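/- **Setting.** Let $m\ge 1$, let $\mathbb D$ be the open unit disk and $\mathbb T$ the unit circle, and let $L^2$ and $H^2$ be the $\mathbb C^m$-valued Lebesgue and Hardy spaces on $\mathbb T$ (functions in $H^2$ are identified with their analytic extensions to $\mathbb D$). Let $P$ be the orthogonal projection of $L^2$ onto $H^2$. For a continuous $\varphi:\mathbb T\to\mathbb C^{m\times m}$ with Fourier coefficients $\varphi_n$ define the following. - $T(\varphi)f=P(\varphi f)$ and $H(\varphi)f=P(\varphi\cdot(I-P)Jf)$ on $H^2$, where $(Jf)(t)=t^{-1}f(t^{-1})$, and $\tilde\varphi(t)=\varphi(1/t)$. - For a scalar inner function $u$ put $K_u=H^2\ominus uH^2$, let $P_u$ be the orthogonal projection of $H^2$ onto $K_u$, and put $Q_u=I-P_u$ and $T_u(\varphi)=P_uT(\varphi)|K_u$. - For $\alpha\in\mathbb D$ put $\mu_\alpha(z)=\frac{z-\alpha}{1-\bar\alpha z}$ and $B_\alpha(z)=\frac{-\bar\alpha}{|\alpha|}\,\frac{z-\alpha}{1-\bar\alpha z}$, with $B_0(z)=z$. - If $\det\varphi$ has a continuous logarithm on $\mathbb T$, put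 $G(\varphi)=\exp\left(\frac1{2\pi}\int_0^{2\pi}\log\det\varphi(e^{i\theta})\,d\theta\right)$, with any continuous logarithm. - Let $\mathcal A$ be the set of all $\varphi$ with $\sum_{n\in\mathbb Z}\|\varphi_n\|+\sum_{n\in\mathbb Z}|n|\,\|\varphi_n\|^2<\infty$. **Theorem.** Let $a\in\mathcal A$ have factorizations $a=w_-w_+=v_+v_-$ such that $w_\pm,v_\pm$ are invertible on $\mathbb T$, the functions $w_\pm,v_\pm$ and their inverses lie in $\mathcal A$, the Fourier coefficients with negative index of $w_+^{\pm1},v_+^{\pm1}$ vanish, and the Fourier coefficients with positive index of $w_-^{\pm1},v_-^{\pm1}$ vanish. Put $b=v_-w_+^{-1}$ and $c=w_-^{-1}v_+$. Let $(\alpha_j)_{j\ge1}$ be a sequence in $\mathbb D$ and $u_N=\prod_{j=1}^N B_{\alpha_j}$. Then $K_{u_N}$ is finite-dimensional for all $N$, $\det(a\circ\mu_{-\beta})$ has a continuous logarithm on $\mathbb T$ for all $\beta\in\mathbb D$, the operator $H(b)H(\tilde c)$ is of trace class, and $\det(I-H(b)H(\tilde c))\neq0$. Moreover, the following hold. 1.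 If $\sum_{j}(1-|\alpha_j|)=\infty$, then $u_N(z)\to0$ for every $z\in\mathbb D$, $Q_{u_N}\to0$ strongly on $H^2$, and $$\lim_{N\to\infty}\det T_{u_N}(a)\prod_{j=1}^N G(a\circ\mu_{-\alpha_j})^{-1}=\frac1{\det(I-H(b)H(\tilde c))}.$$ 2. If $\sum_{j}(1-|\alpha_j|)<\infty$, then the infinite Blaschke product $B(z)=\prod_{j=1}^\infty B_{\alpha_j}(z)$ converges unconditionally and $u_N(z)\to B(z)$ for every $z\in\mathbb D$, $Q_{u_N}\to Q_B$ strongly on $H^2$, $Q_BH(b)H(\tilde c)Q_B$ is of trace class, and $$\lim_{N\to\infty}\det T_{u_N}(a)\prod_{j=1}^N G(a\circ\mu_{-\alpha_j})^{-1}=\frac{\det(I-Q_BH(b)H(\tilde c)Q_B)}{\det(I-H(b)H(\tilde c))}.$$ Here $\det(I-A)$ for a trace class operator $A$ is the Fredholm determinant. -/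

import Mathlib

open MeasureTheory Filter Topology Complex
open scoped ENNReal ComplexConjugate UnitDisc Matrix.Norms.Elementwise

noncomputable section

namespace ModelSpace

/-! ### `L²`, `H²` and Fourier coefficients -/

instance factTwoPiPos : Fact (0 < 2 * Real.pi) := ⟨Real.two_pi_pos⟩

/-- The parameter circle `ℝ / 2πℤ`; its points `θ` parametrize the unit circle by
`t = e^{iθ} = θ.toCircle`, and it carries the normalized Haar measure `dθ / 2π`. -/
abbrev Angle : Type := AddCircle (2 * Real.pi)

/-- The normalized Lebesgue measure on the circle. -/
abbrev σ : Measure Angle := AddCircle.haarAddCircle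

/-- `ℂᵐ` with its Euclidean norm. -/
abbrev Vec (m : ℕ) : Type := EuclideanSpace ℂ (Fin m)

/-- The space `L²` of `ℂᵐ`-valued functions on the unit circle. -/
abbrev L2 (m : ℕ) : Type := Lp (Vec m) 2 σ

/-- The `n`-th Fourier coefficient of a function in `L²`, as a continuous linear map. -/
def coeffCLM (m : ℕ) (n : ℤ) : L2 m →L[ℂ] Vec m :=
  LinearMap.mkContinuous
    { toFun := fun f => fourierCoeff (f : Angle → Vec m) n
      map_add' := fun f g => by
        have hf : Integrable (f : Angle → Vec m) σ :=
          (Lp.memLp f).integrable (by norm_num)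
        have hg : Integrable (g : Angle → Vec m) σ :=
          (Lp.memLp g).integrable (by norm_num)
        rw [fourierCoeff_congr_ae (Lp.coeFn_add f g), fourierCoeff.add hf hg]
        rfl
      map_smul' := fun c f => by
        rw [fourierCoeff_congr_ae (Lp.coeFn_smul c f), fourierCoeff.const_smul]
        rfl } 1
    (fun f => by
      have h2 : eLpNorm (f : Angle → Vec m) 1 σ ≤ eLpNorm (f : Angle → Vec m) 2 σ :=
        eLpNorm_le_eLpNorm_of_exponent_le (by norm_num) (Lp.aestronglyMeasurable f)
      have h3 : ∫ θ, ‖(f : Angle → Vec m) θ‖ ∂σ ≤ ‖f‖ := by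
        rw [integral_norm_eq_lintegral_enorm (Lp.aestronglyMeasurable f),
          ← eLpNorm_one_eq_lintegral_enorm, Lp.norm_def]
        exact ENNReal.toReal_mono (Lp.eLpNorm_ne_top f) h2
      rw [one_mul]
      refine le_trans ?_ h3
      refine (norm_integral_le_integral_norm _).trans (le_of_eq ?_)
      refine integral_congr_ae (Eventually.of_forall fun θ => ?_)
      simp [norm_smul, Circle.norm_coe])

/-- The Hardy space `H²` of the circle: the functions in `L²` whose Fourier coefficients of
negative index vanish. -/
def H2 (m : ℕ) : Submodule ℂ (L2 m) :=
  ⨅ n : {n : ℤ // n < 0}, LinearMap.ker (coeffCLM m n : L2 m →ₗ[ℂ] Vec m)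

theorem mem_H2 {m : ℕ} {f : L2 m} :
    f ∈ H2 m ↔ ∀ n : ℤ, n < 0 → fourierCoeff (f : Angle → Vec m) n = 0 := by
  simp only [H2, Submodule.mem_iInf, LinearMap.mem_ker, Subtype.forall]
  rfl

instance completeSpace_H2 (m : ℕ) : CompleteSpace (H2 m) := by
  have h : IsClosed (H2 m : Set (L2 m)) := by
    rw [H2, Submodule.coe_iInf]
    exact isClosed_iInter fun n => (coeffCLM m n).isClosed_ker
  exact h.completeSpace_coe

/-- The value at `z` in the unit disk of the analytic function with boundary function `f ∈ H²`,
that is, the sum of the power series whose coefficients are the Fourier coefficients of `f`. -/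
def diskValue {m : ℕ} (f : H2 m) (z : 𝔻) : Vec m :=
  ∑' n : ℕ, (z : ℂ) ^ n • coeffCLM m n (f : L2 m)

theorem summable_diskValue {m : ℕ} (f : H2 m) (z : 𝔻) :
    Summable fun n : ℕ => (z : ℂ) ^ n • coeffCLM m n (f : L2 m) := by
  refine Summable.of_norm_bounded (g := fun n : ℕ => ‖(z : ℂ)‖ ^ n * ‖(f : L2 m)‖)
    ((summable_geometric_of_lt_one (norm_nonneg _) z.norm_lt_one).mul_right _) fun n => ?_
  rw [norm_smul, norm_pow]
  have h : ‖coeffCLM m n (f : L2 m)‖ ≤ 1 * ‖(f : L2 m)‖ :=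
    (coeffCLM m n).le_of_opNorm_le
      (LinearMap.mkContinuous_norm_le _ zero_le_one _) (f : L2 m)
  rw [one_mul] at h
  gcongr

/-! ### Multiplication, Toeplitz and Hankel operators -/

/-- The compression `P_V A | V` of an operator `A` to a subspace `V`. -/
def compress {E : Type*} [NormedAddCommGroup E] [InnerProductSpace ℂ E] (V : Submodule ℂ E)
    [V.HasOrthogonalProjection] (A : E →L[ℂ] E) : V →L[ℂ] V :=
  V.orthogonalProjectionOnto ∘L A ∘L V.subtypeL

/-- Continuous `m × m` matrix functions on the unit circle. -/
abbrev Symbol (m : ℕ) : Type := C(Circle, Matrix (Fin m) (Fin m) ℂ)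

/-- A symbol as an operator-valued function of the angle. -/
def Symbol.toCLM {m : ℕ} (a : Symbol m) : C(Angle, Vec m →L[ℂ] Vec m) where
  toFun θ := Matrix.toEuclideanCLM (n := Fin m) (𝕜 := ℂ) (a θ.toCircle)
  continuous_toFun :=
    (LinearMap.continuous_of_finiteDimensional
      ((Matrix.toEuclideanCLM (n := Fin m) (𝕜 := ℂ)).toAlgEquiv.toLinearMap)).comp
      (a.continuous.comp AddCircle.continuous_toCircle)

/-- The operator of multiplication by the matrix function `a` on `L²`. -/
def mulOp {m : ℕ} (a : Symbol m) : L2 m →L[ℂ] L2 m :=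
  (ContinuousLinearMap.id ℂ (Vec m →L[ℂ] Vec m)).holderL σ ∞ 2 2
    (ContinuousMap.toLp ∞ σ ℂ a.toCLM)

/-- The symbol `t ↦ t⁻¹ I`. -/
def invSymbol (m : ℕ) : Symbol m where
  toFun t := ((t⁻¹ : Circle) : ℂ) • (1 : Matrix (Fin m) (Fin m) ℂ)
  continuous_toFun := by fun_prop

/-- The flip operator `(J f)(t) = t⁻¹ f(t⁻¹)` on `L²`. -/
def flipOp (m : ℕ) : L2 m →L[ℂ] L2 m :=
  mulOp (invSymbol m) ∘L
    (Lp.compMeasurePreservingₗᵢ ℂ (fun θ : Angle => -θ)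
      (Measure.measurePreserving_neg σ)).toContinuousLinearMap

/-- The Toeplitz operator `T(a) f = P (a f)` on `H²`. -/
def toeplitz {m : ℕ} (a : Symbol m) : H2 m →L[ℂ] H2 m := compress (H2 m) (mulOp a)

/-- The Hankel operator `H(a) f = P (a · (I - P) J f)` on `H²`. -/
def hankel {m : ℕ} (a : Symbol m) : H2 m →L[ℂ] H2 m :=
  (H2 m).orthogonalProjectionOnto ∘L mulOp a ∘L (1 - (H2 m).starProjection) ∘L
    flipOp m ∘L (H2 m).subtypeL

/-- The reversal `ã(t) = a(1/t)`. -/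
def reversal {m : ℕ} (a : Symbol m) : Symbol m := a.comp ⟨fun t : Circle => t⁻¹, continuous_inv⟩

/-! ### The Wiener and Krein algebras and Wiener–Hopf factors -/

/-- The `n`-th matrix Fourier coefficient of a symbol. -/
def Symbol.coeff {m : ℕ} (a : Symbol m) (n : ℤ) : Matrix (Fin m) (Fin m) ℂ :=
  fourierCoeff (fun θ : Angle => a θ.toCircle) n

/-- Membership in the intersection of the Wiener algebra and the Krein algebra
`K_{2,2}^{1/2,1/2}`; the choice of the matrix norm (here the maximum of the moduli of the entries)
is immaterial. -/
def InWienerKrein {m : ℕ} (a : Symbol m) : Prop :=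
  (Summable fun n : ℤ => ‖a.coeff n‖) ∧ Summable fun n : ℤ => |(n : ℝ)| * ‖a.coeff n‖ ^ 2

/-- `a ∈ H^∞`. -/
def Symbol.IsAnalytic {m : ℕ} (a : Symbol m) : Prop := ∀ n : ℤ, n < 0 → a.coeff n = 0

/-- The complex conjugate of `a` belongs to `H^∞`. -/
def Symbol.IsCoanalytic {m : ℕ} (a : Symbol m) : Prop := ∀ n : ℤ, 0 < n → a.coeff n = 0

/-- A factor of plus type: `w` and `w⁻¹` lie in the Wiener and Krein algebras and in `H^∞`. -/
structure IsPlusFactor {m : ℕ} (w : (Symbol m)ˣ) : Prop where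
  mem : InWienerKrein (w : Symbol m)
  mem_inv : InWienerKrein ((w⁻¹ : (Symbol m)ˣ) : Symbol m)
  analytic : (w : Symbol m).IsAnalytic
  analytic_inv : ((w⁻¹ : (Symbol m)ˣ) : Symbol m).IsAnalytic

/-- A factor of minus type: the complex conjugate of `w` is of plus type. -/
structure IsMinusFactor {m : ℕ} (w : (Symbol m)ˣ) : Prop where
  mem : InWienerKrein (w : Symbol m)
  mem_inv : InWienerKrein ((w⁻¹ : (Symbol m)ˣ) : Symbol m)
  coanalytic : (w : Symbol m).IsCoanalytic
  coanalytic_inv : ((w⁻¹ : (Symbol m)ˣ) : Symbol m).IsCoanalytic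

/-! ### Model spaces -/

/-- The subspace `u H²` of `H²`, for a scalar function `u` on the unit disk. -/
def mulH2 (m : ℕ) (u : 𝔻 → ℂ) : Submodule ℂ (H2 m) where
  carrier := {f | ∃ g : H2 m, ∀ z : 𝔻, diskValue f z = u z • diskValue g z}
  zero_mem' := ⟨0, fun z => by simp [diskValue]⟩
  add_mem' := by
    rintro f₁ f₂ ⟨g₁, h₁⟩ ⟨g₂, h₂⟩
    have hadd : ∀ (f g : H2 m) (z : 𝔻), diskValue (f + g) z = diskValue f z + diskValue g z := by
      intro f g z
      simp only [diskValue, Submodule.coe_add, map_add, smul_add]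
      exact (summable_diskValue f z).tsum_add (summable_diskValue g z)
    exact ⟨g₁ + g₂, fun z => by rw [hadd, hadd, h₁, h₂, smul_add]⟩
  smul_mem' := by
    rintro c f ⟨g, h⟩
    have hsmul : ∀ (f : H2 m) (z : 𝔻), diskValue (c • f) z = c • diskValue f z := by
      intro f z
      simp only [diskValue, Submodule.coe_smul, map_smul]
      rw [← (summable_diskValue f z).tsum_const_smul]
      exact tsum_congr fun n => smul_comm _ _ _
    exact ⟨c • g, fun z => by rw [hsmul, hsmul, h, smul_comm]⟩

/-- The model space `K_u = H² ⊖ u H²`. -/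
def modelSpace (m : ℕ) (u : 𝔻 → ℂ) : Submodule ℂ (H2 m) := (mulH2 m u)ᗮ

instance completeSpace_modelSpace (m : ℕ) (u : 𝔻 → ℂ) : CompleteSpace (modelSpace m u) :=
  inferInstanceAs (CompleteSpace (mulH2 m u)ᗮ)

/-- `Q_u = I - P_u`, where `P_u` is the orthogonal projection of `H²` onto `K_u`. -/
def projQ (m : ℕ) (u : 𝔻 → ℂ) : H2 m →L[ℂ] H2 m := 1 - (modelSpace m u).starProjection

/-- The Toeplitz operator `T_u(a) = P_u T(a) | K_u` on the model space. -/
def modelToeplitz {m : ℕ} (u : 𝔻 → ℂ) (a : Symbol m) : modelSpace m u →L[ℂ] modelSpace m u :=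
  compress (modelSpace m u) (toeplitz a)

/-! ### Blaschke products and geometric means -/

/-- The Blaschke factor `B_α(z) = -(ᾱ / |α|) (z - α) / (1 - ᾱ z)`, with `B_0(z) = z`. -/
def blaschkeFactor (α z : 𝔻) : ℂ :=
  open Classical in
  if α = 0 then (z : ℂ) else
    -conj (α : ℂ) / (‖(α : ℂ)‖ : ℂ) * (((z : ℂ) - α) / (1 - conj (α : ℂ) * z))

/-- The partial product `u_N = B_{α_0} ⋯ B_{α_{N-1}}` for a sequence `α_0, α_1, …`. -/
def partialBlaschke (α : ℕ → 𝔻) (N : ℕ) (z : 𝔻) : ℂ :=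
  ∏ j ∈ Finset.range N, blaschkeFactor (α j) z

/-- The infinite Blaschke product. -/
def infiniteBlaschke (α : ℕ → 𝔻) (z : 𝔻) : ℂ := ∏' j, blaschkeFactor (α j) z

theorem mobius_denom_ne_zero (α : 𝔻) (t : Circle) : 1 - conj (α : ℂ) * (t : ℂ) ≠ 0 := by
  intro h
  have h1 : ‖conj (α : ℂ) * (t : ℂ)‖ = 1 := by
    rw [← sub_eq_zero.mp h, norm_one]
  rw [norm_mul, Circle.norm_coe, mul_one, RCLike.norm_conj] at h1
  exact α.norm_ne_one h1

/-- The Möbius map `μ_α(t) = (t - α) / (1 - ᾱ t)` as a continuous map of the unit circle. -/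
def mobius (α : 𝔻) : C(Circle, Circle) where
  toFun t := ⟨((t : ℂ) - α) / (1 - conj (α : ℂ) * t), by
    have hd := mobius_denom_ne_zero α t
    have key : ‖(t : ℂ) - α‖ = ‖1 - conj (α : ℂ) * t‖ := by
      have h : (1 - conj (α : ℂ) * t) = t * conj ((t : ℂ) - α) := by
        have ht : (t : ℂ) * conj (t : ℂ) = 1 := by
          rw [Complex.mul_conj, Circle.normSq_coe, Complex.ofReal_one]
        rw [map_sub, mul_sub, ht]
        ring
      rw [h, norm_mul, Circle.norm_coe, one_mul, RCLike.norm_conj]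
    change _ ∈ Metric.sphere (0 : ℂ) 1
    rw [mem_sphere_zero_iff_norm, norm_div, key, div_self (norm_ne_zero_iff.mpr hd)]⟩
  continuous_toFun := by
    refine Continuous.subtype_mk ?_ _
    exact Continuous.div (by fun_prop) (by fun_prop) (mobius_denom_ne_zero α)

/-- `ℓ` is a continuous logarithm of `det φ` on the unit circle. -/
def IsLogDet {m : ℕ} (φ : Symbol m) (ℓ : C(Circle, ℂ)) : Prop :=
  ∀ t : Circle, Complex.exp (ℓ t) = (φ t).det

open Classical in
/-- The geometric mean `G(φ) = exp ((1/2π) ∫₀^{2π} log det φ(e^{iθ}) dθ)`, where `log det φ` is a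
continuous logarithm of `det φ`. Two such logarithms differ by a constant in `2πiℤ`, so the value
does not depend on the choice; it is set to `0` if there is no continuous logarithm. -/
def geomMean {m : ℕ} (φ : Symbol m) : ℂ :=
  if h : ∃ ℓ : C(Circle, ℂ), IsLogDet φ ℓ then
    Complex.exp (((1 / (2 * Real.pi) : ℝ) : ℂ) *
      ∫ θ in (0 : ℝ)..(2 * Real.pi), h.choose (Circle.exp θ))
  else 0

/-! ### Determinants of identity minus trace class -/

section Determinant

variable {E : Type*} [NormedAddCommGroup E] [InnerProductSpace ℂ E]

/-- Trace class operators: the trace norm, which is the supremum of the sums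
`∑ |⟨e_i, A f_i⟩|` over all pairs of finite orthonormal systems, is finite. -/
def IsTraceClass (A : E →L[ℂ] E) : Prop :=
  ∃ C : ℝ, ∀ (n : ℕ) (e f : Fin n → E), Orthonormal ℂ e → Orthonormal ℂ f →
    ∑ i, ‖inner ℂ (e i) (A (f i))‖ ≤ C

/-- The determinant of the compression of `A` to a finite-dimensional subspace `V`. -/
def detCompress (A : E →L[ℂ] E) (V : {V : Submodule ℂ E // FiniteDimensional ℂ V}) : ℂ :=
  haveI := V.2
  LinearMap.det (compress V.1 A : V.1 →ₗ[ℂ] V.1)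

/-- `A` is of trace class and `d` is the (Fredholm) determinant `det (I - A)`: the limit of
the determinants of the compressions of `I - A` to the finite-dimensional subspaces, directed by
inclusion. -/
def IsDetOneSub (A : E →L[ℂ] E) (d : ℂ) : Prop :=
  IsTraceClass A ∧ Tendsto (detCompress (1 - A)) atTop (𝓝 d)

end Determinant

/-- The normalized determinant `det T_{u_N}(a) ∏_{α ∈ σ(u_N)} G(a ∘ μ_{-α})⁻¹`. -/
def normalizedDet {m : ℕ} (a : Symbol m) (α : ℕ → 𝔻) (N : ℕ) : ℂ :=
  LinearMap.det (modelToeplitz (partialBlaschke α N) a :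
      modelSpace m (partialBlaschke α N) →ₗ[ℂ] modelSpace m (partialBlaschke α N)) *
    ∏ j ∈ Finset.range N, (geomMean (a.comp (mobius (-(α j)))))⁻¹

/-- The operator `H(b) H(c̃)`. -/
def hankelProduct {m : ℕ} (b c : Symbol m) : H2 m →L[ℂ] H2 m :=
  hankel b ∘L hankel (reversal c)

end ModelSpace

end

/-! Put `K = H(b)H(c̃)`. Since `bc = 1`, inserting `P + (I - P)` between the two factors gives `I -
K = T(b)T(c)`. The rule `T(fg) = T(f)T(g)`, valid for coanalytic `f` or analytic `g`, then shows
that `X = T(v₊⁻¹)T(a)T(v₋⁻¹)` satisfies `(I - K)X = I` and `T(a) = T(v₊) X T(v₋)`.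

The model space of `u_N` is invariant under `T(v₋)` and under `T(v₊)*`, so the determinant of the
compression of `T(a)` is the product of those of `T(v₊)`, `X` and `T(v₋)`. The outer two are
explicit: `K_{u_{N+1}}` is the orthogonal sum of `K_{u_N}` and the functions `u_N x / (1 - ᾱ_N t)`,
a coanalytic Toeplitz operator is triangular along this flag, and its diagonal blocks are values of
the symbol inside the disk (`toeplitz_kernel`, `detCompress_toeplitz_modelSpace`). By the mean value
property these values combine to `G(a ∘ μ_{-α_j})`, so the outer factors cancel the normalization.

For the middle factor, Jacobi's identity for complementary minors (`IsDetOneSub.jacobi`) reads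
`det(I - K) det(P_u X P_u) = det(I - Q_u K Q_u)`. Hence the normalized determinant equals `det(I -
Q_{u_N} K Q_{u_N}) / det(I - K)` exactly, for every `N`.

What is left is continuity. `K` is a product of two Hilbert-Schmidt operators, so strong convergence
of `Q_{u_N}` gives trace norm convergence of `Q_{u_N} K Q_{u_N}` (`eventually_traceBound_conj_sub`),
and determinants are continuous in the trace norm (`norm_det_sub_det_le`). The strong limit comes
from the intersection of the spaces `u_N H²`, which is zero or `BH²` (`iInf_mulH2_eq_bot`,
`iInf_mulH2_eq`). -/

noncomputable section

namespace ModelSpace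

/-! ### Trace bounds and determinants on finite-dimensional subspaces -/

section Fredholm

variable {E F : Type*} [NormedAddCommGroup E] [InnerProductSpace ℂ E]
  [NormedAddCommGroup F] [InnerProductSpace ℂ F]

/-- The trace norm of `A` is at most `C`. -/
def TraceBound (A : E →L[ℂ] E) (C : ℝ) : Prop :=
  ∀ (n : ℕ) (e f : Fin n → E), Orthonormal ℂ e → Orthonormal ℂ f →
    ∑ i, ‖inner ℂ (e i) (A (f i))‖ ≤ C

theorem TraceBound.mono {A : E →L[ℂ] E} {C D : ℝ} (h : TraceBound A C) (hCD : C ≤ D) :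
    TraceBound A D :=
  fun n e f he hf => (h n e f he hf).trans hCD

theorem TraceBound.add {A B : E →L[ℂ] E} {C D : ℝ} (hA : TraceBound A C) (hB : TraceBound B D) :
    TraceBound (A + B) (C + D) := by
  intro n e f he hf
  refine le_trans ?_ (add_le_add (hA n e f he hf) (hB n e f he hf))
  rw [← Finset.sum_add_distrib]
  refine Finset.sum_le_sum fun i _ => ?_
  rw [add_apply, inner_add_right]
  exact norm_add_le _ _

theorem TraceBound.smul {A : E →L[ℂ] E} {C : ℝ} (hA : TraceBound A C) (z : ℂ) :
    TraceBound (z • A) (‖z‖ * C) := by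
  intro n e f he hf
  refine le_trans (le_of_eq ?_) (mul_le_mul_of_nonneg_left (hA n e f he hf) (norm_nonneg z))
  rw [Finset.mul_sum]
  refine Finset.sum_congr rfl fun i _ => ?_
  rw [smul_apply, inner_smul_right, norm_mul]

theorem TraceBound.compress {A : E →L[ℂ] E} {C : ℝ} (h : TraceBound A C) (V : Submodule ℂ E)
    [V.HasOrthogonalProjection] : TraceBound (compress V A) C := by
  intro n e f he hf
  refine le_trans (le_of_eq ?_) (h n (fun i => e i) (fun i => f i)
    (he.comp_linearIsometry V.subtypeₗᵢ) (hf.comp_linearIsometry V.subtypeₗᵢ))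
  refine Finset.sum_congr rfl fun i _ => ?_
  simp [ModelSpace.compress]

theorem compress_sub (A B : E →L[ℂ] E) (V : Submodule ℂ E) [V.HasOrthogonalProjection] :
    compress V (A - B) = compress V A - compress V B := by
  ext x
  simp [compress]

theorem compress_one (V : Submodule ℂ E) [V.HasOrthogonalProjection] :
    compress V (1 : E →L[ℂ] E) = 1 := by
  ext x
  simp [compress]

/-- Let `e` be the Gram-Schmidt basis of the images `M f_i` of an orthonormal basis under `M = 1 -
A`. Then `⟨e_i, M f_j⟩` is triangular, so `|det M|` is the product of the moduli of its diagonal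
entries, each at most `1 + |⟨e_i, A f_i⟩|`. The trace bound applies to this pair of bases. -/
theorem norm_det_one_sub_le [FiniteDimensional ℂ E] {A : E →L[ℂ] E} {C : ℝ}
    (hA : TraceBound A C) :
    ‖LinearMap.det ((1 - A : E →L[ℂ] E) : E →ₗ[ℂ] E)‖ ≤ Real.exp C := by
  set f := stdOrthonormalBasis ℂ E with hf
  have hcard : Module.finrank ℂ E = Fintype.card (Fin (Module.finrank ℂ E)) := by simp
  set M : E →ₗ[ℂ] E := ((1 - A : E →L[ℂ] E) : E →ₗ[ℂ] E) with hM
  set e := InnerProductSpace.gramSchmidtOrthonormalBasis hcard (fun i => M (f i)) with he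
  have h1 : e.toBasis.det (fun i => M (f i)) = ∏ i, inner ℂ (e i) (M (f i)) :=
    InnerProductSpace.gramSchmidtOrthonormalBasis_det hcard _
  have h2 : e.toBasis.det (fun i => M (f i)) = LinearMap.det M * e.toBasis.det f := by
    have := e.toBasis.det_comp M f
    exact this
  have h3 : ‖e.toBasis.det f‖ = 1 := e.det_to_matrix_orthonormalBasis f
  have h4 : ‖LinearMap.det M‖ = ∏ i, ‖inner ℂ (e i) (M (f i))‖ := by
    rw [← norm_prod, ← h1, h2, norm_mul, h3, mul_one]
  rw [h4]
  calc ∏ i, ‖inner ℂ (e i) (M (f i))‖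
      ≤ ∏ i, Real.exp ‖inner ℂ (e i) (A (f i))‖ := by
        refine Finset.prod_le_prod (fun i _ => norm_nonneg _) fun i _ => ?_
        have : inner ℂ (e i) (M (f i)) = inner ℂ (e i) (f i) - inner ℂ (e i) (A (f i)) := by
          rw [hM, ← inner_sub_right]; rfl
        rw [this]
        have h5 : ‖inner ℂ (e i) (f i)‖ ≤ 1 := by
          refine (norm_inner_le_norm _ _).trans ?_
          rw [e.orthonormal.1 i, f.orthonormal.1 i, one_mul]
        have h6 := Real.add_one_le_exp ‖inner ℂ (e i) (A (f i))‖
        have h7 := norm_sub_le (inner ℂ (e i) (f i)) (inner ℂ (e i) (A (f i)))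
        linarith
    _ = Real.exp (∑ i, ‖inner ℂ (e i) (A (f i))‖) := (Real.exp_sum _ _).symm
    _ ≤ Real.exp C := Real.exp_le_exp.mpr (hA _ _ _ e.orthonormal f.orthonormal)

theorem differentiable_det_add_smul [FiniteDimensional ℂ E] (A B : E →ₗ[ℂ] E) :
    Differentiable ℂ fun z : ℂ => LinearMap.det (A + z • B) := by
  have h : (fun z : ℂ => LinearMap.det (A + z • B)) = fun z : ℂ =>
      (LinearMap.toMatrix (Module.finBasis ℂ E) (Module.finBasis ℂ E) A +
        z • LinearMap.toMatrix (Module.finBasis ℂ E) (Module.finBasis ℂ E) B).det := by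
    funext z
    rw [← LinearMap.det_toMatrix (Module.finBasis ℂ E), map_add, map_smul]
  rw [h]
  simp only [Matrix.det_apply, Matrix.add_apply, Matrix.smul_apply]
  fun_prop

/-- Schwarz's lemma for `z ↦ det(1 - A - z(B - A))`: on the disk of radius `1/ε` the trace norm of
`A + z(B - A)` is at most `C + 1`, so the function stays within `2 exp(C + 1)` of its value at `0`,
and the points `0` and `1` are compared. -/
theorem norm_det_sub_det_le [FiniteDimensional ℂ E] {A B : E →L[ℂ] E} {C ε : ℝ} (hε : 0 < ε)
    (hε1 : ε < 1) (hA : TraceBound A C) (hB : TraceBound (B - A) ε) :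
    ‖LinearMap.det ((1 - B : E →L[ℂ] E) : E →ₗ[ℂ] E) -
      LinearMap.det ((1 - A : E →L[ℂ] E) : E →ₗ[ℂ] E)‖ ≤ 2 * Real.exp (C + 1) * ε := by
  set f : ℂ → ℂ := fun z => LinearMap.det
    (((1 - A : E →L[ℂ] E) : E →ₗ[ℂ] E) + z • ((A - B : E →L[ℂ] E) : E →ₗ[ℂ] E)) with hf
  have hd : Differentiable ℂ f := differentiable_det_add_smul _ _
  have hbound : ∀ z : ℂ, ‖z‖ * ε ≤ 1 → ‖f z‖ ≤ Real.exp (C + 1) := by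
    intro z hz
    have h1 : f z = LinearMap.det ((1 - (A + z • (B - A)) : E →L[ℂ] E) : E →ₗ[ℂ] E) := by
      simp only [hf]
      congr 1
      ext x
      simp [smul_sub]
      abel
    rw [h1]
    refine (norm_det_one_sub_le (hA.add (hB.smul z))).trans ?_
    gcongr
  have h0 : f 0 = LinearMap.det ((1 - A : E →L[ℂ] E) : E →ₗ[ℂ] E) := by simp [hf]
  have h1 : f 1 = LinearMap.det ((1 - B : E →L[ℂ] E) : E →ₗ[ℂ] E) := by
    simp only [hf]
    congr 1
    ext x
    simp
  have hmaps : Set.MapsTo f (Metric.ball 0 (1 / ε))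
      (Metric.closedBall (f 0) (2 * Real.exp (C + 1))) := by
    intro z hz
    rw [mem_ball_zero_iff, lt_div_iff₀ hε] at hz
    rw [mem_closedBall_iff_norm]
    have h2 := hbound z hz.le
    have h3 := hbound 0 (by simp)
    have := norm_sub_le (f z) (f 0)
    linarith
  have hmem : (1 : ℂ) ∈ Metric.ball (0 : ℂ) (1 / ε) := by
    rw [mem_ball_zero_iff, norm_one, lt_div_iff₀ hε]
    linarith
  have key := Complex.dist_le_div_mul_dist_of_mapsTo_ball hd.differentiableOn hmaps hmem
  rw [← h0, ← h1, ← dist_eq_norm]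
  refine key.trans (le_of_eq ?_)
  simp

theorem norm_detCompress_sub_le {A B : E →L[ℂ] E} {C ε : ℝ} (hε : 0 < ε)
    (hε1 : ε < 1) (hA : TraceBound A C) (hB : TraceBound (B - A) ε)
    (V : {V : Submodule ℂ E // FiniteDimensional ℂ V}) :
    ‖detCompress (1 - B) V - detCompress (1 - A) V‖ ≤ 2 * Real.exp (C + 1) * ε := by
  have := V.2
  unfold detCompress
  have h := norm_det_sub_det_le hε hε1 (hA.compress V.1)
    (by simpa only [compress_sub] using hB.compress V.1)
  simpa only [compress_sub, compress_one] using h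

/-! ### Block triangular compressions -/

theorem detCompress_eq_det {ι : Type*} [Fintype ι] [DecidableEq ι] (A : E →L[ℂ] E)
    (V : {V : Submodule ℂ E // FiniteDimensional ℂ V}) (e : ι → E) (he : Orthonormal ℂ e)
    (hV : Submodule.span ℂ (Set.range e) = V.1) :
    detCompress A V = Matrix.det (Matrix.of fun i j => inner ℂ (e i) (A (e j))) := by
  obtain ⟨V, hfin⟩ := V
  subst hV
  simp only [detCompress]
  let f : ι → Submodule.span ℂ (Set.range e) := fun i => ⟨e i, Submodule.subset_span ⟨i, rfl⟩⟩
  have hf : Orthonormal ℂ f := by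
    rw [orthonormal_iff_ite] at he ⊢
    exact he
  have hspan : ⊤ ≤ Submodule.span ℂ (Set.range f) := by
    rintro ⟨x, hx⟩ -
    have : Submodule.map (Submodule.span ℂ (Set.range e)).subtype
        (Submodule.span ℂ (Set.range f)) = Submodule.span ℂ (Set.range e) := by
      rw [Submodule.map_span, ← Set.range_comp]
      rfl
    rw [← this] at hx
    obtain ⟨y, hy, hyx⟩ := hx
    have : y = ⟨x, by rw [← hyx]; exact y.2⟩ := Subtype.ext hyx
    rw [← this]
    exact hy
  let c := OrthonormalBasis.mk hf hspan
  rw [← LinearMap.det_toMatrix c.toBasis]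
  congr 1
  ext i j
  rw [LinearMap.toMatrix_apply]
  simp [c, f, compress, OrthonormalBasis.repr_apply_apply]

/-- The images of `V` under `A` have no component in `V'`, so in an adapted orthonormal basis the
matrix of the compression is block upper triangular. -/
theorem detCompress_sup {V V' W : {V : Submodule ℂ E // FiniteDimensional ℂ V}}
    (hW : W.1 = V.1 ⊔ V'.1) (horth : V.1 ⟂ V'.1) (A : E →L[ℂ] E)
    (hA : ∀ x ∈ V.1, ∀ y ∈ V'.1, inner ℂ y (A x) = 0) :
    detCompress A W = detCompress A V * detCompress A V' := by
  have := V.2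
  have := V'.2
  set e := stdOrthonormalBasis ℂ V.1
  set f := stdOrthonormalBasis ℂ V'.1
  let g : Fin (Module.finrank ℂ V.1) ⊕ Fin (Module.finrank ℂ V'.1) → E :=
    Sum.elim (fun i => (e i : E)) (fun i => (f i : E))
  have he : Orthonormal ℂ (fun i => (e i : E)) :=
    e.orthonormal.comp_linearIsometry V.1.subtypeₗᵢ
  have hf : Orthonormal ℂ (fun i => (f i : E)) :=
    f.orthonormal.comp_linearIsometry V'.1.subtypeₗᵢ
  have hes : Submodule.span ℂ (Set.range fun i => (e i : E)) = V.1 := by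
    have := congrArg (Submodule.map V.1.subtype) e.toBasis.span_eq
    rw [Submodule.map_span, ← Set.range_comp, Submodule.map_subtype_top] at this
    simpa [Function.comp_def] using this
  have hfs : Submodule.span ℂ (Set.range fun i => (f i : E)) = V'.1 := by
    have := congrArg (Submodule.map V'.1.subtype) f.toBasis.span_eq
    rw [Submodule.map_span, ← Set.range_comp, Submodule.map_subtype_top] at this
    simpa [Function.comp_def] using this
  have hg : Orthonormal ℂ g := by
    rw [orthonormal_iff_ite] at he hf ⊢
    rintro (i | i) (j | j)
    · simpa [g] using he i j
    · simpa [g] using Submodule.isOrtho_iff_inner_eq.mp horth _ (e i).2 _ (f j).2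
    · simpa [g] using Submodule.isOrtho_iff_inner_eq.mp horth.symm _ (f i).2 _ (e j).2
    · simpa [g] using hf i j
  have hgs : Submodule.span ℂ (Set.range g) = W.1 := by
    rw [hW, Set.Sum.elim_range, Submodule.span_union, hes, hfs]
  rw [detCompress_eq_det A W g hg hgs, detCompress_eq_det A V _ he hes,
    detCompress_eq_det A V' _ hf hfs, ← Matrix.det_fromBlocks_zero₂₁ _
      (Matrix.of fun i j => inner ℂ (e i : E) (A (f j)))]
  congr 1
  ext (i | i) (j | j)
  · rfl
  · rfl
  · simpa [g] using hA _ (e j).2 _ (f i).2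
  · rfl

end Fredholm

/-! ### Fredholm determinants of products of Hilbert-Schmidt operators -/

section Fredholm

variable {E F : Type*} [NormedAddCommGroup E] [InnerProductSpace ℂ E]
  [NormedAddCommGroup F] [InnerProductSpace ℂ F]

instance isDirectedOrder_finiteDimensional :
    IsDirectedOrder {V : Submodule ℂ E // FiniteDimensional ℂ V} where
  directed V W := by
    have := V.2
    have := W.2
    exact ⟨⟨V.1 ⊔ W.1, inferInstance⟩, le_sup_left (a := V.1), le_sup_right (a := V.1)⟩

instance nonempty_finiteDimensional :
    Nonempty {V : Submodule ℂ E // FiniteDimensional ℂ V} := ⟨⟨⊥, inferInstance⟩⟩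

theorem detCompress_congr {A B : E →L[ℂ] E} {V : {V : Submodule ℂ E // FiniteDimensional ℂ V}}
    (h : ∀ x ∈ V.1, ∀ y ∈ V.1, inner ℂ y (A x) = inner ℂ y (B x)) :
    detCompress A V = detCompress B V := by
  have := V.2
  unfold detCompress
  congr 2
  ext x
  congr 1
  refine ext_inner_left ℂ fun y => ?_
  simpa [compress] using h x x.2 y y.2

theorem detCompress_eq_one {A : E →L[ℂ] E} {V : {V : Submodule ℂ E // FiniteDimensional ℂ V}}
    (h : ∀ x ∈ V.1, ∀ y ∈ V.1, inner ℂ y (A x) = inner ℂ y x) : detCompress A V = 1 := by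
  have := V.2
  rw [detCompress_congr (B := 1) (by simpa using h)]
  unfold detCompress
  rw [compress_one]
  exact LinearMap.det_id

theorem detCompress_comp_of_mapsTo (A Y : E →L[ℂ] E)
    (W : {V : Submodule ℂ E // FiniteDimensional ℂ V}) (hY : ∀ x ∈ W.1, Y x ∈ W.1) :
    detCompress (A ∘L Y) W = detCompress A W * detCompress Y W := by
  have := W.2
  unfold detCompress
  rw [← LinearMap.det_comp]
  congr 1
  ext x
  have h : ((W.1.orthogonalProjectionOnto (Y x) : W.1) : E) = Y x :=
    Submodule.starProjection_eq_self_iff.mpr (hY x x.2)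
  simp [compress, h]

/-- The part of `W` orthogonal to `V`. -/
def relCompl (V W : {V : Submodule ℂ E // FiniteDimensional ℂ V}) :
    {V : Submodule ℂ E // FiniteDimensional ℂ V} :=
  ⟨W.1 ⊓ V.1ᗮ, have := W.2; Submodule.finiteDimensional_inf_left _ _⟩

theorem sup_relCompl {V W : {V : Submodule ℂ E // FiniteDimensional ℂ V}} (h : V ≤ W) :
    W.1 = V.1 ⊔ (relCompl V W).1 := by
  have := V.2
  have h' : V.1 ≤ W.1 := h
  have := Submodule.sup_orthogonal_inf_of_hasOrthogonalProjection h'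
  rw [inf_comm] at this
  exact this.symm

theorem isOrtho_relCompl (V W : {V : Submodule ℂ E // FiniteDimensional ℂ V}) :
    V.1 ⟂ (relCompl V W).1 :=
  (Submodule.isOrtho_orthogonal_right V.1).mono_right inf_le_right

theorem starProjection_of_mem_orthogonal {V : Submodule ℂ E} [V.HasOrthogonalProjection] {x : E}
    (hx : x ∈ Vᗮ) : V.starProjection x = 0 :=
  (Submodule.starProjection_apply_eq_zero_iff V).mpr hx

/-- `1 - PKP` is block diagonal for `V` and its complement in `W`, and is the identity on the
latter. The value at `V` thus becomes a determinant on any larger `W`, where trace norm estimates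
can compare it with that of `1 - K`. -/
theorem detCompress_one_sub_conj (K : E →L[ℂ] E)
    {V W : {V : Submodule ℂ E // FiniteDimensional ℂ V}} [V.1.HasOrthogonalProjection]
    (h : V ≤ W) :
    detCompress (1 - V.1.starProjection ∘L K ∘L V.1.starProjection) W =
      detCompress (1 - K) V := by
  have hx0 : ∀ x ∈ (relCompl V W).1, V.1.starProjection x = 0 :=
    fun x hx => starProjection_of_mem_orthogonal hx.2
  rw [detCompress_sup (sup_relCompl h) (isOrtho_relCompl V W)]
  · rw [detCompress_eq_one (V := relCompl V W), mul_one]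
    · refine detCompress_congr fun x hx y hy => ?_
      have hx1 := Submodule.starProjection_eq_self_iff.mpr hx
      have hy1 := Submodule.starProjection_eq_self_iff.mpr hy
      simp only [sub_apply, ContinuousLinearMap.comp_apply, hx1, inner_sub_right]
      rw [← Submodule.inner_starProjection_left_eq_right, hy1]
    · intro x hx y hy
      simp [hx0 x hx]
  · intro x hx y hy
    have h1 : inner ℂ y x = 0 :=
      Submodule.isOrtho_iff_inner_eq.mp (isOrtho_relCompl V W).symm y hy x hx
    simp only [sub_apply, ContinuousLinearMap.comp_apply, inner_sub_right]
    rw [← Submodule.inner_starProjection_left_eq_right, hx0 y hy]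
    simp [h1]

/-- Jacobi's identity for complementary minors, on sufficiently large subspaces. -/
theorem detCompress_mul_detCompress_inverse (K X : E →L[ℂ] E) (hX : (1 - K) ∘L X = 1)
    {V W : {V : Submodule ℂ E // FiniteDimensional ℂ V}} [V.1.HasOrthogonalProjection]
    (h : V ≤ W) (hXW : ∀ x ∈ V.1, X x ∈ W.1) :
    detCompress (1 - K) W * detCompress X V =
      detCompress (1 - (1 - V.1.starProjection) ∘L K ∘L (1 - V.1.starProjection)) W := by
  set P := V.1.starProjection with hP
  have hPx : ∀ x ∈ V.1, P x = x := fun x hx => Submodule.starProjection_eq_self_iff.mpr hx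
  have hPV : ∀ x, P x ∈ V.1 := fun x => Submodule.starProjection_apply_mem _ _
  have hx0 : ∀ x ∈ (relCompl V W).1, P x = 0 :=
    fun x hx => starProjection_of_mem_orthogonal hx.2
  have hPs : ∀ x y, inner ℂ (P x) y = inner ℂ x (P y) :=
    fun x y => Submodule.inner_starProjection_left_eq_right _ _ _
  have horth : ∀ x ∈ V.1, ∀ y ∈ (relCompl V W).1, inner ℂ y x = 0 := fun x hx y hy =>
    Submodule.isOrtho_iff_inner_eq.mp (isOrtho_relCompl V W).symm y hy x hx
  have horth' : ∀ x ∈ (relCompl V W).1, ∀ y ∈ V.1, inner ℂ y x = 0 := fun x hx y hy =>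
    Submodule.isOrtho_iff_inner_eq.mp (isOrtho_relCompl V W) y hy x hx
  -- The operator `XP + (1 - P)` replaces the columns belonging to `V` by those of the inverse;
  -- multiplying by `1 - K` turns them into columns of the identity.
  have h1 : (1 - K) ∘L (X ∘L P + (1 - P)) = 1 - K ∘L (1 - P) := by
    rw [ContinuousLinearMap.comp_add, ← ContinuousLinearMap.comp_assoc, hX]
    ext x
    simp
    abel
  have h2 : detCompress (X ∘L P + (1 - P)) W = detCompress X V := by
    rw [detCompress_sup (V := relCompl V W) (V' := V) (by rw [sup_comm]; exact sup_relCompl h)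
      (isOrtho_relCompl V W).symm, detCompress_eq_one (V := relCompl V W), one_mul]
    · refine detCompress_congr fun x hx y hy => ?_
      simp [hPx x hx]
    · intro x hx y hy
      simp [hx0 x hx]
    · intro x hx y hy
      simp [hx0 x hx, horth' x hx y hy]
  rw [← h2, ← detCompress_comp_of_mapsTo, h1]
  -- Both `1 - K(1 - P)` and `1 - (1 - P)K(1 - P)` fix `V` pointwise, so both are triangular, and
  -- their blocks on the complement of `V` in `W` agree.
  · rw [detCompress_sup (sup_relCompl h) (isOrtho_relCompl V W),
      detCompress_sup (sup_relCompl h) (isOrtho_relCompl V W)]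
    · congr 1
      · refine detCompress_congr fun x hx y hy => ?_
        simp [hPx x hx]
      · refine detCompress_congr fun x hx y hy => ?_
        simp [← hPs, hx0 y hy]
    · intro x hx y hy
      simp [hPx x hx, horth x hx y hy]
    · intro x hx y hy
      simp [hPx x hx, horth x hx y hy]
  · intro x hx
    simp only [add_apply, ContinuousLinearMap.comp_apply, sub_apply,
      one_apply_eq_self]
    exact W.1.add_mem (hXW _ (hPV x)) (W.1.sub_mem hx (h (hPV x)))

theorem tendsto_starProjection_finiteDimensional (x : E) :
    Tendsto (fun V : {V : Submodule ℂ E // FiniteDimensional ℂ V} =>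
      (have := V.2; V.1.starProjection) x) atTop (𝓝 x) := by
  -- The net is eventually constant: `P_V x = x` as soon as `x` lies in `V`.
  refine tendsto_const_nhds.congr' ?_
  filter_upwards [Ici_mem_atTop (⟨Submodule.span ℂ {x}, inferInstance⟩ :
    {V : Submodule ℂ E // FiniteDimensional ℂ V})] with V hV
  have := V.2
  have hV' : Submodule.span ℂ {x} ≤ V.1 := hV
  exact (Submodule.starProjection_eq_self_iff.mpr
    (hV' (Submodule.mem_span_singleton_self x))).symm

/-! ### Hilbert-Schmidt factors and trace norm convergence -/

variable [CompleteSpace E] [CompleteSpace F] {ι : Type*} (b : HilbertBasis ι ℂ F)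

omit [CompleteSpace F] in
theorem hasSum_norm_inner_sq (x : F) : HasSum (fun k => ‖inner ℂ (b k) x‖ ^ 2) (‖x‖ ^ 2) := by
  have := b.hasSum_inner_mul_inner x x
  rw [inner_self_eq_norm_sq_to_K] at this
  have h2 := Complex.hasSum_re this
  convert! h2 using 1
  · funext k
    have h3 := inner_mul_symm_re_eq_norm (𝕜 := ℂ) x (b k)
    rw [norm_mul, norm_inner_symm x] at h3
    rw [sq]
    exact h3.symm
  · norm_cast

-- Expanding each `‖T* e_i‖²` in the basis `b` and exchanging the sums leaves `∑_i |⟨e_i, T b_k⟩|²`,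
-- which Bessel's inequality bounds by `‖T b_k‖²`.
include b in
theorem sum_norm_adjoint_sq_le (T : F →L[ℂ] E) (hT : Summable fun k => ‖T (b k)‖ ^ 2)
    {n : ℕ} {e : Fin n → E} (he : Orthonormal ℂ e) :
    ∑ i, ‖ContinuousLinearMap.adjoint T (e i)‖ ^ 2 ≤ ∑' k, ‖T (b k)‖ ^ 2 := by
  have h2 := hasSum_sum (s := Finset.univ) fun i _ =>
    hasSum_norm_inner_sq b (ContinuousLinearMap.adjoint T (e i))
  refine hasSum_le (fun k => ?_) h2 hT.hasSum
  refine le_trans (le_of_eq ?_) (he.sum_inner_products_le (T (b k)) (s := Finset.univ))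
  refine Finset.sum_congr rfl fun i _ => ?_
  rw [ContinuousLinearMap.adjoint_inner_right, norm_inner_symm]

-- Write `⟨e_i, SR f_i⟩ = ⟨S* e_i, R f_i⟩` and apply the Cauchy-Schwarz inequality twice, first in
-- the space and then in the sum.
include b in
theorem traceBound_comp (S : F →L[ℂ] E) (R : E →L[ℂ] F)
    (hS : Summable fun k => ‖S (b k)‖ ^ 2)
    (hR : Summable fun k => ‖ContinuousLinearMap.adjoint R (b k)‖ ^ 2) :
    TraceBound (S ∘L R) (√(∑' k, ‖S (b k)‖ ^ 2) *
      √(∑' k, ‖ContinuousLinearMap.adjoint R (b k)‖ ^ 2)) := by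
  intro n e f he hf
  calc ∑ i, ‖inner ℂ (e i) ((S ∘L R) (f i))‖
      ≤ ∑ i, ‖ContinuousLinearMap.adjoint S (e i)‖ * ‖R (f i)‖ := by
        refine Finset.sum_le_sum fun i _ => ?_
        rw [ContinuousLinearMap.comp_apply, ← ContinuousLinearMap.adjoint_inner_left]
        exact norm_inner_le_norm _ _
    _ ≤ √(∑ i, ‖ContinuousLinearMap.adjoint S (e i)‖ ^ 2) * √(∑ i, ‖R (f i)‖ ^ 2) :=
        Real.sum_mul_le_sqrt_mul_sqrt _ _ _
    _ ≤ _ := by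
        gcongr
        · exact sum_norm_adjoint_sq_le b S hS he
        · have := sum_norm_adjoint_sq_le b _ hR hf
          simpa using this

-- Strong convergence becomes Hilbert-Schmidt convergence after composition with a Hilbert-Schmidt
-- operator, by dominated convergence; the majorant `4‖x_k‖²` comes from `‖M_j - N‖ ≤ 2`.
omit [CompleteSpace E] in
theorem tendsto_tsum_norm_sub_sq {J : Type*} {l : Filter J} {M : J → E →L[ℂ] E} {N : E →L[ℂ] E}
    (hM : ∀ x, Tendsto (fun j => M j x) l (𝓝 (N x))) (hMn : ∀ j x, ‖M j x‖ ≤ ‖x‖)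
    (hNn : ∀ x, ‖N x‖ ≤ ‖x‖) (x : ι → E) (hx : Summable fun k => ‖x k‖ ^ 2) :
    Tendsto (fun j => ∑' k, ‖(M j - N) (x k)‖ ^ 2) l (𝓝 0) := by
  have h0 : (0 : ℝ) = ∑' k : ι, (0 : ℝ) := by simp
  rw [h0]
  refine tendsto_tsum_of_dominated_convergence (bound := fun k => 4 * ‖x k‖ ^ 2)
    (hx.mul_left 4) (fun k => ?_) (Eventually.of_forall fun j k => ?_)
  · have h1 : Tendsto (fun j => (M j - N) (x k)) l (𝓝 0) := by
      simpa using (hM (x k)).sub_const (N (x k))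
    simpa using h1.norm.pow 2
  · rw [Real.norm_of_nonneg (by positivity)]
    have h1 : ‖(M j - N) (x k)‖ ≤ 2 * ‖x k‖ := by
      rw [sub_apply]
      have := norm_sub_le (M j (x k)) (N (x k))
      have := hMn j (x k)
      have := hNn (x k)
      linarith
    calc ‖(M j - N) (x k)‖ ^ 2 ≤ (2 * ‖x k‖) ^ 2 := by gcongr
      _ = 4 * ‖x k‖ ^ 2 := by ring

omit [CompleteSpace E] in
theorem summable_norm_apply_sq {N : E →L[ℂ] E} {C : ℝ} (hN : ∀ x, ‖N x‖ ≤ C * ‖x‖) {x : ι → E}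
    (hx : Summable fun k => ‖x k‖ ^ 2) : Summable fun k => ‖N (x k)‖ ^ 2 := by
  refine Summable.of_nonneg_of_le (fun k => by positivity) (fun k => ?_) (hx.mul_left (C ^ 2))
  rw [← mul_pow]
  have := hN (x k)
  gcongr

variable {S : F →L[ℂ] E} {R : E →L[ℂ] F} (hS : Summable fun k => ‖S (b k)‖ ^ 2)
  (hR : Summable fun k => ‖ContinuousLinearMap.adjoint R (b k)‖ ^ 2)

-- Telescoping: `MSRM - NSRN = (M - N)S · RM + NS · R(M - N)`, where each product has one factor
-- tending to zero in Hilbert-Schmidt norm. Strong convergence acts only from the left;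
-- self-adjointness carries the right-hand factor over to `R*`. The filter is arbitrary because the
-- lemma serves both the net of finite-dimensional projections and the sequence `Q_{u_N}`.
include hS hR in
theorem eventually_traceBound_conj_sub {J : Type*} {l : Filter J} {M : J → E →L[ℂ] E}
    {N : E →L[ℂ] E}
    (hM : ∀ x, Tendsto (fun j => M j x) l (𝓝 (N x))) (hMn : ∀ j x, ‖M j x‖ ≤ ‖x‖)
    (hNn : ∀ x, ‖N x‖ ≤ ‖x‖) (hMs : ∀ j, IsSelfAdjoint (M j)) (hNs : IsSelfAdjoint N)
    {ε : ℝ} (hε : 0 < ε) :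
    ∀ᶠ j in l, TraceBound (M j ∘L (S ∘L R) ∘L M j - N ∘L (S ∘L R) ∘L N) ε := by
  set s := ∑' k, ‖S (b k)‖ ^ 2
  set r := ∑' k, ‖ContinuousLinearMap.adjoint R (b k)‖ ^ 2
  set s' := fun j => ∑' k, ‖(M j - N) (S (b k))‖ ^ 2
  set r' := fun j => ∑' k, ‖(M j - N) (ContinuousLinearMap.adjoint R (b k))‖ ^ 2
  have hs' : Tendsto s' l (𝓝 0) := tendsto_tsum_norm_sub_sq hM hMn hNn _ hS
  have hr' : Tendsto r' l (𝓝 0) := tendsto_tsum_norm_sub_sq hM hMn hNn _ hR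
  have hlim : Tendsto (fun j => √(s' j) * √r + √s * √(r' j)) l (𝓝 0) := by
    have := (hs'.sqrt.mul_const √r).add (hr'.sqrt.const_mul √s)
    simpa using this
  have hdiff : ∀ j x, ‖(M j - N) x‖ ≤ 2 * ‖x‖ := fun j x => by
    rw [sub_apply]
    have := norm_sub_le (M j x) (N x)
    have := hMn j x
    have := hNn x
    linarith
  filter_upwards [hlim.eventually (gt_mem_nhds hε)] with j hj
  have e1 : M j ∘L (S ∘L R) ∘L M j - N ∘L (S ∘L R) ∘L N =
      ((M j - N) ∘L S) ∘L (R ∘L M j) + (N ∘L S) ∘L (R ∘L (M j - N)) := by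
    ext x
    simp
  have a1 : ContinuousLinearMap.adjoint (R ∘L M j) = M j ∘L ContinuousLinearMap.adjoint R := by
    rw [ContinuousLinearMap.adjoint_comp, (hMs j).adjoint_eq]
  have a2 : ContinuousLinearMap.adjoint (R ∘L (M j - N)) =
      (M j - N) ∘L ContinuousLinearMap.adjoint R := by
    rw [ContinuousLinearMap.adjoint_comp, ((hMs j).sub hNs).adjoint_eq]
  have hMR : Summable fun k => ‖M j (ContinuousLinearMap.adjoint R (b k))‖ ^ 2 :=
    summable_norm_apply_sq (C := 1) (by simpa using hMn j) hR
  have hNS : Summable fun k => ‖N (S (b k))‖ ^ 2 :=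
    summable_norm_apply_sq (C := 1) (by simpa using hNn) hS
  have t1 := traceBound_comp b ((M j - N) ∘L S) (R ∘L M j)
    (summable_norm_apply_sq (hdiff j) hS) (by rw [a1]; exact hMR)
  have t2 := traceBound_comp b (N ∘L S) (R ∘L (M j - N)) hNS
    (by rw [a2]; exact summable_norm_apply_sq (hdiff j) hR)
  rw [e1]
  refine (t1.add t2).mono (le_trans ?_ hj.le)
  rw [a1, a2]
  simp only [ContinuousLinearMap.comp_apply]
  refine add_le_add (mul_le_mul_of_nonneg_left ?_ (Real.sqrt_nonneg _))
    (mul_le_mul_of_nonneg_right ?_ (Real.sqrt_nonneg _))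
  · refine Real.sqrt_le_sqrt (hMR.tsum_le_tsum (fun k => ?_) hR)
    have := hMn j (ContinuousLinearMap.adjoint R (b k))
    gcongr
  · refine Real.sqrt_le_sqrt (hNS.tsum_le_tsum (fun k => ?_) hS)
    have := hNn (S (b k))
    gcongr

-- Cauchy criterion: choose `V` with `P_V K P_V` close to `K = SR` in trace norm. For `W ⊇ V` the
-- value at `V` is the determinant of `1 - P_V K P_V` on `W`, hence close to the value at `W`.
include hS hR in
theorem exists_isDetOneSub_comp : ∃ d, IsDetOneSub (S ∘L R) d := by
  have hTB := traceBound_comp b S R hS hR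
  set C := √(∑' k, ‖S (b k)‖ ^ 2) * √(∑' k, ‖ContinuousLinearMap.adjoint R (b k)‖ ^ 2)
  suffices h : ∃ d, Tendsto (detCompress (1 - S ∘L R)) atTop (𝓝 d) by
    obtain ⟨d, hd⟩ := h
    exact ⟨d, ⟨C, hTB⟩, hd⟩
  refine cauchy_map_iff_exists_tendsto.mp (Metric.cauchy_iff.mpr ⟨inferInstance, fun ε hε => ?_⟩)
  -- The bound `2 exp(C + 1) δ` is then at most `ε / 4`, so two values beyond `V` differ by at most
  -- `ε / 2`; the term `1 / 2` secures the requirement `δ < 1`.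
  set δ := min (1 / 2) (ε / (8 * Real.exp (C + 1)))
  have hexp := Real.exp_pos (C + 1)
  have hδ : 0 < δ := lt_min (by norm_num) (by positivity)
  have hev := eventually_traceBound_conj_sub b hS hR (N := 1)
    (M := fun V : {V : Submodule ℂ E // FiniteDimensional ℂ V} => (have := V.2; V.1.starProjection))
    tendsto_starProjection_finiteDimensional
    (fun V x => by have := V.2; exact V.1.norm_starProjection_apply_le x) (fun x => le_rfl)
    (fun V => by have := V.2; exact isSelfAdjoint_starProjection V.1)
    (IsSelfAdjoint.one _) hδ
  obtain ⟨V, hV⟩ := hev.exists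
  refine ⟨detCompress (1 - S ∘L R) '' Set.Ici V, image_mem_map (Ici_mem_atTop V), ?_⟩
  have key : ∀ W ∈ Set.Ici V, dist (detCompress (1 - S ∘L R) V) (detCompress (1 - S ∘L R) W) ≤
      ε / 4 := by
    intro W hW
    have := V.2
    rw [← detCompress_one_sub_conj _ hW, dist_eq_norm]
    have h1 := norm_detCompress_sub_le hδ ((min_le_left _ _).trans_lt (by norm_num)) hTB hV W
    refine h1.trans ?_
    calc 2 * Real.exp (C + 1) * δ ≤ 2 * Real.exp (C + 1) * (ε / (8 * Real.exp (C + 1))) := by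
          gcongr
          exact min_le_right _ _
      _ = ε / 4 := by field_simp; norm_num
  rintro _ ⟨W, hW, rfl⟩ _ ⟨W', hW', rfl⟩
  have h1 := key W hW
  have h2 := key W' hW'
  have h3 := dist_triangle_left (detCompress (1 - S ∘L R) W) (detCompress (1 - S ∘L R) W')
    (detCompress (1 - S ∘L R) V)
  linarith

include hS hR in
theorem exists_isDetOneSub_conj {N : E →L[ℂ] E} (hNn : ∀ x, ‖N x‖ ≤ ‖x‖)
    (hNs : IsSelfAdjoint N) : ∃ d, IsDetOneSub (N ∘L (S ∘L R) ∘L N) d := by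
  have h := exists_isDetOneSub_comp b (S := N ∘L S) (R := R ∘L N)
    (summable_norm_apply_sq (C := 1) (by simpa using hNn) hS) (by
      rw [ContinuousLinearMap.adjoint_comp, hNs.adjoint_eq]
      exact summable_norm_apply_sq (C := 1) (by simpa using hNn) hR)
  simpa only [ContinuousLinearMap.comp_assoc] using h

-- The estimate for compressed determinants does not depend on the subspace, so it survives the
-- limit over finite-dimensional subspaces.
include hS hR in
theorem tendsto_det_conj {J : Type*} {l : Filter J} {M : J → E →L[ℂ] E}
    {N : E →L[ℂ] E}
    (hM : ∀ x, Tendsto (fun j => M j x) l (𝓝 (N x))) (hMn : ∀ j x, ‖M j x‖ ≤ ‖x‖)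
    (hNn : ∀ x, ‖N x‖ ≤ ‖x‖) (hMs : ∀ j, IsSelfAdjoint (M j)) (hNs : IsSelfAdjoint N)
    {d : J → ℂ} {d₀ : ℂ} (hd : ∀ j, IsDetOneSub (M j ∘L (S ∘L R) ∘L M j) (d j))
    (hd₀ : IsDetOneSub (N ∘L (S ∘L R) ∘L N) d₀) : Tendsto d l (𝓝 d₀) := by
  obtain ⟨C, hC⟩ := hd₀.1
  rw [Metric.tendsto_nhds]
  intro ε hε
  set δ := min (1 / 2) (ε / (4 * Real.exp (C + 1)))
  have hexp := Real.exp_pos (C + 1)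
  have hδ : 0 < δ := lt_min (by norm_num) (by positivity)
  filter_upwards [eventually_traceBound_conj_sub b hS hR hM hMn hNn hMs hNs hδ] with j hj
  have h1 := le_of_tendsto ((hd j).2.sub hd₀.2).norm (Eventually.of_forall fun V =>
    norm_detCompress_sub_le hδ ((min_le_left _ _).trans_lt (by norm_num)) hC hj V)
  rw [dist_eq_norm]
  refine h1.trans_lt ?_
  calc 2 * Real.exp (C + 1) * δ ≤ 2 * Real.exp (C + 1) * (ε / (4 * Real.exp (C + 1))) := by
        gcongr
        exact min_le_right _ _
    _ = ε / 2 := by field_simp; norm_num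
    _ < ε := by linarith

/-! ### Jacobi's identity for Fredholm determinants and nonvanishing -/

omit [CompleteSpace E] in
theorem isDetOneSub_zero : IsDetOneSub (0 : E →L[ℂ] E) 1 := by
  refine ⟨⟨0, fun n e f _ _ => by simp⟩, tendsto_const_nhds.congr fun V => ?_⟩
  exact (detCompress_eq_one fun x _ y _ => by simp).symm

omit [CompleteSpace E] in
theorem IsDetOneSub.jacobi {K X : E →L[ℂ] E} (hX : (1 - K) ∘L X = 1)
    (V : {V : Submodule ℂ E // FiniteDimensional ℂ V}) [V.1.HasOrthogonalProjection] {d d' : ℂ}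
    (hd : IsDetOneSub K d)
    (hd' : IsDetOneSub ((1 - V.1.starProjection) ∘L K ∘L (1 - V.1.starProjection)) d') :
    d * detCompress X V = d' := by
  have := V.2
  refine tendsto_nhds_unique (hd.2.mul_const (detCompress X V)) (hd'.2.congr' ?_)
  -- The finite-dimensional identity holds on every `W` containing both `V` and `X V`, hence
  -- eventually; only then is the limit over `W` taken.
  let W₀ : {V : Submodule ℂ E // FiniteDimensional ℂ V} :=
    ⟨V.1 ⊔ V.1.map (X : E →ₗ[ℂ] E), inferInstance⟩
  filter_upwards [Ici_mem_atTop W₀] with W hW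
  have hW' : V.1 ⊔ V.1.map (X : E →ₗ[ℂ] E) ≤ W.1 := hW
  exact (detCompress_mul_detCompress_inverse K X hX (le_sup_left.trans hW')
    fun x hx => hW' (Submodule.mem_sup_right ⟨x, hx, rfl⟩)).symm

omit [CompleteSpace E] in
theorem norm_one_sub_starProjection_le (V : Submodule ℂ E) [V.HasOrthogonalProjection] (x : E) :
    ‖(1 - V.starProjection) x‖ ≤ ‖x‖ := by
  have h : 1 - V.starProjection = Vᗮ.starProjection := V.starProjection_orthogonal.symm
  rw [h]
  exact Vᗮ.norm_starProjection_apply_le x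

theorem isSelfAdjoint_one_sub_starProjection (V : Submodule ℂ E) [V.HasOrthogonalProjection] :
    IsSelfAdjoint (1 - V.starProjection) :=
  (IsSelfAdjoint.one _).sub (isSelfAdjoint_starProjection V)

-- The complementary projections `1 - P_V` tend strongly to zero, so the determinants of `1 - (1 -
-- P_V) K (1 - P_V)`, with `K = SR`, tend to `1`. One of them is nonzero, and by Jacobi's identity
-- it is a multiple of `d`.
include hS hR in
theorem det_ne_zero_of_inverse {X : E →L[ℂ] E} (hX : (1 - S ∘L R) ∘L X = 1) {d : ℂ}
    (hd : IsDetOneSub (S ∘L R) d) : d ≠ 0 := by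
  set M : {V : Submodule ℂ E // FiniteDimensional ℂ V} → E →L[ℂ] E :=
    fun V => have := V.2; 1 - V.1.starProjection with hM
  have hMn : ∀ V x, ‖M V x‖ ≤ ‖x‖ := fun V x => by
    have := V.2
    exact norm_one_sub_starProjection_le V.1 x
  have hMs : ∀ V, IsSelfAdjoint (M V) := fun V => by
    have := V.2
    exact isSelfAdjoint_one_sub_starProjection V.1
  choose D hD using fun V => exists_isDetOneSub_conj b hS hR (hMn V) (hMs V)
  have hlim : Tendsto D atTop (𝓝 1) := by
    refine tendsto_det_conj b hS hR (N := 0) (fun x => ?_) hMn (by simp) hMs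
      (IsSelfAdjoint.zero _) hD (by simpa using isDetOneSub_zero)
    have := (tendsto_const_nhds (x := x)).sub (tendsto_starProjection_finiteDimensional x)
    simpa [hM] using this
  obtain ⟨V, hV⟩ := (hlim.eventually_ne one_ne_zero).exists
  have := V.2
  intro h0
  have h1 := hd.jacobi hX V (hD V)
  rw [h0, zero_mul] at h1
  exact hV h1.symm

end Fredholm

/-! ### Fourier coefficients in `L²` -/

section L2Basics

variable {m : ℕ}

theorem coeffCLM_apply (n : ℤ) (f : L2 m) :
    coeffCLM m n f = fourierCoeff (f : Angle → Vec m) n := rfl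

theorem integrable_coe (f : L2 m) : Integrable (f : Angle → Vec m) σ :=
  (Lp.memLp f).integrable (by norm_num)

theorem norm_coeffCLM_le (n : ℤ) (f : L2 m) : ‖coeffCLM m n f‖ ≤ ‖f‖ := by
  have h : ‖coeffCLM m n f‖ ≤ 1 * ‖f‖ :=
    (coeffCLM m n).le_of_opNorm_le (LinearMap.mkContinuous_norm_le _ zero_le_one _) f
  rwa [one_mul] at h

/-- The monomial `tⁿ x`. -/
def monomial (n : ℤ) (x : Vec m) : L2 m :=
  ContinuousMap.toLp 2 σ ℂ ⟨fun θ : Angle => (fourier n θ : ℂ) • x, by fun_prop⟩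

theorem coeFn_monomial (n : ℤ) (x : Vec m) :
    (monomial n x : Angle → Vec m) =ᵐ[σ] fun θ => (fourier n θ : ℂ) • x :=
  ContinuousMap.coeFn_toLp _ _

theorem inner_monomial_left (n : ℤ) (x : Vec m) (f : L2 m) :
    inner ℂ (monomial n x) f = inner ℂ x (coeffCLM m n f) := by
  rw [L2.inner_def, coeffCLM_apply, fourierCoeff, ← integral_inner
    ((integrable_coe f).fourier_smul (-n))]
  refine integral_congr_ae ?_
  filter_upwards [coeFn_monomial n x] with θ hθ
  rw [hθ, inner_smul_left, inner_smul_right, ← fourier_neg]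

theorem coeffCLM_monomial (k n : ℤ) (x : Vec m) :
    coeffCLM m k (monomial n x) = if k = n then x else 0 := by
  rw [coeffCLM_apply, fourierCoeff_congr_ae (coeFn_monomial n x), fourierCoeff]
  have h : ∀ θ : Angle, (fourier (-k) θ : ℂ) • (fourier n θ : ℂ) • x =
      ((fourier (-k) θ : ℂ) • (fourier n θ : ℂ)) • x := fun θ => (smul_assoc _ _ _).symm
  simp_rw [h]
  rw [integral_smul_const]
  have h2 : ∫ θ : Angle, (fourier (-k) θ : ℂ) • (fourier n θ : ℂ) ∂σ =
      fourierCoeff (T := 2 * Real.pi) (fourier n) k := rfl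
  rw [h2, fourierCoeff_fourier, Pi.single_apply]
  split_ifs <;> simp

theorem ext_coeffCLM {f g : L2 m} (h : ∀ n, coeffCLM m n f = coeffCLM m n g) : f = g := by
  rw [← sub_eq_zero]
  set u := f - g with hu
  have h0 : ∀ n, coeffCLM m n u = 0 := fun n => by rw [hu, map_sub, h, sub_self]
  -- Completeness of the scalar Fourier basis, applied to each component.
  have hc : ∀ i : Fin m, (EuclideanSpace.proj (𝕜 := ℂ) i : Vec m →L[ℂ] ℂ).compLp u = 0 := by
    intro i
    apply (fourierBasis (T := 2 * Real.pi)).repr.injective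
    ext n
    rw [fourierBasis_repr, map_zero, lp.coeFn_zero, Pi.zero_apply,
      fourierCoeff_congr_ae (ContinuousLinearMap.coeFn_compLp _ u)]
    have h1 := congrArg (EuclideanSpace.proj (𝕜 := ℂ) i : Vec m →L[ℂ] ℂ) (h0 n)
    rw [coeffCLM_apply, fourierCoeff, ← ContinuousLinearMap.integral_comp_comm _
      ((integrable_coe u).fourier_smul (-n)), map_zero] at h1
    rw [← h1, fourierCoeff]
    simp only [map_smul]
  rw [Lp.eq_zero_iff_ae_eq_zero]
  have hall : ∀ᵐ θ ∂σ, ∀ i : Fin m, u θ i = 0 := by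
    rw [ae_all_iff]
    intro i
    have h1 := (Lp.eq_zero_iff_ae_eq_zero).mp (hc i)
    filter_upwards [h1, ContinuousLinearMap.coeFn_compLp
      (EuclideanSpace.proj (𝕜 := ℂ) i : Vec m →L[ℂ] ℂ) u] with θ h2 h3
    rw [h2] at h3
    exact h3.symm
  filter_upwards [hall] with θ hθ
  ext i
  exact hθ i

/-- The orthonormal basis of `L²` formed by the functions `tⁿ e_i`. -/
def monomialBasis (m : ℕ) : HilbertBasis (ℤ × Fin m) ℂ (L2 m) :=
  HilbertBasis.mkOfOrthogonalEqBot
    (v := fun p : ℤ × Fin m => monomial p.1 (EuclideanSpace.single p.2 (1 : ℂ)))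
    (by
      rw [orthonormal_iff_ite]
      rintro ⟨n, i⟩ ⟨k, j⟩
      rw [inner_monomial_left, coeffCLM_monomial]
      by_cases hnk : n = k
      · by_cases hij : i = j
        · simp [hnk, hij]
        · simp [hnk, hij, EuclideanSpace.inner_single_left]
      · simp [hnk])
    (by
      rw [Submodule.eq_bot_iff]
      intro f hf
      refine ext_coeffCLM fun n => ?_
      ext i
      have h1 := (Submodule.mem_orthogonal _ _).mp hf _
        (Submodule.subset_span ⟨(n, i), rfl⟩)
      rw [inner_monomial_left, EuclideanSpace.inner_single_left] at h1
      simpa using h1)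

theorem monomialBasis_apply (p : ℤ × Fin m) :
    monomialBasis m p = monomial p.1 (EuclideanSpace.single p.2 (1 : ℂ)) := by
  rw [monomialBasis, HilbertBasis.coe_mkOfOrthogonalEqBot]

/-! ### The projection onto `H²` -/

theorem mem_H2_iff {f : L2 m} : f ∈ H2 m ↔ ∀ n : ℤ, n < 0 → coeffCLM m n f = 0 := mem_H2

theorem monomial_mem_H2 {n : ℤ} (hn : 0 ≤ n) (x : Vec m) : monomial n x ∈ H2 m :=
  mem_H2_iff.mpr fun k hk => by rw [coeffCLM_monomial, if_neg (by omega)]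

theorem coeffCLM_of_mem_orthogonal {f : L2 m} (hf : f ∈ (H2 m)ᗮ) {n : ℤ} (hn : 0 ≤ n) :
    coeffCLM m n f = 0 := by
  refine ext_inner_left ℂ fun x => ?_
  rw [← inner_monomial_left, inner_zero_right]
  exact (Submodule.mem_orthogonal _ _).mp hf _ (monomial_mem_H2 hn x)

theorem coeffCLM_starProjection (n : ℤ) (f : L2 m) :
    coeffCLM m n ((H2 m).starProjection f) = if 0 ≤ n then coeffCLM m n f else 0 := by
  split_ifs with hn
  · have h := coeffCLM_of_mem_orthogonal ((H2 m).sub_starProjection_mem_orthogonal f) hn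
    rw [map_sub, sub_eq_zero] at h
    exact h.symm
  · exact mem_H2_iff.mp ((H2 m).starProjection_apply_mem f) n (by omega)

theorem mem_H2_orthogonal_iff {f : L2 m} :
    f ∈ (H2 m)ᗮ ↔ ∀ n : ℤ, 0 ≤ n → coeffCLM m n f = 0 := by
  refine ⟨fun hf n hn => coeffCLM_of_mem_orthogonal hf hn, fun h => ?_⟩
  rw [← Submodule.starProjection_apply_eq_zero_iff]
  refine ext_coeffCLM fun n => ?_
  rw [coeffCLM_starProjection, map_zero]
  split_ifs with hn
  · exact h n hn
  · rfl

theorem monomial_mem_H2_orthogonal {n : ℤ} (hn : n < 0) (x : Vec m) :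
    monomial n x ∈ (H2 m)ᗮ :=
  mem_H2_orthogonal_iff.mpr fun k hk => by rw [coeffCLM_monomial, if_neg (by omega)]

/-! ### Multiplication operators -/

theorem coeFn_mulOp (a : Symbol m) (f : L2 m) :
    (mulOp a f : Angle → Vec m) =ᵐ[σ]
      fun θ => Matrix.toEuclideanCLM (n := Fin m) (𝕜 := ℂ) (a θ.toCircle) (f θ) := by
  have h1 := (ContinuousLinearMap.id ℂ (Vec m →L[ℂ] Vec m)).coeFn_holder (r := 2)
    (ContinuousMap.toLp ∞ σ ℂ a.toCLM) f
  have h2 := ContinuousMap.coeFn_toLp (p := ∞) (𝕜 := ℂ) σ a.toCLM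
  have h3 : mulOp a f = (ContinuousLinearMap.id ℂ (Vec m →L[ℂ] Vec m)).holder 2
    (ContinuousMap.toLp ∞ σ ℂ a.toCLM) f := rfl
  rw [h3]
  filter_upwards [h1, h2] with θ h1 h2
  rw [h1, h2]
  rfl

theorem mulOp_mul (a b : Symbol m) : mulOp (a * b) = mulOp a ∘L mulOp b := by
  ext1 f
  refine Lp.ext ?_
  filter_upwards [coeFn_mulOp (a * b) f, coeFn_mulOp a (mulOp b f), coeFn_mulOp b f]
    with θ h1 h2 h3
  rw [h1, ContinuousLinearMap.comp_apply, h2, h3, ContinuousMap.mul_apply, map_mul]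
  rfl

theorem mulOp_one : mulOp (1 : Symbol m) = 1 := by
  ext1 f
  refine Lp.ext ?_
  filter_upwards [coeFn_mulOp 1 f] with θ h1
  rw [h1, ContinuousMap.one_apply, map_one]
  rfl

theorem mulOp_sub (a b : Symbol m) : mulOp (a - b) = mulOp a - mulOp b := by
  ext1 f
  rw [sub_apply]
  refine Lp.ext ?_
  filter_upwards [coeFn_mulOp (a - b) f, coeFn_mulOp a f, coeFn_mulOp b f,
    Lp.coeFn_sub (mulOp a f) (mulOp b f)] with θ h1 h2 h3 h4
  rw [h1, h4, Pi.sub_apply, h2, h3, ContinuousMap.sub_apply, map_sub]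
  rfl

theorem mulOp_smul (c : ℂ) (a : Symbol m) : mulOp (c • a) = c • mulOp a := by
  ext1 f
  rw [smul_apply]
  refine Lp.ext ?_
  filter_upwards [coeFn_mulOp (c • a) f, coeFn_mulOp a f,
    Lp.coeFn_smul c (mulOp a f)] with θ h1 h2 h4
  rw [h1, h4, Pi.smul_apply, h2, ContinuousMap.smul_apply, map_smul]
  rfl

theorem inner_mulOp_left (a : Symbol m) (f g : L2 m) :
    inner ℂ (mulOp a f) g = inner ℂ f (mulOp (star a) g) := by
  rw [L2.inner_def, L2.inner_def]
  refine integral_congr_ae ?_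
  filter_upwards [coeFn_mulOp a f, coeFn_mulOp (star a) g] with θ h1 h2
  rw [h1, h2, ContinuousMap.star_apply, map_star, ContinuousLinearMap.star_eq_adjoint,
    ContinuousLinearMap.adjoint_inner_right]

theorem adjoint_mulOp (a : Symbol m) :
    ContinuousLinearMap.adjoint (mulOp a) = mulOp (star a) := by
  rw [eq_comm, ContinuousLinearMap.eq_adjoint_iff]
  intro f g
  rw [inner_mulOp_left, star_star]

theorem coeffCLM_mulOp_monomial (a : Symbol m) (k n : ℤ) (x : Vec m) :
    coeffCLM m k (mulOp a (monomial n x)) =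
      Matrix.toEuclideanCLM (n := Fin m) (𝕜 := ℂ) (a.coeff (k - n)) x := by
  let L : Matrix (Fin m) (Fin m) ℂ →L[ℂ] Vec m := LinearMap.toContinuousLinearMap
    { toFun := fun M => Matrix.toEuclideanCLM (n := Fin m) (𝕜 := ℂ) M x
      map_add' := fun M N => by rw [map_add]; rfl
      map_smul' := fun c M => by rw [map_smul]; rfl }
  have hL : ∀ M, L M = Matrix.toEuclideanCLM (n := Fin m) (𝕜 := ℂ) M x := fun M => rfl
  have key : L (a.coeff (k - n)) =
      ∫ θ : Angle, L ((fourier (-(k - n)) θ : ℂ) • a θ.toCircle) ∂σ := by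
    refine (ContinuousLinearMap.integral_comp_comm L
      (φ := fun θ : Angle => (fourier (-(k - n)) θ : ℂ) • a θ.toCircle) ?_).symm
    refine (Continuous.integrable_of_hasCompactSupport ?_ (HasCompactSupport.of_compactSpace _))
    exact (fourier (-(k - n))).continuous.smul
      (a.continuous.comp AddCircle.continuous_toCircle)
  rw [← hL, key, coeffCLM_apply, fourierCoeff]
  refine integral_congr_ae ?_
  filter_upwards [coeFn_mulOp a (monomial n x), coeFn_monomial n x] with θ h1 h2
  rw [h1, h2, map_smul, map_smul, hL, smul_smul, ← fourier_add]
  congr 2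
  ring_nf

theorem coeff_star (a : Symbol m) (n : ℤ) : (star a).coeff n = (a.coeff (-n)).conjTranspose := by
  have hinj : Function.Injective (Matrix.toEuclideanCLM (n := Fin m) (𝕜 := ℂ)) :=
    EquivLike.injective _
  apply hinj
  ext1 x
  refine ext_inner_left ℂ fun y => ?_
  have h1 := coeffCLM_mulOp_monomial (star a) n 0 x
  have h2 := coeffCLM_mulOp_monomial a 0 n y
  rw [sub_zero] at h1
  rw [zero_sub] at h2
  rw [← h1, ← inner_monomial_left, ← inner_mulOp_left, ← inner_conj_symm, inner_monomial_left,
    h2, inner_conj_symm, ← Matrix.star_eq_conjTranspose, map_star,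
    ContinuousLinearMap.star_eq_adjoint, ContinuousLinearMap.adjoint_inner_right]

end L2Basics

/-! ### Toeplitz operators -/

section Toeplitz

variable {m : ℕ}

/-- Multiplication by `a` maps `H²` into itself. -/
def PreservesH2 (a : Symbol m) : Prop := ∀ f ∈ H2 m, mulOp a f ∈ H2 m

/-- Multiplication by `a` maps the orthogonal complement of `H²` into itself. -/
def PreservesH2Compl (a : Symbol m) : Prop := ∀ f ∈ (H2 m)ᗮ, mulOp a f ∈ (H2 m)ᗮ

theorem PreservesH2.star {a : Symbol m} (h : PreservesH2 a) : PreservesH2Compl (star a) := by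
  intro f hf
  rw [Submodule.mem_orthogonal]
  intro g hg
  rw [← inner_mulOp_left]
  exact (Submodule.mem_orthogonal _ _).mp hf _ (h g hg)

theorem PreservesH2Compl.star {a : Symbol m} (h : PreservesH2Compl a) :
    PreservesH2 (star a) := by
  intro f hf
  have : mulOp (Star.star a) f ∈ (H2 m)ᗮᗮ := by
    rw [Submodule.mem_orthogonal]
    intro g hg
    rw [← inner_mulOp_left]
    exact (Submodule.mem_orthogonal' _ _).mp (h g hg) _ hf
  rwa [Submodule.orthogonal_orthogonal] at this

theorem Symbol.IsAnalytic.star {a : Symbol m} (h : a.IsAnalytic) : (star a).IsCoanalytic := by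
  intro n hn
  rw [coeff_star, h (-n) (by omega), Matrix.conjTranspose_zero]

/-- By duality it suffices that multiplication by `a*` sends the monomials `tⁿ x`, `n ≥ 0`, into
`H²`. Their images have explicit Fourier coefficients, so no approximation of a general `f` is
required. -/
theorem Symbol.IsCoanalytic.preservesH2Compl {a : Symbol m} (h : a.IsCoanalytic) :
    PreservesH2Compl a := by
  intro f hf
  rw [mem_H2_orthogonal_iff]
  intro n hn
  refine ext_inner_left ℂ fun x => ?_
  rw [← inner_monomial_left, inner_zero_right]
  have h1 := inner_mulOp_left (Star.star a) (monomial n x) f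
  rw [star_star] at h1
  rw [← h1]
  refine (Submodule.mem_orthogonal _ _).mp hf _ (mem_H2_iff.mpr fun k hk => ?_)
  rw [coeffCLM_mulOp_monomial, coeff_star, h _ (by omega), Matrix.conjTranspose_zero, map_zero]
  rfl

theorem Symbol.IsAnalytic.preservesH2 {a : Symbol m} (h : a.IsAnalytic) : PreservesH2 a := by
  have := h.star.preservesH2Compl.star
  rwa [star_star] at this

theorem PreservesH2.mul {a b : Symbol m} (ha : PreservesH2 a) (hb : PreservesH2 b) :
    PreservesH2 (a * b) := fun f hf => by
  rw [mulOp_mul]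
  exact ha _ (hb f hf)

theorem preservesH2_one : PreservesH2 (1 : Symbol m) := fun f hf => by
  rw [mulOp_one]
  exact hf

theorem coe_toeplitz (a : Symbol m) (f : H2 m) :
    (toeplitz a f : L2 m) = (H2 m).starProjection (mulOp a f) := rfl

theorem coe_toeplitz_of_preservesH2 {a : Symbol m} (ha : PreservesH2 a) (f : H2 m) :
    (toeplitz a f : L2 m) = mulOp a f := by
  rw [coe_toeplitz, Submodule.starProjection_eq_self_iff]
  exact ha f f.2

theorem starProjection_mulOp_starProjection {a : Symbol m} (ha : PreservesH2Compl a) (f : L2 m) :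
    (H2 m).starProjection (mulOp a ((H2 m).starProjection f)) =
      (H2 m).starProjection (mulOp a f) := by
  have h := starProjection_of_mem_orthogonal
    (ha _ ((H2 m).sub_starProjection_mem_orthogonal f))
  rw [map_sub, map_sub, sub_eq_zero] at h
  exact h.symm

/-- The projection between the two factors is redundant, since `b f` already lies in `H²`. In
`toeplitz_mul_of_left` it is redundant because `a` sends the discarded part to something orthogonal
to `H²`. -/
theorem toeplitz_mul_of_right {a b : Symbol m} (hb : PreservesH2 b) :
    toeplitz (a * b) = toeplitz a ∘L toeplitz b := by
  ext1 f
  apply Subtype.ext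
  rw [ContinuousLinearMap.comp_apply, coe_toeplitz, coe_toeplitz,
    coe_toeplitz_of_preservesH2 hb, mulOp_mul]
  rfl

theorem toeplitz_mul_of_left {a b : Symbol m} (ha : PreservesH2Compl a) :
    toeplitz (a * b) = toeplitz a ∘L toeplitz b := by
  ext1 f
  apply Subtype.ext
  rw [ContinuousLinearMap.comp_apply, coe_toeplitz, coe_toeplitz, coe_toeplitz,
    starProjection_mulOp_starProjection ha, mulOp_mul]
  rfl

theorem toeplitz_one : toeplitz (1 : Symbol m) = 1 := by
  ext1 f
  apply Subtype.ext
  rw [coe_toeplitz_of_preservesH2 preservesH2_one, mulOp_one]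
  rfl

theorem inner_toeplitz_right (a : Symbol m) (f g : H2 m) :
    inner ℂ f (toeplitz a g) = inner ℂ (f : L2 m) (mulOp a g) := by
  rw [Submodule.coe_inner, coe_toeplitz, ← Submodule.inner_starProjection_left_eq_right,
    Submodule.starProjection_eq_self_iff.mpr f.2]

theorem adjoint_toeplitz (a : Symbol m) :
    ContinuousLinearMap.adjoint (toeplitz a) = toeplitz (star a) := by
  rw [eq_comm, ContinuousLinearMap.eq_adjoint_iff]
  intro f g
  rw [inner_toeplitz_right, ← inner_conj_symm, inner_toeplitz_right, inner_conj_symm,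
    inner_mulOp_left, star_star]

/-! ### The flip operator and products of Hankel operators -/

theorem coeFn_flipOp (f : L2 m) :
    (flipOp m f : Angle → Vec m) =ᵐ[σ]
      fun θ => (((θ.toCircle)⁻¹ : Circle) : ℂ) • f (-θ) := by
  set g := Lp.compMeasurePreservingₗᵢ ℂ (fun θ : Angle => -θ)
    (Measure.measurePreserving_neg σ) f with hg
  have h0 : flipOp m f = mulOp (invSymbol m) g := rfl
  have h1 : (g : Angle → Vec m) =ᵐ[σ] (f : Angle → Vec m) ∘ fun θ => -θ :=
    Lp.coeFn_compMeasurePreserving f (Measure.measurePreserving_neg σ)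
  rw [h0]
  filter_upwards [coeFn_mulOp (invSymbol m) g, h1] with θ h2 h3
  rw [h2, h3]
  change Matrix.toEuclideanCLM (n := Fin m) (𝕜 := ℂ)
    ((((θ.toCircle)⁻¹ : Circle) : ℂ) • (1 : Matrix (Fin m) (Fin m) ℂ)) _ = _
  rw [map_smul, map_one]
  rfl

theorem coeffCLM_flipOp (n : ℤ) (f : L2 m) :
    coeffCLM m n (flipOp m f) = coeffCLM m (-1 - n) f := by
  rw [coeffCLM_apply, coeffCLM_apply, fourierCoeff_congr_ae (coeFn_flipOp f), fourierCoeff,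
    fourierCoeff, ← integral_neg_eq_self]
  refine integral_congr_ae (Eventually.of_forall fun θ => ?_)
  simp only [neg_neg, smul_smul]
  congr 1
  have h : (fourier (-(-1 - n)) θ : ℂ) = fourier n θ * fourier 1 θ := by
    rw [← fourier_add]
    congr 2
    ring
  rw [h, fourier_one]
  congr 1
  · rw [fourier_apply, fourier_apply]
    congr 2
    simp
  · rw [AddCircle.toCircle_neg, inv_inv]

theorem flipOp_flipOp (f : L2 m) : flipOp m (flipOp m f) = f := by
  refine ext_coeffCLM fun n => ?_
  rw [coeffCLM_flipOp, coeffCLM_flipOp]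
  congr 2
  ring

theorem flipOp_starProjection (f : L2 m) :
    flipOp m ((H2 m).starProjection f) = flipOp m f - (H2 m).starProjection (flipOp m f) := by
  refine ext_coeffCLM fun n => ?_
  rw [coeffCLM_flipOp, coeffCLM_starProjection, map_sub, coeffCLM_starProjection,
    coeffCLM_flipOp]
  by_cases hn : 0 ≤ n
  · rw [if_neg (by omega), if_pos hn, sub_self]
  · rw [if_pos (by omega), if_neg hn, sub_zero]

theorem mulOp_reversal_flipOp (c : Symbol m) (f : L2 m) :
    mulOp (reversal c) (flipOp m f) = flipOp m (mulOp c f) := by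
  refine Lp.ext ?_
  have h := (Measure.measurePreserving_neg σ).quasiMeasurePreserving.ae (coeFn_mulOp c f)
  filter_upwards [coeFn_mulOp (reversal c) (flipOp m f), coeFn_flipOp f,
    coeFn_flipOp (mulOp c f), h] with θ h1 h2 h3 h4
  rw [h1, h2, h3, h4, map_smul, AddCircle.toCircle_neg]
  rfl

/-- The map `f ↦ P (b (I - P) f)` from `L²` to `H²`. -/
def outerHankel (b : Symbol m) : L2 m →L[ℂ] H2 m :=
  (H2 m).orthogonalProjectionOnto ∘L mulOp b ∘L (1 - (H2 m).starProjection)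

/-- The map `f ↦ (I - P) (c f)` from `H²` to `L²`. -/
def innerHankel (c : Symbol m) : H2 m →L[ℂ] L2 m :=
  (1 - (H2 m).starProjection) ∘L mulOp c ∘L (H2 m).subtypeL

theorem adjoint_innerHankel (c : Symbol m) :
    ContinuousLinearMap.adjoint (innerHankel c) = outerHankel (star c) := by
  rw [innerHankel, ContinuousLinearMap.adjoint_comp, ContinuousLinearMap.adjoint_comp,
    adjoint_mulOp, Submodule.adjoint_subtypeL,
    (isSelfAdjoint_one_sub_starProjection (H2 m)).adjoint_eq]
  rfl

theorem one_sub_starProjection_idem {E : Type*} [NormedAddCommGroup E] [InnerProductSpace ℂ E]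
    (V : Submodule ℂ E) [V.HasOrthogonalProjection] (f : E) :
    (1 - V.starProjection) ((1 - V.starProjection) f) = (1 - V.starProjection) f := by
  simp [Submodule.starProjection_eq_self_iff.mpr (V.starProjection_apply_mem f)]

/-- The two flips cancel: `J` is an involution, exchanges `P` with `I - P`, and intertwines
multiplication by `c` with multiplication by `c̃`. What remains is `P b (I - P) c P`. -/
theorem hankelProduct_eq (b c : Symbol m) :
    hankelProduct b c = outerHankel b ∘L innerHankel c := by
  have hQ : ∀ g : L2 m, (1 - (H2 m).starProjection) (flipOp m ((H2 m).starProjection g)) =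
      (1 - (H2 m).starProjection) (flipOp m g) := fun g => by
    rw [flipOp_starProjection]
    exact one_sub_starProjection_idem _ _
  ext1 f
  have hf : (1 - (H2 m).starProjection) (flipOp m (f : L2 m)) = flipOp m f := by
    have h := flipOp_starProjection (f : L2 m)
    rw [Submodule.starProjection_eq_self_iff.mpr f.2] at h
    exact h.symm
  have h1 : hankelProduct b c f = (H2 m).orthogonalProjectionOnto (mulOp b
      ((1 - (H2 m).starProjection) (flipOp m ((H2 m).starProjection (mulOp (reversal c)
        ((1 - (H2 m).starProjection) (flipOp m (f : L2 m)))))))) := rfl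
  have h2 : (outerHankel b ∘L innerHankel c) f = (H2 m).orthogonalProjectionOnto (mulOp b
      ((1 - (H2 m).starProjection) ((1 - (H2 m).starProjection) (mulOp c (f : L2 m))))) := rfl
  rw [h1, h2, hf, hQ, mulOp_reversal_flipOp, flipOp_flipOp, one_sub_starProjection_idem]

/-- Insert `P + (I - P)` between `b` and `c` in `P b c P = I`. -/
theorem one_sub_hankelProduct {b c : Symbol m} (hbc : b * c = 1) :
    1 - hankelProduct b c = toeplitz b ∘L toeplitz c := by
  ext1 f
  have h1 : mulOp b (mulOp c (f : L2 m)) = f := by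
    rw [← ContinuousLinearMap.comp_apply, ← mulOp_mul, hbc, mulOp_one]
    rfl
  have h2 : hankelProduct b c f = (H2 m).orthogonalProjectionOnto (mulOp b
      ((1 - (H2 m).starProjection) ((1 - (H2 m).starProjection) (mulOp c (f : L2 m))))) := by
    rw [hankelProduct_eq]
    rfl
  have h3 : (toeplitz b ∘L toeplitz c) f = (H2 m).orthogonalProjectionOnto (mulOp b
      ((H2 m).starProjection (mulOp c (f : L2 m)))) := rfl
  rw [sub_apply, h2, h3, one_sub_starProjection_idem, sub_apply, map_sub, map_sub,
    one_apply_eq_self, one_apply_eq_self, h1]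
  simp

end Toeplitz

/-! ### Hilbert-Schmidt estimates -/

section HilbertSchmidt

variable {m : ℕ}

theorem hasSum_norm_coeffCLM_sq (f : L2 m) :
    HasSum (fun n => ‖coeffCLM m n f‖ ^ 2) (‖f‖ ^ 2) := by
  have h := hasSum_norm_inner_sq (monomialBasis m) f
  refine h.prod_fiberwise fun n => ?_
  rw [EuclideanSpace.norm_sq_eq]
  convert! hasSum_fintype (fun i : Fin m => ‖coeffCLM m n f i‖ ^ 2) using 1
  funext i
  rw [monomialBasis_apply, inner_monomial_left, EuclideanSpace.inner_single_left]
  simp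

theorem norm_toEuclideanCLM_single_sq_le (M : Matrix (Fin m) (Fin m) ℂ) (i : Fin m) :
    ‖Matrix.toEuclideanCLM (n := Fin m) (𝕜 := ℂ) M (EuclideanSpace.single i (1 : ℂ))‖ ^ 2 ≤
      m * ‖M‖ ^ 2 := by
  rw [EuclideanSpace.norm_sq_eq]
  have : ∀ j : Fin m, ‖Matrix.toEuclideanCLM (n := Fin m) (𝕜 := ℂ) M
      (EuclideanSpace.single i (1 : ℂ)) j‖ ^ 2 ≤ ‖M‖ ^ 2 := by
    intro j
    have h : Matrix.toEuclideanCLM (n := Fin m) (𝕜 := ℂ) M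
      (EuclideanSpace.single i (1 : ℂ)) j = M j i := by
      simp [Matrix.ofLp_toEuclideanCLM]
    rw [h]
    have := Matrix.norm_entry_le_entrywise_sup_norm M (i := j) (j := i)
    gcongr
  refine (Finset.sum_le_sum fun j _ => this j).trans ?_
  simp

/-- A difference `d > 0` is attained by exactly `d` pairs with `n < 0 ≤ k`, namely those with `0 ≤ k
< d` and `n = k - d`. This count is the source of the weight `|d|` in the Krein condition. -/
theorem summable_triangle {g : ℤ → ℝ} (hg : ∀ d, 0 ≤ g d)
    (hs : Summable fun d : ℤ => |(d : ℝ)| * g d) :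
    Summable fun p : ℤ × ℤ => if p.1 < 0 ∧ 0 ≤ p.2 then g (p.2 - p.1) else 0 := by
  let e : ℤ × ℤ ≃ ℤ × ℤ :=
    { toFun := fun q => (q.2 - q.1, q.2)
      invFun := fun p => (p.2 - p.1, p.2)
      left_inv := fun q => by ext <;> simp
      right_inv := fun p => by ext <;> simp }
  rw [← e.summable_iff]
  have hfun : ((fun p : ℤ × ℤ => if p.1 < 0 ∧ 0 ≤ p.2 then g (p.2 - p.1) else 0) ∘ e) =
      fun q : ℤ × ℤ => if q.2 ∈ Finset.Ico 0 q.1 then g q.1 else 0 := by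
    funext q
    simp [e, and_comm]
  rw [hfun, summable_prod_of_nonneg (fun q => by
    simp only [Pi.zero_apply]; split_ifs <;> [exact hg _; exact le_rfl])]
  have hfib : ∀ d : ℤ, HasSum (fun k : ℤ => if k ∈ Finset.Ico 0 d then g d else 0)
      (d.toNat * g d) := by
    intro d
    have h := hasSum_sum_of_ne_finset_zero (L := SummationFilter.unconditional ℤ)
      (s := Finset.Ico 0 d)
      (f := fun k : ℤ => if k ∈ Finset.Ico 0 d then g d else 0)
      (fun k hk => if_neg hk)
    convert! h using 1
    rw [Finset.sum_congr rfl fun k hk => if_pos hk]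
    simp
  refine ⟨fun d => (hfib d).summable, ?_⟩
  refine Summable.of_nonneg_of_le (fun d => ?_) (fun d => ?_) hs
  · exact tsum_nonneg fun k => by dsimp only; split_ifs <;> [exact hg _; exact le_rfl]
  · dsimp only
    rw [(hfib d).tsum_eq]
    gcongr
    · exact hg d
    · have : ((d.toNat : ℤ) : ℝ) ≤ ((|d| : ℤ) : ℝ) := by
        exact_mod_cast (by rw [Int.toNat_eq_max]; exact max_le (le_abs_self d) (abs_nonneg d))
      rwa [Int.cast_natCast, Int.cast_abs] at this

/-- In the monomial basis the operator has the blocks `χ_{k-n}` with `n < 0 ≤ k`, so its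
Hilbert-Schmidt norm is controlled by `∑ |d| ‖χ_d‖²`. -/
theorem summable_norm_outerHankel_sq {χ : Symbol m}
    (hχ : Summable fun n : ℤ => |(n : ℝ)| * ‖χ.coeff n‖ ^ 2) :
    Summable fun p => ‖outerHankel χ (monomialBasis m p)‖ ^ 2 := by
  have hs := (summable_triangle (fun d => sq_nonneg ‖χ.coeff d‖) hχ).mul_left (m : ℝ)
  set G : ℤ → ℝ := fun n => ∑' k : ℤ,
    (m : ℝ) * if n < 0 ∧ 0 ≤ k then ‖χ.coeff (k - n)‖ ^ 2 else 0
  have hG : Summable G := hs.prod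
  have hG0 : ∀ n, 0 ≤ G n := fun n => tsum_nonneg fun k => by positivity
  have hone : Summable fun _ : Fin m => (1 : ℝ) := (hasSum_fintype _).summable
  refine Summable.of_nonneg_of_le (fun p => by positivity) (fun p => ?_)
    (hG.mul_of_nonneg hone hG0 fun _ => zero_le_one)
  obtain ⟨n, i⟩ := p
  rw [mul_one, monomialBasis_apply]
  set v := monomial n (EuclideanSpace.single i (1 : ℂ)) with hv
  have hnorm : ‖outerHankel χ v‖ =
      ‖(H2 m).starProjection (mulOp χ (v - (H2 m).starProjection v))‖ := rfl
  rw [hnorm]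
  refine hasSum_le (fun k => ?_) (hasSum_norm_coeffCLM_sq _) (hs.prod_factor n).hasSum
  dsimp only
  rw [coeffCLM_starProjection]
  by_cases hn : n < 0
  · rw [starProjection_of_mem_orthogonal (monomial_mem_H2_orthogonal hn _), sub_zero]
    by_cases hk : 0 ≤ k
    · rw [if_pos hk, if_pos ⟨hn, hk⟩, hv, coeffCLM_mulOp_monomial]
      exact norm_toEuclideanCLM_single_sq_le _ _
    · simp [hk]
  · have hv1 : v ∈ H2 m := monomial_mem_H2 (by omega) _
    rw [Submodule.starProjection_eq_self_iff.mpr hv1]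
    simp [hn]

/-- For such `ψ` the operator is `T(ψ)` times the one belonging to `χ`, a bounded operator times a
Hilbert-Schmidt one. So `b = v₋ w₊⁻¹` and `c* = v₊* (w₋⁻¹)*` are handled without showing that the
products lie in the Krein algebra. -/
theorem summable_norm_outerHankel_mul_sq {ψ χ : Symbol m} (hψ : PreservesH2Compl ψ)
    (hχ : Summable fun n : ℤ => |(n : ℝ)| * ‖χ.coeff n‖ ^ 2) :
    Summable fun p => ‖outerHankel (ψ * χ) (monomialBasis m p)‖ ^ 2 := by
  have h : ∀ f, outerHankel (ψ * χ) f = toeplitz ψ (outerHankel χ f) := by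
    intro f
    apply Subtype.ext
    have h1 : (outerHankel (ψ * χ) f : L2 m) =
      (H2 m).starProjection (mulOp (ψ * χ) ((1 - (H2 m).starProjection) f)) := rfl
    have h2 : (outerHankel χ f : L2 m) =
      (H2 m).starProjection (mulOp χ ((1 - (H2 m).starProjection) f)) := rfl
    rw [h1, coe_toeplitz, h2, starProjection_mulOp_starProjection hψ, mulOp_mul]
    rfl
  simp_rw [h]
  exact summable_norm_apply_sq (fun x => (toeplitz ψ).le_opNorm x)
    (summable_norm_outerHankel_sq hχ)

end HilbertSchmidt

/-! ### Reproducing kernels -/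

section Kernel

variable {m : ℕ}

theorem norm_monomial_le (n : ℤ) (x : Vec m) : ‖(monomial n x : L2 m)‖ ≤ ‖x‖ := by
  have h := inner_monomial_left n x (monomial n x)
  rw [coeffCLM_monomial, if_pos rfl, inner_self_eq_norm_sq_to_K, inner_self_eq_norm_sq_to_K] at h
  have h2 : ‖(monomial n x : L2 m)‖ ^ 2 = ‖x‖ ^ 2 := by exact_mod_cast h
  exact ((pow_left_inj₀ (norm_nonneg _) (norm_nonneg _) two_ne_zero).mp h2).le

theorem summable_kernel (α : 𝔻) (x : Vec m) :
    Summable fun n : ℕ => conj (α : ℂ) ^ n • (monomial (n : ℤ) x : L2 m) := by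
  refine Summable.of_norm_bounded (g := fun n : ℕ => ‖(α : ℂ)‖ ^ n * ‖x‖)
    ((summable_geometric_of_lt_one (norm_nonneg _) α.norm_lt_one).mul_right _) fun n => ?_
  rw [norm_smul, norm_pow, RCLike.norm_conj]
  have := norm_monomial_le (m := m) n x
  gcongr

/-- The function `x / (1 - ᾱ t)`. -/
def kernelL2 (α : 𝔻) (x : Vec m) : L2 m := ∑' n : ℕ, conj (α : ℂ) ^ n • monomial (n : ℤ) x

theorem coeffCLM_kernelL2 (α : 𝔻) (x : Vec m) (k : ℤ) :
    coeffCLM m k (kernelL2 α x) = if 0 ≤ k then conj (α : ℂ) ^ k.toNat • x else 0 := by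
  have h := (summable_kernel α x).hasSum.mapL (coeffCLM m k)
  simp only [map_smul, coeffCLM_monomial] at h
  refine h.unique ?_
  split_ifs with hk
  · convert! hasSum_ite_eq k.toNat (conj (α : ℂ) ^ k.toNat • x) using 2 with n
    by_cases hn : n = k.toNat
    · rw [if_pos (by omega), if_pos hn, hn]
    · rw [if_neg (by omega), if_neg hn, smul_zero]
  · convert! hasSum_zero using 2 with n
    rw [if_neg (by omega), smul_zero]

theorem kernelL2_mem_H2 (α : 𝔻) (x : Vec m) : kernelL2 α x ∈ H2 m :=
  mem_H2_iff.mpr fun n hn => by rw [coeffCLM_kernelL2, if_neg (by omega)]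

theorem ext_coeff_H2 {f g : H2 m}
    (h : ∀ n : ℕ, coeffCLM m n (f : L2 m) = coeffCLM m n (g : L2 m)) : f = g := by
  refine Subtype.ext (ext_coeffCLM fun n => ?_)
  by_cases hn : 0 ≤ n
  · lift n to ℕ using hn
    exact h n
  · rw [mem_H2_iff.mp f.2 n (by omega), mem_H2_iff.mp g.2 n (by omega)]

/-- The linear map `x ↦ x / (1 - ᾱ t)`. -/
def kernel (α : 𝔻) : Vec m →ₗ[ℂ] H2 m where
  toFun x := ⟨kernelL2 α x, kernelL2_mem_H2 α x⟩
  map_add' x y := ext_coeff_H2 fun n => by simp [coeffCLM_kernelL2]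
  map_smul' c x := ext_coeff_H2 fun n => by simp [coeffCLM_kernelL2, smul_comm c]

theorem coeffCLM_kernel (α : 𝔻) (x : Vec m) (n : ℕ) :
    coeffCLM m n (kernel α x : L2 m) = conj (α : ℂ) ^ n • x := by
  change coeffCLM m n (kernelL2 α x) = _
  simpa using coeffCLM_kernelL2 α x n

theorem inner_kernel_left (α : 𝔻) (x : Vec m) (f : H2 m) :
    inner ℂ (kernel α x) f = inner ℂ x (diskValue f α) := by
  have h1 := (summable_kernel α x).hasSum.mapL (innerSL ℂ (f : L2 m))
  have h2 := (summable_diskValue f α).hasSum.mapL (innerSL ℂ x)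
  have h3 : HasSum (fun n : ℕ => conj (inner ℂ (f : L2 m)
      (conj (α : ℂ) ^ n • (monomial (n : ℤ) x : L2 m))))
      (conj (inner ℂ (f : L2 m) (kernelL2 α x))) := Complex.hasSum_conj'.mpr h1
  rw [inner_conj_symm] at h3
  refine h3.unique ?_
  convert! h2 using 2 with n
  simp only [innerSL_apply_apply]
  rw [inner_conj_symm, inner_smul_left, inner_smul_right, inner_monomial_left]
  simp

theorem diskValue_sub (f g : H2 m) (z : 𝔻) :
    diskValue (f - g) z = diskValue f z - diskValue g z := by
  refine ext_inner_left ℂ fun x => ?_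
  rw [inner_sub_right]
  simp only [← inner_kernel_left]
  rw [inner_sub_right]

theorem diskValue_smul (c : ℂ) (f : H2 m) (z : 𝔻) :
    diskValue (c • f) z = c • diskValue f z := by
  refine ext_inner_left ℂ fun x => ?_
  rw [inner_smul_right]
  simp only [← inner_kernel_left]
  exact inner_smul_right (𝕜 := ℂ) (E := H2 m) _ _ _

/-- Uniqueness of power series coefficients. -/
theorem ext_diskValue {f g : H2 m} (h : ∀ z, diskValue f z = diskValue g z) : f = g := by
  rw [← sub_eq_zero]
  set u := f - g with hu
  have h0 : ∀ z, diskValue u z = 0 := fun z => by rw [hu, diskValue_sub, h, sub_self]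
  let p : FormalMultilinearSeries ℂ ℂ (Vec m) := fun n =>
    ContinuousMultilinearMap.mkPiRing ℂ (Fin n) (coeffCLM m n (u : L2 m))
  have hp : ∀ n, p.coeff n = coeffCLM m n (u : L2 m) := fun n => by
    simp [p, FormalMultilinearSeries.coeff]
  have hps : HasFPowerSeriesAt (0 : ℂ → Vec m) p 0 := by
    rw [hasFPowerSeriesAt_iff]
    filter_upwards [Metric.ball_mem_nhds (0 : ℂ) one_pos] with z hz
    have hz' : ‖z‖ < 1 := by simpa using hz
    have h1 := (summable_diskValue u (UnitDisc.mk z hz')).hasSum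
    have h2 := h0 (UnitDisc.mk z hz')
    rw [diskValue] at h2
    rw [h2] at h1
    simpa [hp] using h1
  refine ext_coeff_H2 fun n => ?_
  rw [← hp, hps.eq_zero]
  simp [FormalMultilinearSeries.coeff]

theorem kernel_injective (α : 𝔻) : Function.Injective (kernel α : Vec m →ₗ[ℂ] H2 m) := by
  intro x y h
  have h1 := coeffCLM_kernel α x 0
  have h2 := coeffCLM_kernel α y 0
  rw [h] at h1
  simpa using h1.symm.trans h2

/-! ### Coanalytic Toeplitz operators act diagonally on kernels -/

/-- The matrix function `∑ w_{-n} zⁿ`, whose value at `t̄` is `w(t)` if `w` is coanalytic. -/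
def coSeries (w : Symbol m) (z : ℂ) : Matrix (Fin m) (Fin m) ℂ :=
  ∑' n : ℕ, z ^ n • w.coeff (-(n : ℤ))

theorem summable_norm_coeff_neg {w : Symbol m} (hw : Summable fun n : ℤ => ‖w.coeff n‖) :
    Summable fun n : ℕ => ‖w.coeff (-(n : ℤ))‖ :=
  hw.comp_injective (i := fun n : ℕ => -(n : ℤ)) fun a b h => by simpa using h

theorem hasSum_coSeries {w : Symbol m} (hw : Summable fun n : ℤ => ‖w.coeff n‖) {z : ℂ}
    (hz : ‖z‖ ≤ 1) : HasSum (fun n : ℕ => z ^ n • w.coeff (-(n : ℤ))) (coSeries w z) := by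
  refine Summable.hasSum (Summable.of_norm_bounded (summable_norm_coeff_neg hw) fun n => ?_)
  rw [norm_smul, norm_pow]
  exact mul_le_of_le_one_left (norm_nonneg _) (pow_le_one₀ (norm_nonneg _) hz)

/-- The `n`-th coefficient of the image is `∑_i ᾱ^i w_{n-i} x`. Coanalyticity removes the terms with
`i < n`, and shifting the index by `n` extracts the factor `ᾱⁿ`. -/
theorem toeplitz_kernel {w : Symbol m} (hw : Summable fun n : ℤ => ‖w.coeff n‖)
    (hco : w.IsCoanalytic) (α : 𝔻) (x : Vec m) :
    toeplitz w (kernel α x) =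
      kernel α (Matrix.toEuclideanCLM (n := Fin m) (𝕜 := ℂ) (coSeries w (conj (α : ℂ))) x) := by
  refine ext_coeff_H2 fun n => ?_
  rw [coeffCLM_kernel, coe_toeplitz, coeffCLM_starProjection, if_pos (by omega)]
  have h1 := (summable_kernel α x).hasSum.mapL (coeffCLM m n ∘L mulOp w)
  simp only [ContinuousLinearMap.comp_apply, map_smul, coeffCLM_mulOp_monomial] at h1
  let L : Matrix (Fin m) (Fin m) ℂ →ₗ[ℂ] Vec m :=
    { toFun := fun M => Matrix.toEuclideanCLM (n := Fin m) (𝕜 := ℂ) M x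
      map_add' := fun M N => by rw [map_add]; rfl
      map_smul' := fun c M => by rw [map_smul]; rfl }
  have hL : Continuous L := LinearMap.continuous_of_finiteDimensional L
  have h2 := ((hasSum_coSeries hw (z := conj (α : ℂ))
    (by rw [RCLike.norm_conj]; exact α.norm_lt_one.le)).map L hL).const_smul
      (conj (α : ℂ) ^ n)
  refine h1.unique ?_
  have h3 : ∑ i ∈ Finset.range n, conj (α : ℂ) ^ i •
      Matrix.toEuclideanCLM (n := Fin m) (𝕜 := ℂ) (w.coeff (n - i)) x = 0 := by
    refine Finset.sum_eq_zero fun i hi => ?_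
    rw [Finset.mem_range] at hi
    rw [hco _ (by omega), map_zero]
    simp
  have h4 := (hasSum_nat_add_iff (f := fun i : ℕ => conj (α : ℂ) ^ i •
      Matrix.toEuclideanCLM (n := Fin m) (𝕜 := ℂ) (w.coeff (n - i)) x) n
      (g := conj (α : ℂ) ^ n • L (coSeries w (conj (α : ℂ))))).mp (by
    convert! h2 using 2 with i
    have h5 : ((n : ℤ) - ((i + n : ℕ) : ℤ)) = -(i : ℤ) := by push_cast; ring
    rw [h5, Function.comp_apply, map_smul, smul_smul, ← pow_add, add_comm n i]
    rfl)
  rw [h3, add_zero] at h4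
  exact h4

/-- Apply `T(w)T(w') = I` to the kernel at `α = z̄`, on which both factors act as matrices; this
replaces a Cauchy product of series. -/
theorem coSeries_mul_coSeries {w w' : Symbol m} (hw : Summable fun n : ℤ => ‖w.coeff n‖)
    (hco : w.IsCoanalytic) (hw' : Summable fun n : ℤ => ‖w'.coeff n‖)
    (hco' : w'.IsCoanalytic) (h : w * w' = 1) {z : ℂ} (hz : ‖z‖ < 1) :
    coSeries w z * coSeries w' z = 1 := by
  set α : 𝔻 := UnitDisc.mk (conj z) (by rwa [RCLike.norm_conj]) with hα
  have hz' : conj (α : ℂ) = z := by simp [hα]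
  have hinj : Function.Injective (Matrix.toEuclideanCLM (n := Fin m) (𝕜 := ℂ)) :=
    EquivLike.injective _
  apply hinj
  ext1 x
  apply kernel_injective α
  have h1 := toeplitz_mul_of_left (b := w') hco.preservesH2Compl
  rw [h, toeplitz_one] at h1
  have h2 := congrArg (fun A : H2 m →L[ℂ] H2 m => A (kernel α x)) h1
  simp only [ContinuousLinearMap.comp_apply, toeplitz_kernel hw hco, toeplitz_kernel hw' hco',
    hz'] at h2
  rw [map_mul, map_one]
  exact h2.symm

end Kernel

/-! ### Blaschke symbols -/

section Blaschke

variable {m : ℕ}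

theorem detCompress_adjoint {E : Type*} [NormedAddCommGroup E] [InnerProductSpace ℂ E]
    [CompleteSpace E] (A : E →L[ℂ] E) (V : {V : Submodule ℂ E // FiniteDimensional ℂ V}) :
    detCompress (ContinuousLinearMap.adjoint A) V = conj (detCompress A V) := by
  have := V.2
  set e := stdOrthonormalBasis ℂ V.1
  have he : Orthonormal ℂ (fun i => (e i : E)) :=
    e.orthonormal.comp_linearIsometry V.1.subtypeₗᵢ
  have hes : Submodule.span ℂ (Set.range fun i => (e i : E)) = V.1 := by
    have := congrArg (Submodule.map V.1.subtype) e.toBasis.span_eq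
    rw [Submodule.map_span, ← Set.range_comp, Submodule.map_subtype_top] at this
    simpa [Function.comp_def] using this
  rw [detCompress_eq_det _ V _ he hes, detCompress_eq_det A V _ he hes,
    starRingEnd_apply, ← Matrix.det_conjTranspose]
  congr 1
  ext i j
  simp [Matrix.conjTranspose_apply, ContinuousLinearMap.adjoint_inner_right]

theorem detCompress_comp_of_adjoint_mapsTo {E : Type*} [NormedAddCommGroup E]
    [InnerProductSpace ℂ E] [CompleteSpace E] (A Y : E →L[ℂ] E)
    (W : {V : Submodule ℂ E // FiniteDimensional ℂ V})
    (hA : ∀ x ∈ W.1, ContinuousLinearMap.adjoint A x ∈ W.1) :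
    detCompress (A ∘L Y) W = detCompress A W * detCompress Y W := by
  apply (starRingEnd ℂ).injective
  rw [map_mul, ← detCompress_adjoint, ← detCompress_adjoint, ← detCompress_adjoint,
    ContinuousLinearMap.adjoint_comp, detCompress_comp_of_mapsTo _ _ _ hA, mul_comm]

/-- The symbol `t ↦ t I`. -/
def shiftSymbol (m : ℕ) : Symbol m where
  toFun t := (t : ℂ) • (1 : Matrix (Fin m) (Fin m) ℂ)
  continuous_toFun := by fun_prop

theorem coeffCLM_mulOp_shiftSymbol (n : ℤ) (f : L2 m) :
    coeffCLM m n (mulOp (shiftSymbol m) f) = coeffCLM m (n - 1) f := by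
  rw [coeffCLM_apply, coeffCLM_apply, fourierCoeff_congr_ae (coeFn_mulOp _ f), fourierCoeff,
    fourierCoeff]
  refine integral_congr_ae (Eventually.of_forall fun θ => ?_)
  have h : (fourier (-(n - 1)) θ : ℂ) = fourier (-n) θ * fourier 1 θ := by
    rw [← fourier_add]
    congr 2
    ring
  change (fourier (-n) θ : ℂ) • Matrix.toEuclideanCLM (n := Fin m) (𝕜 := ℂ)
    ((θ.toCircle : ℂ) • (1 : Matrix (Fin m) (Fin m) ℂ)) (f θ) = (fourier (-(n - 1)) θ : ℂ) • f θ
  rw [h, fourier_one, map_smul, map_one, mul_smul]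
  rfl

/-- The unimodular factor in the definition of `B_α`. -/
def blaschkeConst (α : 𝔻) : ℂ :=
  open Classical in if α = 0 then 1 else -conj (α : ℂ) / (‖(α : ℂ)‖ : ℂ)

theorem norm_blaschkeConst (α : 𝔻) : ‖blaschkeConst α‖ = 1 := by
  unfold blaschkeConst
  split_ifs with h
  · simp
  · have h1 : ‖(α : ℂ)‖ ≠ 0 := by simpa using h
    rw [norm_div, norm_neg, RCLike.norm_conj, Complex.norm_real, norm_norm, div_self h1]

theorem blaschkeFactor_eq (α z : 𝔻) :
    blaschkeFactor α z = blaschkeConst α * (((z : ℂ) - α) / (1 - conj (α : ℂ) * z)) := by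
  unfold blaschkeFactor blaschkeConst
  split_ifs with h
  · simp [h]
  · rfl

/-- The boundary values of `B_α` as a scalar matrix symbol. -/
def blaschkeSymbol (m : ℕ) (α : 𝔻) : Symbol m where
  toFun t := (blaschkeConst α * (mobius α t : ℂ)) • (1 : Matrix (Fin m) (Fin m) ℂ)
  continuous_toFun := by
    have : Continuous fun t => (mobius α t : ℂ) :=
      continuous_subtype_val.comp (mobius α).continuous
    fun_prop

theorem blaschkeSymbol_comm (α : 𝔻) (a : Symbol m) :
    blaschkeSymbol m α * a = a * blaschkeSymbol m α := by
  ext1 t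
  simp [blaschkeSymbol]

theorem star_blaschkeSymbol_mul (α : 𝔻) :
    star (blaschkeSymbol m α) * blaschkeSymbol m α = 1 := by
  ext1 t
  have h : conj (blaschkeConst α * (mobius α t : ℂ)) * (blaschkeConst α * (mobius α t : ℂ)) = 1 := by
    rw [RCLike.conj_mul, norm_mul, norm_blaschkeConst, Circle.norm_coe]
    simp
  change star ((blaschkeConst α * (mobius α t : ℂ)) • (1 : Matrix (Fin m) (Fin m) ℂ)) *
    ((blaschkeConst α * (mobius α t : ℂ)) • (1 : Matrix (Fin m) (Fin m) ℂ)) = 1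
  rw [star_smul, star_one, smul_mul_smul_comm, mul_one, ← starRingEnd_apply, h, one_smul]

/-- The defining relation of the Blaschke factor with its denominator cleared. On Fourier
coefficients it is a two-term recurrence, from which the properties of multiplication by `B_α` on
`H²` are derived. -/
theorem blaschkeSymbol_sub (α : 𝔻) :
    blaschkeSymbol m α - conj (α : ℂ) • (shiftSymbol m * blaschkeSymbol m α) =
      blaschkeConst α • (shiftSymbol m - (α : ℂ) • 1) := by
  ext1 t
  have hd := mobius_denom_ne_zero α t
  have hmob : (mobius α t : ℂ) = ((t : ℂ) - α) / (1 - conj (α : ℂ) * t) := rfl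
  change (blaschkeConst α * (mobius α t : ℂ)) • (1 : Matrix (Fin m) (Fin m) ℂ) -
    conj (α : ℂ) • (((t : ℂ) • (1 : Matrix (Fin m) (Fin m) ℂ)) *
      ((blaschkeConst α * (mobius α t : ℂ)) • (1 : Matrix (Fin m) (Fin m) ℂ))) =
    blaschkeConst α • ((t : ℂ) • (1 : Matrix (Fin m) (Fin m) ℂ) - (α : ℂ) • 1)
  rw [smul_mul_smul_comm, mul_one, smul_smul, ← sub_smul, ← sub_smul, smul_smul]
  congr 1
  rw [mul_comm] at hd
  rw [hmob, mul_comm (conj (α : ℂ)) (t : ℂ)]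
  field_simp

theorem coeffCLM_mulOp_blaschkeSymbol (α : 𝔻) (h : L2 m) (n : ℤ) :
    coeffCLM m n (mulOp (blaschkeSymbol m α) h) -
        conj (α : ℂ) • coeffCLM m (n - 1) (mulOp (blaschkeSymbol m α) h) =
      blaschkeConst α • (coeffCLM m (n - 1) h - (α : ℂ) • coeffCLM m n h) := by
  have h1 := congrArg (fun s : Symbol m => coeffCLM m n (mulOp s h)) (blaschkeSymbol_sub (m := m) α)
  simp only [mulOp_sub, mulOp_smul, mulOp_mul, mulOp_one, sub_apply, smul_apply,
    ContinuousLinearMap.comp_apply, map_sub, map_smul, coeffCLM_mulOp_shiftSymbol,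
    one_apply_eq_self] at h1
  exact h1

/-- For negative indices the recurrence reads `h_n = ᾱ h_{n-1}`. Iterated `k` times it gives `‖h_n‖
≤ |α|^k ‖h‖`, so `h_n = 0`. -/
theorem preservesH2_blaschkeSymbol (α : 𝔻) : PreservesH2 (blaschkeSymbol m α) := by
  intro f hf
  set h := mulOp (blaschkeSymbol m α) f with hh
  have hrec : ∀ n : ℤ, n < 0 → coeffCLM m n h = conj (α : ℂ) • coeffCLM m (n - 1) h := by
    intro n hn
    have h1 := coeffCLM_mulOp_blaschkeSymbol α f n
    rw [mem_H2_iff.mp hf n hn, mem_H2_iff.mp hf (n - 1) (by omega)] at h1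
    simpa [sub_eq_zero] using h1
  have hbound : ∀ (k : ℕ) (n : ℤ), n < 0 → ‖coeffCLM m n h‖ ≤ ‖(α : ℂ)‖ ^ k * ‖h‖ := by
    intro k
    induction k with
    | zero => intro n _; simpa using norm_coeffCLM_le n h
    | succ k ih =>
      intro n hn
      rw [hrec n hn, norm_smul, RCLike.norm_conj, pow_succ', mul_assoc]
      exact mul_le_mul_of_nonneg_left (ih (n - 1) (by omega)) (norm_nonneg _)
  rw [mem_H2_iff]
  intro n hn
  rw [← norm_le_zero_iff]
  have hlim : Tendsto (fun k : ℕ => ‖(α : ℂ)‖ ^ k * ‖h‖) atTop (𝓝 (0 * ‖h‖)) :=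
    (tendsto_pow_atTop_nhds_zero_of_lt_one (norm_nonneg _) α.norm_lt_one).mul_const _
  rw [zero_mul] at hlim
  exact ge_of_tendsto' hlim fun k => hbound k n hn

theorem unitDisc_denom_ne_zero (α z : 𝔻) : 1 - conj (α : ℂ) * (z : ℂ) ≠ 0 := by
  intro h
  have h1 : ‖conj (α : ℂ) * (z : ℂ)‖ = 1 := by rw [← sub_eq_zero.mp h, norm_one]
  rw [norm_mul, RCLike.norm_conj] at h1
  have h2 := α.norm_lt_one
  have h3 := z.norm_lt_one
  nlinarith [norm_nonneg (α : ℂ), norm_nonneg (z : ℂ)]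

theorem diskValue_eq_of_coeff {f g : H2 m} {z : 𝔻}
    (h : ∀ n : ℕ, coeffCLM m n (f : L2 m) = coeffCLM m ((n : ℤ) - 1) (g : L2 m)) :
    diskValue f z = (z : ℂ) • diskValue g z := by
  have hs := summable_diskValue f z
  rw [diskValue, hs.tsum_eq_zero_add, h 0, mem_H2_iff.mp g.2 _ (by simp), smul_zero, zero_add,
    diskValue, ← (summable_diskValue g z).tsum_const_smul]
  refine tsum_congr fun n => ?_
  rw [h (n + 1), pow_succ', mul_smul]
  push_cast
  rw [add_sub_cancel_right]

theorem shiftSymbol_preservesH2 : PreservesH2 (shiftSymbol m) := fun f hf =>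
  mem_H2_iff.mpr fun n hn => by
    rw [coeffCLM_mulOp_shiftSymbol, mem_H2_iff.mp hf _ (by omega)]

theorem diskValue_toeplitz_shiftSymbol (f : H2 m) (z : 𝔻) :
    diskValue (toeplitz (shiftSymbol m) f) z = (z : ℂ) • diskValue f z :=
  diskValue_eq_of_coeff fun n => by
    rw [coe_toeplitz_of_preservesH2 shiftSymbol_preservesH2, coeffCLM_mulOp_shiftSymbol]

theorem diskValue_toeplitz_blaschkeSymbol (α : 𝔻) (f : H2 m) (z : 𝔻) :
    diskValue (toeplitz (blaschkeSymbol m α) f) z = blaschkeFactor α z • diskValue f z := by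
  set g := toeplitz (blaschkeSymbol m α) f with hg
  have hcg : (g : L2 m) = mulOp (blaschkeSymbol m α) f :=
    coe_toeplitz_of_preservesH2 (preservesH2_blaschkeSymbol α) f
  have h1 : g - conj (α : ℂ) • toeplitz (shiftSymbol m) g =
      blaschkeConst α • (toeplitz (shiftSymbol m) f - (α : ℂ) • f) := by
    refine ext_coeff_H2 fun n => ?_
    have := coeffCLM_mulOp_blaschkeSymbol α (f : L2 m) n
    simp only [Submodule.coe_sub, Submodule.coe_smul, map_sub, map_smul,
      coe_toeplitz_of_preservesH2 shiftSymbol_preservesH2, coeffCLM_mulOp_shiftSymbol]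
    rw [hcg]
    exact this
  have h2 := congrArg (fun u => diskValue u z) h1
  simp only [diskValue_sub, diskValue_smul, diskValue_toeplitz_shiftSymbol] at h2
  have hd := unitDisc_denom_ne_zero α z
  have h3 : (1 - conj (α : ℂ) * z) • diskValue g z =
      (blaschkeConst α * ((z : ℂ) - α)) • diskValue f z := by
    rw [sub_smul, one_smul, mul_smul, mul_smul, sub_smul]
    exact h2
  rw [blaschkeFactor_eq, mul_div_assoc', div_eq_inv_mul, mul_smul, ← h3, smul_smul,
    inv_mul_cancel₀ hd, one_smul]

theorem blaschkeFactor_self (α : 𝔻) : blaschkeFactor α α = 0 := by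
  simp [blaschkeFactor_eq]

theorem toeplitz_star_blaschkeSymbol_eq_zero_iff (α : 𝔻) (f : H2 m) :
    toeplitz (star (blaschkeSymbol m α)) f = 0 ↔ f ∈ LinearMap.range (kernel (m := m) α) := by
  constructor
  · intro hf
    -- Here `h` is orthogonal to `H²` and `f = B_α h`. At index `n + 1 ≥ 1` both coefficients of `h`
    -- in the recurrence vanish, so `f_{n+1} = ᾱ f_n` and `f` is the kernel at `f_0`.
    set h := mulOp (star (blaschkeSymbol m α)) f with hh
    have hperp : h ∈ (H2 m)ᗮ := by
      rw [← Submodule.starProjection_apply_eq_zero_iff, hh, ← coe_toeplitz, hf]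
      rfl
    have hfh : mulOp (blaschkeSymbol m α) h = f := by
      rw [hh, ← ContinuousLinearMap.comp_apply, ← mulOp_mul, blaschkeSymbol_comm,
        star_blaschkeSymbol_mul, mulOp_one]
      rfl
    refine ⟨coeffCLM m 0 (f : L2 m), ext_coeff_H2 fun n => ?_⟩
    rw [coeffCLM_kernel]
    induction n with
    | zero => simp
    | succ n ih =>
      have h1 := coeffCLM_mulOp_blaschkeSymbol α h ((n + 1 : ℕ) : ℤ)
      rw [mem_H2_orthogonal_iff.mp hperp _ (by omega),
        mem_H2_orthogonal_iff.mp hperp _ (by omega), hfh, smul_zero, sub_zero, smul_zero,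
        sub_eq_zero] at h1
      rw [h1, pow_succ', mul_smul, ih]
      push_cast
      rw [add_sub_cancel_right]
  · rintro ⟨x, rfl⟩
    refine ext_inner_right ℂ fun g => ?_
    rw [← adjoint_toeplitz, ContinuousLinearMap.adjoint_inner_left, inner_kernel_left,
      diskValue_toeplitz_blaschkeSymbol, blaschkeFactor_self, zero_smul, inner_zero_right,
      inner_zero_left]

/-! ### Model spaces of finite Blaschke products -/

/-- The boundary values of `u_N` as a scalar matrix symbol. -/
def partialSymbol (m : ℕ) (α : ℕ → 𝔻) : ℕ → Symbol m
  | 0 => 1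
  | N + 1 => partialSymbol m α N * blaschkeSymbol m (α N)

variable (α : ℕ → 𝔻)

theorem partialSymbol_comm (N : ℕ) (a : Symbol m) :
    partialSymbol m α N * a = a * partialSymbol m α N := by
  induction N with
  | zero => simp [partialSymbol]
  | succ N ih => rw [partialSymbol, mul_assoc, blaschkeSymbol_comm, ← mul_assoc, ih, mul_assoc]

theorem star_partialSymbol_comm (N : ℕ) (a : Symbol m) :
    star (partialSymbol m α N) * a = a * star (partialSymbol m α N) := by
  have h := congrArg star (partialSymbol_comm α N (star a))
  simpa using h.symm

theorem star_partialSymbol_mul (N : ℕ) :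
    star (partialSymbol m α N) * partialSymbol m α N = 1 := by
  induction N with
  | zero => simp [partialSymbol]
  | succ N ih =>
    rw [partialSymbol, star_mul, mul_assoc, ← mul_assoc (star (partialSymbol m α N)), ih, one_mul,
      star_blaschkeSymbol_mul]

theorem preservesH2_partialSymbol (N : ℕ) : PreservesH2 (partialSymbol m α N) := by
  induction N with
  | zero => exact preservesH2_one
  | succ N ih => exact ih.mul (preservesH2_blaschkeSymbol _)

theorem diskValue_toeplitz_partialSymbol (N : ℕ) (f : H2 m) (z : 𝔻) :
    diskValue (toeplitz (partialSymbol m α N) f) z = partialBlaschke α N z • diskValue f z := by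
  induction N generalizing f with
  | zero => simp [partialSymbol, partialBlaschke, toeplitz_one]
  | succ N ih =>
    rw [partialSymbol, toeplitz_mul_of_right (preservesH2_blaschkeSymbol _),
      ContinuousLinearMap.comp_apply, ih, diskValue_toeplitz_blaschkeSymbol, smul_smul,
      partialBlaschke, partialBlaschke, Finset.prod_range_succ]

theorem toeplitz_star_partialSymbol_comp (N : ℕ) :
    toeplitz (star (partialSymbol m α N)) ∘L toeplitz (partialSymbol m α N) = 1 := by
  rw [← toeplitz_mul_of_right (preservesH2_partialSymbol α N), star_partialSymbol_mul,
    toeplitz_one]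

theorem mem_mulH2_partialBlaschke_iff (N : ℕ) (f : H2 m) :
    f ∈ mulH2 m (partialBlaschke α N) ↔ ∃ g, toeplitz (partialSymbol m α N) g = f := by
  constructor
  · rintro ⟨g, hg⟩
    exact ⟨g, ext_diskValue fun z => by rw [diskValue_toeplitz_partialSymbol, hg]⟩
  · rintro ⟨g, rfl⟩
    exact ⟨g, fun z => diskValue_toeplitz_partialSymbol α N g z⟩

/-- `u_N H²` is the range of `T(u_N)`, and its orthogonal complement is the kernel of the adjoint.
-/
theorem mem_modelSpace_partialBlaschke_iff (N : ℕ) (f : H2 m) :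
    f ∈ modelSpace m (partialBlaschke α N) ↔ toeplitz (star (partialSymbol m α N)) f = 0 := by
  rw [modelSpace, Submodule.mem_orthogonal, ← adjoint_toeplitz]
  constructor
  · intro h
    refine ext_inner_left ℂ fun g => ?_
    rw [ContinuousLinearMap.adjoint_inner_right, inner_zero_right]
    exact h _ ((mem_mulH2_partialBlaschke_iff α N _).mpr ⟨g, rfl⟩)
  · intro h u hu
    obtain ⟨g, rfl⟩ := (mem_mulH2_partialBlaschke_iff α N u).mp hu
    rw [← ContinuousLinearMap.adjoint_inner_right, h, inner_zero_right]

/-- The map `x ↦ u_N x / (1 - ᾱ_N t)`. -/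
def wanderingMap (m : ℕ) (N : ℕ) : Vec m →ₗ[ℂ] H2 m :=
  (toeplitz (partialSymbol m α N) : H2 m →ₗ[ℂ] H2 m) ∘ₗ kernel (α N)

theorem wanderingMap_apply (N : ℕ) (x : Vec m) :
    wanderingMap α m N x = toeplitz (partialSymbol m α N) (kernel (α N) x) := rfl

/-- `T(ū_{N+1}) = T(B̄)T(ū_N)`, and the kernel of `T(B̄)` consists of the functions `x / (1 - ᾱ_N
t)`. If `T(ū_N) f` is such a function, subtracting `u_N` times it from `f` leaves an element of
`K_{u_N}`. -/
theorem modelSpace_succ (N : ℕ) :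
    modelSpace m (partialBlaschke α (N + 1)) =
      modelSpace m (partialBlaschke α N) ⊔ LinearMap.range (wanderingMap α m N) := by
  have hTT : ∀ f, toeplitz (star (partialSymbol m α N)) (toeplitz (partialSymbol m α N) f) = f :=
    fun f => congrArg (fun A : H2 m →L[ℂ] H2 m => A f) (toeplitz_star_partialSymbol_comp α N)
  have hsucc : ∀ f : H2 m, toeplitz (star (partialSymbol m α (N + 1))) f =
      toeplitz (star (blaschkeSymbol m (α N))) (toeplitz (star (partialSymbol m α N)) f) := by
    intro f
    rw [partialSymbol, star_mul, toeplitz_mul_of_left (preservesH2_blaschkeSymbol _).star]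
    rfl
  ext f
  rw [mem_modelSpace_partialBlaschke_iff, hsucc, Submodule.mem_sup]
  constructor
  · intro h
    obtain ⟨x, hx⟩ := (toeplitz_star_blaschkeSymbol_eq_zero_iff (α N) _).mp h
    refine ⟨f - wanderingMap α m N x, ?_, wanderingMap α m N x, ⟨x, rfl⟩, by abel⟩
    rw [mem_modelSpace_partialBlaschke_iff, map_sub, wanderingMap_apply, hTT, hx, sub_self]
  · rintro ⟨g, hg, _, ⟨x, rfl⟩, rfl⟩
    rw [map_add, (mem_modelSpace_partialBlaschke_iff α N g).mp hg, zero_add, wanderingMap_apply,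
      hTT, toeplitz_star_blaschkeSymbol_eq_zero_iff]
    exact ⟨x, rfl⟩

theorem modelSpace_zero : modelSpace m (partialBlaschke α 0) = ⊥ := by
  rw [Submodule.eq_bot_iff]
  intro f hf
  rw [mem_modelSpace_partialBlaschke_iff, partialSymbol, star_one, toeplitz_one] at hf
  exact hf

theorem finiteDimensional_modelSpace (N : ℕ) :
    FiniteDimensional ℂ (modelSpace m (partialBlaschke α N)) := by
  induction N with
  | zero => rw [modelSpace_zero]; infer_instance
  | succ N ih => rw [modelSpace_succ]; infer_instance

/-- The model space of `u_N` as a finite-dimensional subspace. -/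
def finiteModelSpace (m N : ℕ) : {V : Submodule ℂ (H2 m) // FiniteDimensional ℂ V} :=
  ⟨modelSpace m (partialBlaschke α N), finiteDimensional_modelSpace α N⟩

/-- Both symbols preserve the complement of `H²` and `u_N` is scalar, so `T(w)` commutes with
`T(ū_N)` and preserves its kernel. -/
theorem toeplitz_mem_modelSpace {w : Symbol m} (hw : PreservesH2Compl w) (N : ℕ) {f : H2 m}
    (hf : f ∈ modelSpace m (partialBlaschke α N)) :
    toeplitz w f ∈ modelSpace m (partialBlaschke α N) := by
  rw [mem_modelSpace_partialBlaschke_iff] at hf ⊢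
  rw [← ContinuousLinearMap.comp_apply, ← toeplitz_mul_of_left (preservesH2_partialSymbol α N).star,
    star_partialSymbol_comm, toeplitz_mul_of_left hw, ContinuousLinearMap.comp_apply, hf, map_zero]

theorem det_toEuclideanCLM (M : Matrix (Fin m) (Fin m) ℂ) :
    LinearMap.det ((Matrix.toEuclideanCLM (n := Fin m) (𝕜 := ℂ) M : Vec m →L[ℂ] Vec m) :
      Vec m →ₗ[ℂ] Vec m) = M.det := by
  rw [Matrix.coe_toEuclideanCLM_eq_toEuclideanLin, Matrix.toEuclideanLin,
    Matrix.toLpLin_eq_toLin,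
    LinearMap.det_toLin]

theorem detCompress_toeplitz_wandering {w : Symbol m} (hw : Summable fun n : ℤ => ‖w.coeff n‖)
    (hco : w.IsCoanalytic) (N : ℕ) :
    detCompress (toeplitz w) ⟨LinearMap.range (wanderingMap α m N), inferInstance⟩ =
      (coSeries w (conj (α N : ℂ))).det := by
  have hTT : ∀ f, toeplitz (star (partialSymbol m α N)) (toeplitz (partialSymbol m α N) f) = f :=
    fun f => congrArg (fun A : H2 m →L[ℂ] H2 m => A f) (toeplitz_star_partialSymbol_comp α N)
  have hinj : Function.Injective (wanderingMap α m N) := by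
    intro x y hxy
    rw [wanderingMap_apply, wanderingMap_apply] at hxy
    have := congrArg (toeplitz (star (partialSymbol m α N))) hxy
    rw [hTT, hTT] at this
    exact kernel_injective _ this
  let e := LinearEquiv.ofInjective (wanderingMap α m N) hinj
  have he : ∀ x, (e x : H2 m) = wanderingMap α m N x := fun x => rfl
  set F : Vec m →ₗ[ℂ] Vec m := ((Matrix.toEuclideanCLM (n := Fin m) (𝕜 := ℂ)
    (coSeries w (conj (α N : ℂ))) : Vec m →L[ℂ] Vec m) : Vec m →ₗ[ℂ] Vec m) with hF
  rw [← det_toEuclideanCLM, ← hF, ← LinearMap.det_conj F e]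
  unfold detCompress
  congr 1
  refine LinearMap.ext fun y => ?_
  obtain ⟨x, rfl⟩ := e.surjective y
  refine ext_inner_left ℂ fun v => ?_
  obtain ⟨u, rfl⟩ := e.surjective v
  simp only [LinearMap.comp_apply, LinearEquiv.coe_coe, LinearEquiv.symm_apply_apply]
  -- The scalar unimodular factor `u_N` cancels, so the compression of `T(w)` to `u_N` times the
  -- kernels is, in the coordinate `x`, the matrix by which `T(w)` acts on the kernels themselves.
  have hsws : toeplitz (star (partialSymbol m α N)) ∘L toeplitz w ∘L
      toeplitz (partialSymbol m α N) = toeplitz w := by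
    rw [← toeplitz_mul_of_right (preservesH2_partialSymbol α N),
      ← toeplitz_mul_of_left (preservesH2_partialSymbol α N).star, ← mul_assoc,
      star_partialSymbol_comm, mul_assoc, star_partialSymbol_mul, mul_one]
  have h1 : inner ℂ (e u) (compress (LinearMap.range (wanderingMap α m N)) (toeplitz w) (e x)) =
      inner ℂ (e u : H2 m) (toeplitz w (e x : H2 m)) := by
    simp [compress]
  have h2 : inner ℂ (e u) (e (F x)) = inner ℂ (e u : H2 m) (e (F x) : H2 m) := rfl
  refine h1.trans (Eq.trans ?_ h2.symm)
  rw [he, he, he, wanderingMap_apply, wanderingMap_apply, wanderingMap_apply,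
    ← ContinuousLinearMap.adjoint_inner_right, ← ContinuousLinearMap.adjoint_inner_right,
    adjoint_toeplitz, hTT]
  have h3 := congrArg (fun A : H2 m →L[ℂ] H2 m => A (kernel (α N) x)) hsws
  simp only [ContinuousLinearMap.comp_apply] at h3
  rw [h3, toeplitz_kernel hw hco]
  rfl

theorem detCompress_toeplitz_modelSpace {w : Symbol m} (hw : Summable fun n : ℤ => ‖w.coeff n‖)
    (hco : w.IsCoanalytic) (N : ℕ) :
    detCompress (toeplitz w) (finiteModelSpace α m N) =
      ∏ j ∈ Finset.range N, (coSeries w (conj (α j : ℂ))).det := by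
  induction N with
  | zero =>
    rw [Finset.prod_range_zero]
    refine detCompress_eq_one fun x hx y _ => ?_
    have hx' : x ∈ modelSpace m (partialBlaschke α 0) := hx
    rw [modelSpace_zero, Submodule.mem_bot] at hx'
    simp [hx']
  | succ N ih =>
    rw [Finset.prod_range_succ, ← ih, ← detCompress_toeplitz_wandering α hw hco]
    have horth : ∀ x ∈ modelSpace m (partialBlaschke α N),
        ∀ y ∈ LinearMap.range (wanderingMap α m N), inner ℂ y x = 0 := by
      rintro x hx _ ⟨v, rfl⟩
      exact (Submodule.mem_orthogonal _ _).mp hx _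
        ((mem_mulH2_partialBlaschke_iff α N _).mpr ⟨_, rfl⟩)
    refine detCompress_sup (modelSpace_succ α N) ?_ _ ?_
    · exact (Submodule.isOrtho_iff_inner_eq.mpr fun y hy x hx => horth x hx y hy).symm
    · exact fun x hx y hy => horth _ (toeplitz_mem_modelSpace α hco.preservesH2Compl N hx) y hy

end Blaschke

/-! ### Continuous logarithms and geometric means -/

section Logarithm

variable {m : ℕ}

theorem coeff_apply (a : Symbol m) (n : ℤ) (i j : Fin m) :
    a.coeff n i j = fourierCoeff (fun θ : Angle => a θ.toCircle i j) n := by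
  let L : Matrix (Fin m) (Fin m) ℂ →L[ℂ] ℂ := LinearMap.toContinuousLinearMap
    (Matrix.entryLinearMap ℂ ℂ i j)
  have key : L (a.coeff n) = ∫ θ : Angle, L ((fourier (-n) θ : ℂ) • a θ.toCircle) ∂σ := by
    refine (ContinuousLinearMap.integral_comp_comm L
      (φ := fun θ : Angle => (fourier (-n) θ : ℂ) • a θ.toCircle) ?_).symm
    refine (Continuous.integrable_of_hasCompactSupport ?_ (HasCompactSupport.of_compactSpace _))
    exact (fourier (-n)).continuous.smul (a.continuous.comp AddCircle.continuous_toCircle)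
  exact key

theorem hasSum_coSeries_apply {w : Symbol m} (hw : Summable fun n : ℤ => ‖w.coeff n‖) {z : ℂ}
    (hz : ‖z‖ ≤ 1) (i j : Fin m) :
    HasSum (fun n : ℕ => z ^ n * w.coeff (-(n : ℤ)) i j) (coSeries w z i j) :=
  (hasSum_coSeries hw hz).map (Matrix.entryLinearMap ℂ ℂ i j)
    (LinearMap.continuous_of_finiteDimensional _)

theorem norm_pow_mul_coeff_le {w : Symbol m} {z : ℂ} (hz : ‖z‖ ≤ 1) (i j : Fin m) (n : ℕ) :
    ‖z ^ n * w.coeff (-(n : ℤ)) i j‖ ≤ ‖w.coeff (-(n : ℤ))‖ := by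
  rw [norm_mul, norm_pow]
  exact (mul_le_of_le_one_left (norm_nonneg _) (pow_le_one₀ (norm_nonneg _) hz)).trans
    (Matrix.norm_entry_le_entrywise_sup_norm _)

theorem continuousOn_det_coSeries {w : Symbol m} (hw : Summable fun n : ℤ => ‖w.coeff n‖) :
    ContinuousOn (fun z => (coSeries w z).det) (Metric.closedBall 0 1) := by
  have h : ∀ i j, ContinuousOn (fun z => coSeries w z i j) (Metric.closedBall 0 1) := by
    intro i j
    refine (continuousOn_tsum (f := fun (n : ℕ) (z : ℂ) => z ^ n * w.coeff (-(n : ℤ)) i j)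
      (fun n => by fun_prop) (summable_norm_coeff_neg hw) fun n z hz =>
        norm_pow_mul_coeff_le (by simpa using hz) i j n).congr fun z hz => ?_
    exact ((hasSum_coSeries_apply hw (by simpa using hz) i j).tsum_eq).symm
  simp only [Matrix.det_apply]
  fun_prop

theorem differentiableOn_det_coSeries {w : Symbol m} (hw : Summable fun n : ℤ => ‖w.coeff n‖) :
    DifferentiableOn ℂ (fun z => (coSeries w z).det) (Metric.ball 0 1) := by
  have h : ∀ i j, DifferentiableOn ℂ (fun z => coSeries w z i j) (Metric.ball 0 1) := by
    intro i j
    refine (differentiableOn_tsum_of_summable_norm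
      (F := fun (n : ℕ) (z : ℂ) => z ^ n * w.coeff (-(n : ℤ)) i j)
      (summable_norm_coeff_neg hw) (fun n => by fun_prop) Metric.isOpen_ball fun n z hz =>
        norm_pow_mul_coeff_le (mem_ball_zero_iff.mp hz).le i j n).congr fun z hz => ?_
    exact ((hasSum_coSeries_apply hw (mem_ball_zero_iff.mp hz).le i j).tsum_eq).symm
  simp only [Matrix.det_apply]
  fun_prop

/-- An absolutely convergent Fourier series represents its continuous function at every point; only
nonpositive indices contribute. -/
theorem coSeries_conj_circle {w : Symbol m} (hw : Summable fun n : ℤ => ‖w.coeff n‖)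
    (hco : w.IsCoanalytic) (t : Circle) : coSeries w (conj (t : ℂ)) = w t := by
  obtain ⟨θ, rfl⟩ : ∃ θ : Angle, θ.toCircle = t := by
    obtain ⟨x, rfl⟩ := Circle.exp_surjective t
    refine ⟨(x : Angle), ?_⟩
    rw [AddCircle.toCircle_apply_mk]
    congr 1
    field_simp
  ext i j
  have h1 := hasSum_coSeries_apply hw (z := conj ((θ.toCircle : Circle) : ℂ))
    (by rw [RCLike.norm_conj, Circle.norm_coe]) i j
  set f : C(Angle, ℂ) := ⟨fun θ => w θ.toCircle i j, by
    exact ((w.continuous.comp AddCircle.continuous_toCircle).matrix_elem i j)⟩ with hf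
  have hfc : ∀ n, fourierCoeff f n = w.coeff n i j := fun n => (coeff_apply w n i j).symm
  have hs : Summable (fourierCoeff f) := by
    refine Summable.of_norm_bounded hw fun n => ?_
    rw [hfc]
    exact Matrix.norm_entry_le_entrywise_sup_norm _
  have h2 := has_pointwise_sum_fourier_series_of_summable hs θ
  have hinj : Function.Injective fun n : ℕ => -(n : ℤ) := fun a b h => by simpa using h
  rw [← hinj.hasSum_iff] at h2
  · refine h1.unique ?_
    convert! h2 using 2 with n
    rw [Function.comp_apply, hfc, fourier_neg, smul_eq_mul, mul_comm]
    congr 1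
    rw [← map_pow, fourier_apply, AddCircle.toCircle_zsmul]
    simp
  · intro n hn
    have : 0 < n := by
      by_contra h0
      exact hn ⟨(-n).toNat, by simp only; omega⟩
    rw [hfc, hco n this]
    simp

/-- A continuous nonvanishing function on the closed disk which is analytic in the open disk has a
logarithm with the same properties. -/
theorem exists_log_of_continuousOn_closedBall {F : ℂ → ℂ}
    (hc : ContinuousOn F (Metric.closedBall 0 1))
    (hd : DifferentiableOn ℂ F (Metric.ball 0 1)) (h0 : ∀ z ∈ Metric.closedBall (0 : ℂ) 1, F z ≠ 0) :
    ∃ L : ℂ → ℂ, Continuous L ∧ DifferentiableOn ℂ L (Metric.ball 0 1) ∧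
      ∀ z ∈ Metric.closedBall (0 : ℂ) 1, Complex.exp (L z) = F z := by
  -- Radial retraction onto the closed disk. It extends `F` to a continuous nonvanishing function on
  -- the simply connected plane, which lifts through the covering `exp`.
  let r : ℂ → ℂ := fun z => z / (max 1 ‖z‖ : ℝ)
  have hr0 : ∀ z : ℂ, (0 : ℝ) < max 1 ‖z‖ := fun z => lt_of_lt_of_le one_pos (le_max_left _ _)
  have hr : ∀ z, r z ∈ Metric.closedBall (0 : ℂ) 1 := by
    intro z
    rw [mem_closedBall_zero_iff, norm_div, Complex.norm_real, Real.norm_of_nonneg (hr0 z).le,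
      div_le_one (hr0 z)]
    exact le_max_right _ _
  have hrc : Continuous r := by
    refine continuous_id.div (by fun_prop) fun z => ?_
    exact_mod_cast (hr0 z).ne'
  have hr1 : ∀ z ∈ Metric.closedBall (0 : ℂ) 1, r z = z := by
    intro z hz
    rw [mem_closedBall_zero_iff] at hz
    simp [r, max_eq_left hz]
  have hgc : Continuous fun z => F (r z) := hc.comp_continuous hrc hr
  obtain ⟨L, ⟨-, hL⟩, -⟩ := isCoveringMapOn_exp.existsUnique_continuousMap_lifts
    (⟨fun z => F (r z), hgc⟩ : C(ℂ, ℂ)) (a₀ := 0) (exp_log (h0 _ (hr 0)))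
    (fun z => h0 _ (hr z))
  have hexp : ∀ z, Complex.exp (L z) = F (r z) := fun z => congrFun hL z
  have hexp1 : ∀ z ∈ Metric.closedBall (0 : ℂ) 1, Complex.exp (L z) = F z := fun z hz => by
    rw [hexp, hr1 z hz]
  refine ⟨L, L.continuous, fun z hz => DifferentiableAt.differentiableWithinAt ?_, hexp1⟩
  have hzF := h0 z (Metric.ball_subset_closedBall hz)
  have hFd : DifferentiableAt ℂ F z := (hd z hz).differentiableAt (Metric.isOpen_ball.mem_nhds hz)
  -- Near `z` the continuous lift equals this holomorphic function, because `Im(L y - L z)` lies in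
  -- `(-π, π)` there and the principal logarithm inverts `exp`.
  have hd1 : DifferentiableAt ℂ (fun y => L z + Complex.log (F y / F z)) z := by
    refine (DifferentiableAt.clog (hFd.div_const _) ?_).const_add _
    rw [div_self hzF]
    exact one_mem_slitPlane
  refine hd1.congr_of_eventuallyEq ?_
  have hcont : Tendsto (fun y => (L y - L z).im) (𝓝 z) (𝓝 0) := by
    have : Continuous fun y => (L y - L z).im := by fun_prop
    simpa using this.tendsto z
  filter_upwards [Metric.isOpen_ball.mem_nhds hz, hcont.eventually
    (Ioo_mem_nhds (neg_lt_zero.mpr Real.pi_pos) Real.pi_pos)] with y hy1 hy2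
  rw [← hexp1 y (Metric.ball_subset_closedBall hy1), ← hexp1 z (Metric.ball_subset_closedBall hz),
    ← Complex.exp_sub, Complex.log_exp hy2.1 hy2.2.le]
  ring

theorem det_coSeries_ne_zero {w w' : Symbol m} (hw : Summable fun n : ℤ => ‖w.coeff n‖)
    (hco : w.IsCoanalytic) (hw' : Summable fun n : ℤ => ‖w'.coeff n‖)
    (hco' : w'.IsCoanalytic) (h : w * w' = 1) {z : ℂ} (hz : ‖z‖ ≤ 1) :
    (coSeries w z).det ≠ 0 := by
  have key : coSeries w z * coSeries w' z = 1 := by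
    rcases hz.lt_or_eq with hz | hz
    · exact coSeries_mul_coSeries hw hco hw' hco' h hz
    · set t : Circle := ⟨conj z, by
        change _ ∈ Metric.sphere (0 : ℂ) 1
        rw [mem_sphere_zero_iff_norm, RCLike.norm_conj, hz]⟩ with ht
      have hzt : z = conj (t : ℂ) := by simp [ht]
      rw [hzt, coSeries_conj_circle hw hco, coSeries_conj_circle hw' hco',
        ← ContinuousMap.mul_apply, h]
      rfl
  intro h0
  have h1 := congrArg Matrix.det key
  rw [Matrix.det_mul, h0, zero_mul, Matrix.det_one] at h1
  exact zero_ne_one h1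

theorem exists_log_det_coSeries {w w' : Symbol m} (hw : Summable fun n : ℤ => ‖w.coeff n‖)
    (hco : w.IsCoanalytic) (hw' : Summable fun n : ℤ => ‖w'.coeff n‖)
    (hco' : w'.IsCoanalytic) (h : w * w' = 1) :
    ∃ L : ℂ → ℂ, Continuous L ∧ DifferentiableOn ℂ L (Metric.ball 0 1) ∧
      ∀ z ∈ Metric.closedBall (0 : ℂ) 1, Complex.exp (L z) = (coSeries w z).det :=
  exists_log_of_continuousOn_closedBall (continuousOn_det_coSeries hw)
    (differentiableOn_det_coSeries hw) fun z hz =>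
      det_coSeries_ne_zero hw hco hw' hco' h (by simpa using hz)

/-! ### Mean values of logarithms composed with Möbius maps -/

theorem normSq_mobius_identity (α s : ℂ) :
    ‖1 + α * s‖ ^ 2 - ‖s + conj α‖ ^ 2 = (1 - ‖α‖ ^ 2) * (1 - ‖s‖ ^ 2) := by
  simp only [← Complex.normSq_eq_norm_sq, Complex.normSq_apply, Complex.add_re, Complex.add_im,
    Complex.mul_re, Complex.mul_im, Complex.conj_re, Complex.conj_im, Complex.one_re,
    Complex.one_im]
  ring

/-- On the circle the conjugate of `μ_{-β}(t)` is `ψ(t̄)` for a Möbius map `ψ` of the disk with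
`ψ(0) = β̄`. The mean value property applies to `L ∘ ψ`. -/
theorem mean_comp_mobius {L : ℂ → ℂ} (hL : Continuous L)
    (hd : DifferentiableOn ℂ L (Metric.ball 0 1)) (β : 𝔻) :
    ((1 / (2 * Real.pi) : ℝ) : ℂ) *
      ∫ θ in (0 : ℝ)..(2 * Real.pi), L (conj (mobius (-β) (Circle.exp θ) : ℂ)) =
      L (conj (β : ℂ)) := by
  have hβ := β.norm_lt_one
  let ψ : ℂ → ℂ := fun s => (s + conj (β : ℂ)) / (1 + β * s)
  have hden : ∀ s : ℂ, ‖s‖ ≤ 1 → 1 + (β : ℂ) * s ≠ 0 := by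
    intro s hs h
    have h1 : ‖(β : ℂ) * s‖ = 1 := by
      rw [eq_neg_of_add_eq_zero_right h, norm_neg, norm_one]
    rw [norm_mul] at h1
    nlinarith [norm_nonneg (β : ℂ), norm_nonneg s]
  have hψ : ∀ s : ℂ, ‖s‖ < 1 → ‖ψ s‖ < 1 := by
    intro s hs
    rw [norm_div, div_lt_one (norm_pos_iff.mpr (hden s hs.le))]
    have h1 := normSq_mobius_identity β s
    have h2 : 0 < (1 - ‖(β : ℂ)‖ ^ 2) * (1 - ‖s‖ ^ 2) :=
      mul_pos (by nlinarith [norm_nonneg (β : ℂ)]) (by nlinarith [norm_nonneg s])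
    exact lt_of_pow_lt_pow_left₀ 2 (norm_nonneg _) (by linarith)
  have hdc : DiffContOnCl ℂ (fun s => L (ψ s)) (Metric.ball 0 |1|) := by
    rw [abs_one]
    constructor
    · refine hd.comp (DifferentiableOn.div (by fun_prop) (by fun_prop) fun s hs =>
        hden s (mem_ball_zero_iff.mp hs).le) fun s hs => ?_
      exact mem_ball_zero_iff.mpr (hψ s (mem_ball_zero_iff.mp hs))
    · rw [closure_ball _ one_ne_zero]
      refine hL.comp_continuousOn (ContinuousOn.div (by fun_prop) (by fun_prop) fun s hs =>
        hden s (mem_closedBall_zero_iff.mp hs))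
  have h1 := hdc.circleAverage
  have hψ0 : ψ 0 = conj (β : ℂ) := by simp [ψ]
  simp only [hψ0, Real.circleAverage] at h1
  -- Conjugation reverses the orientation of the circle; the substitution `θ ↦ 2π - θ` restores it.
  have hsub := intervalIntegral.integral_comp_sub_left (a := 0) (b := 2 * Real.pi)
    (fun θ => L (ψ (circleMap 0 1 θ))) (2 * Real.pi)
  rw [sub_self, sub_zero] at hsub
  rw [← h1, ← hsub, Complex.real_smul, one_div]
  congr 1
  refine intervalIntegral.integral_congr fun θ _ => ?_
  congr 1
  have hmob : (mobius (-β) (Circle.exp θ) : ℂ) = ((Circle.exp θ : ℂ) - (-β : 𝔻)) /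
    (1 - conj ((-β : 𝔻) : ℂ) * Circle.exp θ) := rfl
  have hexp : conj (Circle.exp θ : ℂ) = circleMap 0 1 (2 * Real.pi - θ) := by
    rw [circleMap_zero, Circle.coe_exp, ← Complex.exp_conj]
    simp only [map_mul, Complex.conj_ofReal, Complex.conj_I, Complex.ofReal_one, one_mul]
    rw [Complex.exp_eq_exp_iff_exists_int]
    exact ⟨-1, by push_cast; ring⟩
  rw [hmob, map_div₀, map_sub, map_sub, map_mul, hexp]
  simp [ψ, sub_eq_add_neg]

/-- Two continuous logarithms on the connected circle differ by a constant, since `exp` is a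
covering. The mean shifts by that constant, whose exponential is `1`. -/
theorem geomMean_eq {φ : Symbol m} {ℓ : C(Circle, ℂ)} (hℓ : IsLogDet φ ℓ) :
    geomMean φ = Complex.exp (((1 / (2 * Real.pi) : ℝ) : ℂ) *
      ∫ θ in (0 : ℝ)..(2 * Real.pi), ℓ (Circle.exp θ)) := by
  have h : ∃ ℓ : C(Circle, ℂ), IsLogDet φ ℓ := ⟨ℓ, hℓ⟩
  rw [geomMean, dif_pos h]
  set ℓ' := h.choose
  have hℓ' : IsLogDet φ ℓ' := h.choose_spec
  have hone : ∀ t, Complex.exp (ℓ' t - ℓ t) = 1 := fun t => by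
    rw [Complex.exp_sub, hℓ' t, hℓ t, div_self]
    rw [← hℓ t]
    exact Complex.exp_ne_zero _
  have hcov : IsCoveringMap fun z : ℂ => (⟨_, z.exp_ne_zero⟩ : {z : ℂ // z ≠ 0}) :=
    isCoveringMap_exp
  have hconst : ∀ t, ℓ' t - ℓ t = ℓ' 1 - ℓ 1 := fun t =>
    hcov.const_of_comp (g := fun t : Circle => ℓ' t - ℓ t) (by fun_prop)
      (fun a a' => Subtype.ext (by simp only [hone])) t 1
  have hpi : ((2 * Real.pi : ℝ) : ℂ) ≠ 0 := by exact_mod_cast Real.two_pi_pos.ne'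
  have hint : (∫ θ in (0 : ℝ)..(2 * Real.pi), ℓ' (Circle.exp θ)) =
      (∫ θ in (0 : ℝ)..(2 * Real.pi), ℓ (Circle.exp θ)) +
        ((2 * Real.pi : ℝ) : ℂ) * (ℓ' 1 - ℓ 1) := by
    have : ∀ θ : ℝ, ℓ' (Circle.exp θ) = ℓ (Circle.exp θ) + (ℓ' 1 - ℓ 1) := fun θ => by
      rw [← hconst (Circle.exp θ)]
      ring
    simp_rw [this]
    rw [intervalIntegral.integral_add
      (Continuous.intervalIntegrable (by fun_prop) _ _)
      (Continuous.intervalIntegrable (by fun_prop) _ _)]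
    simp
    ring
  rw [hint, mul_add, Complex.exp_add, ← mul_assoc, one_div, Complex.ofReal_inv,
    inv_mul_cancel₀ hpi, one_mul, hone, mul_one]

/-- The continuous logarithm of `det (a ∘ μ_{-β})` and the value of the geometric mean. -/
theorem isLogDet_and_geomMean {a vp vp' vm vm' : Symbol m} (hav : a = vp * vm)
    (hp : Summable fun n : ℤ => ‖(star vp).coeff n‖) (hpco : (star vp).IsCoanalytic)
    (hp' : Summable fun n : ℤ => ‖(star vp').coeff n‖) (hpco' : (star vp').IsCoanalytic)
    (hpp : vp' * vp = 1)
    (hm : Summable fun n : ℤ => ‖vm.coeff n‖) (hmco : vm.IsCoanalytic)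
    (hm' : Summable fun n : ℤ => ‖vm'.coeff n‖) (hmco' : vm'.IsCoanalytic)
    (hmm : vm * vm' = 1) (β : 𝔻) :
    (∃ ℓ : C(Circle, ℂ), IsLogDet (a.comp (mobius (-β))) ℓ) ∧
    geomMean (a.comp (mobius (-β))) =
      conj (coSeries (star vp) (conj (β : ℂ))).det * (coSeries vm (conj (β : ℂ))).det := by
  obtain ⟨L₁, hc₁, hd₁, he₁⟩ := exists_log_det_coSeries hp hpco hp' hpco'
    (by simpa using congrArg star hpp)
  obtain ⟨L₂, hc₂, hd₂, he₂⟩ := exists_log_det_coSeries hm hmco hm' hmco' hmm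
  have hμ : Continuous fun t => (mobius (-β) t : ℂ) :=
    continuous_subtype_val.comp (mobius (-β)).continuous
  have hcirc : ∀ t : Circle, conj (t : ℂ) ∈ Metric.closedBall (0 : ℂ) 1 := fun t => by
    rw [mem_closedBall_zero_iff, RCLike.norm_conj, Circle.norm_coe]
  have hβ : conj (β : ℂ) ∈ Metric.closedBall (0 : ℂ) 1 := by
    rw [mem_closedBall_zero_iff, RCLike.norm_conj]
    exact β.norm_lt_one.le
  -- The analytic factor enters through its coanalytic adjoint, so its logarithm is conjugated back
  -- before being added to that of the coanalytic factor.
  let ℓ : C(Circle, ℂ) := ⟨fun t => conj (L₁ (conj (mobius (-β) t : ℂ))) +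
    L₂ (conj (mobius (-β) t : ℂ)), by fun_prop⟩
  have hℓ : IsLogDet (a.comp (mobius (-β))) ℓ := by
    intro t
    change Complex.exp (conj (L₁ (conj (mobius (-β) t : ℂ))) +
      L₂ (conj (mobius (-β) t : ℂ))) = (a (mobius (-β) t)).det
    rw [Complex.exp_add, Complex.exp_conj, he₁ _ (hcirc _), he₂ _ (hcirc _),
      coSeries_conj_circle hp hpco, coSeries_conj_circle hm hmco, hav, ContinuousMap.mul_apply,
      Matrix.det_mul, ContinuousMap.star_apply, Matrix.star_eq_conjTranspose,
      Matrix.det_conjTranspose, starRingEnd_apply, star_star]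
  refine ⟨⟨ℓ, hℓ⟩, ?_⟩
  have hm₁ := mean_comp_mobius hc₁ hd₁ β
  have hm₂ := mean_comp_mobius hc₂ hd₂ β
  have hint : (∫ θ in (0 : ℝ)..(2 * Real.pi), ℓ (Circle.exp θ)) =
      conj (∫ θ in (0 : ℝ)..(2 * Real.pi), L₁ (conj (mobius (-β) (Circle.exp θ) : ℂ))) +
        ∫ θ in (0 : ℝ)..(2 * Real.pi), L₂ (conj (mobius (-β) (Circle.exp θ) : ℂ)) := by
    have hconj : conj (∫ θ in (0 : ℝ)..(2 * Real.pi),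
        L₁ (conj (mobius (-β) (Circle.exp θ) : ℂ))) =
        ∫ θ in (0 : ℝ)..(2 * Real.pi), conj (L₁ (conj (mobius (-β) (Circle.exp θ) : ℂ))) := by
      rw [intervalIntegral.integral_of_le Real.two_pi_pos.le,
        intervalIntegral.integral_of_le Real.two_pi_pos.le, integral_conj]
    have hμ' : Continuous fun θ : ℝ => conj (mobius (-β) (Circle.exp θ) : ℂ) :=
      continuous_conj.comp (hμ.comp Circle.exp.continuous)
    rw [hconj]
    exact intervalIntegral.integral_add
      (Continuous.intervalIntegrable (continuous_conj.comp (hc₁.comp hμ')) _ _)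
      (Continuous.intervalIntegrable (hc₂.comp hμ') _ _)
  rw [geomMean_eq hℓ, hint, mul_add, hm₂, Complex.exp_add, he₂ _ hβ]
  congr 1
  rw [← he₁ _ hβ, ← Complex.exp_conj, ← hm₁, map_mul, Complex.conj_ofReal]

end Logarithm

/-! ### Convergence of Blaschke products -/

section Convergence

variable {m : ℕ} (α : ℕ → 𝔻)

theorem norm_blaschkeFactor_sub_one_le (β z : 𝔻) :
    ‖blaschkeFactor β z - 1‖ ≤ (1 - ‖(β : ℂ)‖) * ((1 + ‖(z : ℂ)‖) / (1 - ‖(z : ℂ)‖)) := by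
  have hz := z.norm_lt_one
  have hβ := β.norm_lt_one
  have hz0 := norm_nonneg (z : ℂ)
  have hβ0 := norm_nonneg (β : ℂ)
  by_cases h : β = 0
  · have h1 : blaschkeFactor β z = z := by simp [blaschkeFactor, h]
    rw [h1, h, UnitDisc.coe_zero, norm_zero, sub_zero, one_mul, le_div_iff₀ (by linarith)]
    have h2 : ‖(z : ℂ) - 1‖ ≤ ‖(z : ℂ)‖ + 1 := (norm_sub_le _ _).trans (by simp)
    nlinarith [norm_nonneg ((z : ℂ) - 1)]
  · have hβ1 : (‖(β : ℂ)‖ : ℂ) ≠ 0 := by simpa using h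
    have hd := unitDisc_denom_ne_zero β z
    have hb : blaschkeFactor β z =
        -conj (β : ℂ) / (‖(β : ℂ)‖ : ℂ) * (((z : ℂ) - β) / (1 - conj (β : ℂ) * z)) := by
      simp [blaschkeFactor, h]
    have hsq : conj (β : ℂ) * (β : ℂ) = (‖(β : ℂ)‖ : ℂ) ^ 2 := RCLike.conj_mul _
    -- The unimodular constant in `B_β` is what makes the factor `1 - |β|` split off; the `|β|` in
    -- the denominator cancels against `||β| + β̄z| ≤ |β|(1 + |z|)`.
    have key : blaschkeFactor β z - 1 = -((1 - (‖(β : ℂ)‖ : ℂ)) *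
        (((‖(β : ℂ)‖ : ℂ) + conj (β : ℂ) * z) /
          ((‖(β : ℂ)‖ : ℂ) * (1 - conj (β : ℂ) * z)))) := by
      rw [hb, div_mul_div_comm, mul_div_assoc', ← neg_div, sub_eq_iff_eq_add,
        div_add_one (mul_ne_zero hβ1 hd)]
      congr 1
      linear_combination hsq
    have hden : ‖(β : ℂ)‖ * (1 - ‖(z : ℂ)‖) ≤
        ‖(‖(β : ℂ)‖ : ℂ) * (1 - conj (β : ℂ) * z)‖ := by
      rw [norm_mul, Complex.norm_real, norm_norm]
      refine mul_le_mul_of_nonneg_left ?_ hβ0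
      have h1 := norm_sub_norm_le (1 : ℂ) (conj (β : ℂ) * z)
      rw [norm_one, norm_mul, RCLike.norm_conj] at h1
      nlinarith
    have hnum : ‖(‖(β : ℂ)‖ : ℂ) + conj (β : ℂ) * z‖ ≤ ‖(β : ℂ)‖ * (1 + ‖(z : ℂ)‖) := by
      refine (norm_add_le _ _).trans (le_of_eq ?_)
      rw [norm_mul, RCLike.norm_conj, Complex.norm_real, norm_norm]
      ring
    have hβpos : 0 < ‖(β : ℂ)‖ := lt_of_le_of_ne hβ0 fun h0 => hβ1 (by exact_mod_cast h0.symm)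
    have h1β : ‖(1 : ℂ) - (‖(β : ℂ)‖ : ℂ)‖ = 1 - ‖(β : ℂ)‖ := by
      rw [← Complex.ofReal_one, ← Complex.ofReal_sub, Complex.norm_real,
        Real.norm_of_nonneg (by linarith)]
    rw [key, norm_neg, norm_mul, h1β, norm_div]
    refine mul_le_mul_of_nonneg_left ?_ (by linarith)
    calc _ ≤ ‖(β : ℂ)‖ * (1 + ‖(z : ℂ)‖) / (‖(β : ℂ)‖ * (1 - ‖(z : ℂ)‖)) :=
          div_le_div₀ (by positivity) hnum (mul_pos hβpos (by linarith)) hden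
      _ = _ := mul_div_mul_left _ _ hβpos.ne'

variable {α} in
theorem multipliable_blaschkeFactor (hα : Summable fun j => 1 - ‖(α j : ℂ)‖) (z : 𝔻) :
    Multipliable fun j => blaschkeFactor (α j) z := by
  have h : Multipliable fun j => 1 + (blaschkeFactor (α j) z - 1) :=
    multipliable_one_add_of_summable (Summable.of_nonneg_of_le (fun j => norm_nonneg _)
      (fun j => norm_blaschkeFactor_sub_one_le (α j) z) (hα.mul_right _))
  simpa using h

variable {α} in
theorem tendsto_partialBlaschke (hα : Summable fun j => 1 - ‖(α j : ℂ)‖) (z : 𝔻) :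
    Tendsto (fun N => partialBlaschke α N z) atTop (𝓝 (infiniteBlaschke α z)) :=
  (multipliable_blaschkeFactor hα z).hasProd.tendsto_prod_nat

/-- From `1 - |B_β(z)|² = (1 - |β|²)(1 - |z|²) / |1 - β̄z|²`, with denominator at most `4` and `1 -
|β|² ≥ 1 - |β|`, followed by `1 + x ≤ eˣ`. -/
theorem norm_blaschkeFactor_sq_le (β z : 𝔻) :
    ‖blaschkeFactor β z‖ ^ 2 ≤ Real.exp (-((1 - ‖(z : ℂ)‖ ^ 2) / 4 * (1 - ‖(β : ℂ)‖))) := by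
  have hz := z.norm_lt_one
  have hβ := β.norm_lt_one
  have hz0 := norm_nonneg (z : ℂ)
  have hβ0 := norm_nonneg (β : ℂ)
  have hd := unitDisc_denom_ne_zero β z
  have hdpos := norm_pos_iff.mpr hd
  have h1 := normSq_mobius_identity (-conj (β : ℂ)) z
  simp only [map_neg, Complex.conj_conj, norm_neg, RCLike.norm_conj, neg_mul,
    ← sub_eq_add_neg] at h1
  have h2 : ‖1 - conj (β : ℂ) * z‖ ≤ 2 := by
    refine (norm_sub_le _ _).trans ?_
    rw [norm_one, norm_mul, RCLike.norm_conj]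
    nlinarith
  rw [blaschkeFactor_eq, norm_mul, norm_blaschkeConst, one_mul, norm_div, div_pow]
  refine le_trans ?_ (Real.add_one_le_exp _)
  rw [div_le_iff₀ (by positivity)]
  have h3 : ‖1 - conj (β : ℂ) * z‖ ^ 2 ≤ 4 := by nlinarith
  have h4 : 0 ≤ (1 - ‖(z : ℂ)‖ ^ 2) * (1 - ‖(β : ℂ)‖) :=
    mul_nonneg (by nlinarith) (by linarith)
  have h5 : (1 - ‖(z : ℂ)‖ ^ 2) * (1 - ‖(β : ℂ)‖) ≤
      (1 - ‖(β : ℂ)‖ ^ 2) * (1 - ‖(z : ℂ)‖ ^ 2) := by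
    rw [mul_comm]
    exact mul_le_mul_of_nonneg_right (by nlinarith) (by nlinarith)
  nlinarith

variable {α} in
theorem tendsto_partialBlaschke_zero (hα : ¬ Summable fun j => 1 - ‖(α j : ℂ)‖) (z : 𝔻) :
    Tendsto (fun N => partialBlaschke α N z) atTop (𝓝 0) := by
  have hz := z.norm_lt_one
  set c := (1 - ‖(z : ℂ)‖ ^ 2) / 4 with hc
  have hcpos : 0 < c := by
    have := norm_nonneg (z : ℂ)
    rw [hc]
    nlinarith
  have hsum : Tendsto (fun N => ∑ j ∈ Finset.range N, (1 - ‖(α j : ℂ)‖)) atTop atTop :=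
    (not_summable_iff_tendsto_nat_atTop_of_nonneg
      fun j => sub_nonneg.mpr (α j).norm_lt_one.le).mp hα
  have hbound : ∀ N, ‖partialBlaschke α N z‖ ^ 2 ≤
      Real.exp (-(c * ∑ j ∈ Finset.range N, (1 - ‖(α j : ℂ)‖))) := by
    intro N
    rw [partialBlaschke, norm_prod, ← Finset.prod_pow, Finset.mul_sum, ← Finset.sum_neg_distrib,
      Real.exp_sum]
    exact Finset.prod_le_prod (fun j _ => by positivity)
      fun j _ => norm_blaschkeFactor_sq_le (α j) z
  have hlim : Tendsto (fun N => Real.exp (-(c * ∑ j ∈ Finset.range N, (1 - ‖(α j : ℂ)‖))))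
      atTop (𝓝 0) :=
    Real.tendsto_exp_neg_atTop_nhds_zero.comp (hsum.const_mul_atTop hcpos)
  have hsq := squeeze_zero (fun N => by positivity) hbound hlim
  rw [tendsto_zero_iff_norm_tendsto_zero]
  have h2 := hsq.sqrt
  simpa using h2

/-! ### Strong convergence of the projections -/

theorem norm_apply_eq_of_adjoint_apply {E : Type*} [NormedAddCommGroup E]
    [InnerProductSpace ℂ E] [CompleteSpace E] {A : E →L[ℂ] E} {g : E}
    (h : ContinuousLinearMap.adjoint A (A g) = g) : ‖A g‖ = ‖g‖ := by
  have h1 : inner ℂ (A g) (A g) = inner ℂ g g := by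
    rw [← ContinuousLinearMap.adjoint_inner_right, h]
  rw [inner_self_eq_norm_sq_to_K, inner_self_eq_norm_sq_to_K] at h1
  have h2 : ‖A g‖ ^ 2 = ‖g‖ ^ 2 := by exact_mod_cast h1
  exact (pow_left_inj₀ (norm_nonneg _) (norm_nonneg _) two_ne_zero).mp h2

theorem norm_toeplitz_partialSymbol (N : ℕ) (g : H2 m) :
    ‖toeplitz (partialSymbol m α N) g‖ = ‖g‖ := by
  refine norm_apply_eq_of_adjoint_apply ?_
  rw [adjoint_toeplitz]
  exact congrArg (fun A : H2 m →L[ℂ] H2 m => A g) (toeplitz_star_partialSymbol_comp α N)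

/-- `f - T(u_N)T(ū_N) f` lies in `K_{u_N}`, so it vanishes for `f` orthogonal to `K_{u_N}`. In
particular `u_N H²` is closed. -/
theorem orthogonal_modelSpace_partialBlaschke (N : ℕ) :
    (modelSpace m (partialBlaschke α N))ᗮ = mulH2 m (partialBlaschke α N) := by
  refine le_antisymm (fun f hf => ?_) (Submodule.le_orthogonal_orthogonal _)
  rw [mem_mulH2_partialBlaschke_iff]
  set g := toeplitz (star (partialSymbol m α N)) f with hg
  refine ⟨g, ?_⟩
  have hTT : toeplitz (star (partialSymbol m α N)) (toeplitz (partialSymbol m α N) g) = g :=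
    congrArg (fun A : H2 m →L[ℂ] H2 m => A g) (toeplitz_star_partialSymbol_comp α N)
  have h1 : f - toeplitz (partialSymbol m α N) g ∈ modelSpace m (partialBlaschke α N) := by
    rw [mem_modelSpace_partialBlaschke_iff, map_sub, hTT, ← hg, sub_self]
  have h2 : toeplitz (partialSymbol m α N) g ∈ (modelSpace m (partialBlaschke α N))ᗮ :=
    Submodule.le_orthogonal_orthogonal _ ((mem_mulH2_partialBlaschke_iff α N _).mpr ⟨g, rfl⟩)
  have h3 := Submodule.inner_right_of_mem_orthogonal h1 (Submodule.sub_mem _ hf h2)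
  rw [inner_self_eq_zero, sub_eq_zero] at h3
  exact h3.symm

theorem monotone_modelSpace : Monotone fun N => modelSpace m (partialBlaschke α N) :=
  monotone_nat_of_le_succ fun N => by
    rw [modelSpace_succ]
    exact le_sup_left

/-- Projections onto an increasing sequence converge strongly to the projection onto the closure of
the union, which is the complement of the intersection of the complements. -/
theorem tendsto_one_sub_starProjection {E : Type*} [NormedAddCommGroup E]
    [InnerProductSpace ℂ E] [CompleteSpace E] (K : ℕ → Submodule ℂ E)
    [∀ N, (K N).HasOrthogonalProjection] (hK : Monotone K) {V : Submodule ℂ E}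
    (hV : ⨅ N, (K N)ᗮ = V) (f : E) :
    Tendsto (fun N => (1 - (K N).starProjection) f) atTop (𝓝 ((1 - Vᗮ.starProjection) f)) := by
  have h1 := Submodule.starProjection_tendsto_closure_iSup K hK f
  have h2 : (⨆ N, K N).topologicalClosure = Vᗮ := by
    rw [← Submodule.orthogonal_orthogonal_eq_closure, ← Submodule.iInf_orthogonal, hV]
  have h3 : (⨆ N, K N).topologicalClosure.starProjection f = Vᗮ.starProjection f := by
    congr 2
  rw [h3] at h1
  exact tendsto_const_nhds.sub h1

theorem tendsto_one_sub_starProjection_zero {E : Type*} [NormedAddCommGroup E]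
    [InnerProductSpace ℂ E] [CompleteSpace E] (K : ℕ → Submodule ℂ E)
    [∀ N, (K N).HasOrthogonalProjection] (hK : Monotone K) (hV : ⨅ N, (K N)ᗮ = ⊥) (f : E) :
    Tendsto (fun N => (1 - (K N).starProjection) f) atTop (𝓝 0) := by
  have h := tendsto_one_sub_starProjection K hK hV f
  have h1 : f ∈ (⊥ : Submodule ℂ E)ᗮ := by simp
  rwa [sub_apply, one_apply_eq_self, Submodule.starProjection_eq_self_iff.mpr h1,
    sub_self] at h

theorem norm_diskValue_le (f : H2 m) (z : 𝔻) :
    ‖diskValue f z‖ ≤ (1 - ‖(z : ℂ)‖)⁻¹ * ‖f‖ := by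
  refine tsum_of_norm_bounded
    ((hasSum_geometric_of_lt_one (norm_nonneg _) z.norm_lt_one).mul_right ‖f‖) fun n => ?_
  rw [norm_smul, norm_pow]
  have := norm_coeffCLM_le n (f : L2 m)
  gcongr
  exact this

-- If `f = u_N g_N` for all `N`, then `‖g_N‖ = ‖f‖`, so `‖f(z)‖ ≤ |u_N(z)| ‖f‖ / (1 - |z|)`, which
-- tends to zero.
variable {α} in
theorem iInf_mulH2_eq_bot (hα : ¬ Summable fun j => 1 - ‖(α j : ℂ)‖) :
    ⨅ N, mulH2 m (partialBlaschke α N) = ⊥ := by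
  rw [Submodule.eq_bot_iff]
  intro f hf
  rw [Submodule.mem_iInf] at hf
  refine ext_diskValue fun z => ?_
  have h0 : diskValue (0 : H2 m) z = 0 := by simp [diskValue]
  rw [h0, ← norm_le_zero_iff]
  have hlim : Tendsto (fun N => ‖partialBlaschke α N z‖ * ((1 - ‖(z : ℂ)‖)⁻¹ * ‖f‖)) atTop
      (𝓝 0) := by
    have := (tendsto_partialBlaschke_zero hα z).norm.mul_const ((1 - ‖(z : ℂ)‖)⁻¹ * ‖f‖)
    simpa using this
  refine ge_of_tendsto' hlim fun N => ?_
  obtain ⟨g, rfl⟩ := (mem_mulH2_partialBlaschke_iff α N f).mp (hf N)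
  rw [diskValue_toeplitz_partialSymbol, norm_smul, norm_toeplitz_partialSymbol]
  exact mul_le_mul_of_nonneg_left (norm_diskValue_le g z) (norm_nonneg _)

/-- The Banach-Alaoglu theorem in the dual space; an ultrafilter finer than `atTop` takes the place
of a weakly convergent subsequence. -/
theorem exists_tendsto_inner_hyperfilter {E : Type*} [NormedAddCommGroup E]
    [InnerProductSpace ℂ E] [CompleteSpace E] {g : ℕ → E} {C : ℝ} (hg : ∀ N, ‖g N‖ ≤ C) :
    ∃ g₀ : E, ∀ y, Tendsto (fun N => inner ℂ y (g N)) (hyperfilter ℕ) (𝓝 (inner ℂ y g₀)) := by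
  let φ : ℕ → WeakDual ℂ E := fun N => StrongDual.toWeakDual (InnerProductSpace.toDual ℂ E (g N))
  have hcomp := WeakDual.isCompact_closedBall (𝕜 := ℂ) (E := E) 0 C
  have hmem : ∀ N, φ N ∈ WeakDual.toStrongDual ⁻¹' Metric.closedBall (0 : StrongDual ℂ E) C := by
    intro N
    rw [Set.mem_preimage, Metric.mem_closedBall, dist_zero_right]
    exact ((InnerProductSpace.toDual ℂ E).norm_map (g N)).le.trans (hg N)
  obtain ⟨ψ, -, hψ⟩ := hcomp.ultrafilter_le_nhds' ((hyperfilter ℕ).map φ)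
    (by rw [Ultrafilter.mem_map]; exact Filter.univ_mem' hmem)
  refine ⟨(InnerProductSpace.toDual ℂ E).symm (WeakDual.toStrongDual ψ), fun y => ?_⟩
  have h1 : Tendsto (fun N => φ N y) (hyperfilter ℕ) (𝓝 (ψ y)) :=
    ((WeakDual.eval_continuous y).tendsto ψ).comp hψ
  have h2 : ψ y = inner ℂ ((InnerProductSpace.toDual ℂ E).symm (WeakDual.toStrongDual ψ)) y :=
    (InnerProductSpace.toDual_symm_apply).symm
  have h3 : ∀ N, φ N y = inner ℂ (g N) y := fun N => rfl
  rw [h2] at h1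
  simp only [h3] at h1
  have h4 := (continuous_conj.tendsto _).comp h1
  simpa only [Function.comp_def, inner_conj_symm] using h4

/-- Weak sequential compactness of balls of `H²`, in terms of values in the disk. -/
theorem exists_weak_limit {g : ℕ → H2 m} {C : ℝ} (hg : ∀ N, ‖g N‖ ≤ C) :
    ∃ g₀ : H2 m, ∀ (z : 𝔻) (x : Vec m), Tendsto (fun N => inner ℂ x (diskValue (g N) z))
      (hyperfilter ℕ) (𝓝 (inner ℂ x (diskValue g₀ z))) := by
  obtain ⟨g₀, hg₀⟩ := exists_tendsto_inner_hyperfilter hg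
  refine ⟨g₀, fun z x => ?_⟩
  have h := hg₀ (kernel z x)
  simp only [inner_kernel_left] at h
  exact h

theorem partialBlaschke_add (N M : ℕ) (z : 𝔻) :
    partialBlaschke α (N + M) z =
      partialBlaschke α N z * partialBlaschke (fun j => α (N + j)) M z := by
  simp only [partialBlaschke, Finset.prod_range_add]

-- If `f = u_N g_N` for all `N`, the `g_N` have norm `‖f‖`, and a weak limit `g₀` satisfies `f = B
-- g₀` pointwise in the disk. Conversely, for `f = Bg` and fixed `N`, the finite tail products times
-- `g` have norm `‖g‖`, and a weak limit `h` satisfies `f = u_N h`. Boundary values of `B` never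
-- enter.
variable {α} in
theorem iInf_mulH2_eq (hα : Summable fun j => 1 - ‖(α j : ℂ)‖) :
    ⨅ N, mulH2 m (partialBlaschke α N) = mulH2 m (infiniteBlaschke α) := by
  have hle : (hyperfilter ℕ : Filter ℕ) ≤ atTop := Nat.hyperfilter_le_atTop
  have hlim : ∀ z, Tendsto (fun N => partialBlaschke α N z) (hyperfilter ℕ)
      (𝓝 (infiniteBlaschke α z)) := fun z => (tendsto_partialBlaschke hα z).mono_left hle
  refine le_antisymm (fun f hf => ?_) (le_iInf fun N => ?_)
  · rw [Submodule.mem_iInf] at hf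
    choose g hg using fun N => (mem_mulH2_partialBlaschke_iff α N f).mp (hf N)
    obtain ⟨g₀, hg₀⟩ := exists_weak_limit (g := g) (C := ‖f‖) fun N => by
      rw [← norm_toeplitz_partialSymbol α N (g N), hg N]
    refine ⟨g₀, fun z => ext_inner_left ℂ fun x => ?_⟩
    rw [inner_smul_right]
    refine tendsto_nhds_unique ?_ ((hlim z).mul (hg₀ z x))
    refine tendsto_const_nhds.congr fun N => ?_
    rw [← inner_smul_right, ← diskValue_toeplitz_partialSymbol, hg N]
  · rintro f ⟨g, hg⟩
    obtain ⟨h, hh⟩ := exists_weak_limit (C := ‖g‖)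
      (g := fun M => toeplitz (partialSymbol m (fun j => α (N + j)) M) g)
      fun M => (norm_toeplitz_partialSymbol _ M g).le
    refine ⟨h, fun z => ext_inner_left ℂ fun x => ?_⟩
    rw [hg z, inner_smul_right, inner_smul_right]
    have hshift : Tendsto (fun M => partialBlaschke α (N + M) z) (hyperfilter ℕ)
        (𝓝 (infiniteBlaschke α z)) := by
      refine ((tendsto_partialBlaschke hα z).comp ?_).mono_left hle
      exact tendsto_atTop_mono (fun M => Nat.le_add_left M N) tendsto_id
    refine tendsto_nhds_unique (hshift.mul_const _) (((hh z x).const_mul _).congr fun M => ?_)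
    rw [diskValue_toeplitz_partialSymbol, inner_smul_right, partialBlaschke_add, mul_assoc]

variable {α} in
theorem tendsto_projQ_zero (hα : ¬ Summable fun j => 1 - ‖(α j : ℂ)‖) (f : H2 m) :
    Tendsto (fun N => projQ m (partialBlaschke α N) f) atTop (𝓝 0) := by
  refine tendsto_one_sub_starProjection_zero _ (monotone_modelSpace α) ?_ f
  simp only [orthogonal_modelSpace_partialBlaschke]
  exact iInf_mulH2_eq_bot hα

variable {α} in
theorem tendsto_projQ (hα : Summable fun j => 1 - ‖(α j : ℂ)‖) (f : H2 m) :
    Tendsto (fun N => projQ m (partialBlaschke α N) f) atTop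
      (𝓝 (projQ m (infiniteBlaschke α) f)) := by
  refine tendsto_one_sub_starProjection _ (monotone_modelSpace α) ?_ f
  simp only [orthogonal_modelSpace_partialBlaschke]
  exact iInf_mulH2_eq hα

end Convergence

/-! ### The determinant formula -/

section Main

variable {m : ℕ}

theorem norm_coeff_star (a : Symbol m) (n : ℤ) : ‖(star a).coeff n‖ = ‖a.coeff (-n)‖ := by
  rw [coeff_star, Matrix.norm_conjTranspose]

theorem InWienerKrein.star {a : Symbol m} (h : InWienerKrein a) : InWienerKrein (star a) := by
  constructor
  · simp only [norm_coeff_star]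
    exact (Equiv.neg ℤ).summable_iff.mpr h.1
  · have h2 := (Equiv.neg ℤ).summable_iff.mpr h.2
    refine h2.congr fun n => ?_
    simp [norm_coeff_star]

theorem detCompress_toeplitz_modelSpace_of_isAnalytic (α : ℕ → 𝔻) {w : Symbol m}
    (hw : Summable fun n : ℤ => ‖(star w).coeff n‖) (han : w.IsAnalytic) (N : ℕ) :
    detCompress (toeplitz w) (finiteModelSpace α m N) =
      ∏ j ∈ Finset.range N, conj (coSeries (star w) (conj (α j : ℂ))).det := by
  have h : toeplitz w = ContinuousLinearMap.adjoint (toeplitz (star w)) := by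
    rw [adjoint_toeplitz, star_star]
  rw [h, detCompress_adjoint, detCompress_toeplitz_modelSpace α hw han.star, map_prod]

end Main

end ModelSpace

end

/-! ### The exact determinant formula and its limit -/

open ModelSpace in
theorem theorem1p2 (m : ℕ) (a : Symbol m) (wm wp vp vm : (Symbol m)ˣ)
    (ha : InWienerKrein a)
    (hwm : IsMinusFactor wm) (hwp : IsPlusFactor wp)
    (hvp : IsPlusFactor vp) (hvm : IsMinusFactor vm)
    (haw : a = (wm : Symbol m) * wp) (hav : a = (vp : Symbol m) * vm)
    (b c : Symbol m)
    (hb : b = (vm : Symbol m) * ((wp⁻¹ : (Symbol m)ˣ) : Symbol m))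
    (hc : c = ((wm⁻¹ : (Symbol m)ˣ) : Symbol m) * vp)
    (α : ℕ → 𝔻) :
    -- all determinants and geometric means involved are well defined
    (∀ N, FiniteDimensional ℂ (modelSpace m (partialBlaschke α N))) ∧
    (∀ β : 𝔻, ∃ ℓ : C(Circle, ℂ), IsLogDet (a.comp (mobius (-β))) ℓ) ∧
    -- `d = det (I - H(b) H(c̃))`
    ∃ d : ℂ, IsDetOneSub (hankelProduct b c) d ∧ d ≠ 0 ∧
      ((¬ Summable fun j => 1 - ‖(α j : ℂ)‖) →
        (∀ z : 𝔻, Tendsto (fun N => partialBlaschke α N z) atTop (𝓝 0)) ∧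
        (∀ f : H2 m, Tendsto (fun N => projQ m (partialBlaschke α N) f) atTop (𝓝 0)) ∧
        Tendsto (normalizedDet a α) atTop (𝓝 (1 / d))) ∧
      ((Summable fun j => 1 - ‖(α j : ℂ)‖) →
        (∀ z : 𝔻, Multipliable fun j => blaschkeFactor (α j) z) ∧
        (∀ z : 𝔻, Tendsto (fun N => partialBlaschke α N z) atTop (𝓝 (infiniteBlaschke α z))) ∧
        (∀ f : H2 m, Tendsto (fun N => projQ m (partialBlaschke α N) f) atTop
          (𝓝 (projQ m (infiniteBlaschke α) f))) ∧
        -- `dB = det (I - Q_B H(b) H(c̃) Q_B)`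
        ∃ dB : ℂ,
          IsDetOneSub (projQ m (infiniteBlaschke α) ∘L hankelProduct b c ∘L
            projQ m (infiniteBlaschke α)) dB ∧
          Tendsto (normalizedDet a α) atTop (𝓝 (dB / d))) := by
  have hunits : wm * wp = vp * vm := Units.ext (haw.symm.trans hav)
  -- `bc = v₋ (w₋ w₊)⁻¹ v₊ = v₋ (v₊ v₋)⁻¹ v₊ = 1`.
  have hbc : b * c = 1 := by
    have h : vm * wp⁻¹ * (wm⁻¹ * vp) = 1 := by
      have h1 : wp⁻¹ * wm⁻¹ = vm⁻¹ * vp⁻¹ := by rw [← mul_inv_rev, hunits, mul_inv_rev]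
      rw [mul_assoc, ← mul_assoc wp⁻¹, h1]
      group
    rw [hb, hc]
    exact congrArg Units.val h
  have hlog := fun β => isLogDet_and_geomMean (m := m) hav hvp.mem.star.1 hvp.analytic.star
    hvp.mem_inv.star.1 hvp.analytic_inv.star vp.inv_mul hvm.mem.1 hvm.coanalytic hvm.mem_inv.1
    hvm.coanalytic_inv vm.mul_inv β
  have hS : Summable fun p => ‖outerHankel b (monomialBasis m p)‖ ^ 2 := by
    rw [hb]
    exact summable_norm_outerHankel_mul_sq hvm.coanalytic.preservesH2Compl hwp.mem_inv.2
  have hR : Summable fun p =>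
      ‖ContinuousLinearMap.adjoint (innerHankel c) (monomialBasis m p)‖ ^ 2 := by
    rw [adjoint_innerHankel, hc, star_mul]
    exact summable_norm_outerHankel_mul_sq hvp.analytic.star.preservesH2Compl hwm.mem_inv.star.2
  have hK := hankelProduct_eq b c
  set X : H2 m →L[ℂ] H2 m := toeplitz ((vp⁻¹ : (Symbol m)ˣ) : Symbol m) ∘L toeplitz a ∘L
    toeplitz ((vm⁻¹ : (Symbol m)ˣ) : Symbol m) with hXdef
  -- With `I - K = T(b)T(c)` the product collapses from the inside: `T(c)T(v₊⁻¹) = T(w₋⁻¹)`, then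
  -- `T(w₋⁻¹)T(a) = T(w₊)`, then `T(b)T(w₊) = T(v₋)`.
  have hX : (1 - hankelProduct b c) ∘L X = 1 := by
    have e1 : toeplitz c ∘L toeplitz ((vp⁻¹ : (Symbol m)ˣ) : Symbol m) =
        toeplitz ((wm⁻¹ : (Symbol m)ˣ) : Symbol m) := by
      rw [← toeplitz_mul_of_right hvp.analytic_inv.preservesH2, hc, mul_assoc, vp.mul_inv, mul_one]
    have e2 : toeplitz ((wm⁻¹ : (Symbol m)ˣ) : Symbol m) ∘L toeplitz a = toeplitz wp := by
      rw [← toeplitz_mul_of_left hwm.coanalytic_inv.preservesH2Compl, haw, ← mul_assoc,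
        wm.inv_mul, one_mul]
    have e3 : toeplitz b ∘L toeplitz wp = toeplitz vm := by
      rw [← toeplitz_mul_of_right hwp.analytic.preservesH2, hb, mul_assoc, wp.inv_mul, mul_one]
    have e4 : toeplitz vm ∘L toeplitz ((vm⁻¹ : (Symbol m)ˣ) : Symbol m) = 1 := by
      rw [← toeplitz_mul_of_left hvm.coanalytic.preservesH2Compl, vm.mul_inv, toeplitz_one]
    rw [one_sub_hankelProduct hbc, hXdef, ContinuousLinearMap.comp_assoc,
      ← ContinuousLinearMap.comp_assoc (toeplitz c), e1, ← ContinuousLinearMap.comp_assoc _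
      (toeplitz a), e2, ← ContinuousLinearMap.comp_assoc, e3, e4]
  have hTa : toeplitz a = toeplitz vp ∘L X ∘L toeplitz vm := by
    have e1 : toeplitz vp ∘L toeplitz ((vp⁻¹ : (Symbol m)ˣ) : Symbol m) = 1 := by
      rw [← toeplitz_mul_of_right hvp.analytic_inv.preservesH2, vp.mul_inv, toeplitz_one]
    have e2 : toeplitz ((vm⁻¹ : (Symbol m)ˣ) : Symbol m) ∘L toeplitz vm = 1 := by
      rw [← toeplitz_mul_of_left hvm.coanalytic_inv.preservesH2Compl, vm.inv_mul, toeplitz_one]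
    rw [hXdef, ContinuousLinearMap.comp_assoc, ContinuousLinearMap.comp_assoc, e2,
      ← ContinuousLinearMap.comp_assoc, e1]
    rfl
  have hQn : ∀ (u : 𝔻 → ℂ) (x : H2 m), ‖projQ m u x‖ ≤ ‖x‖ := fun u x =>
    norm_one_sub_starProjection_le (modelSpace m u) x
  have hQs : ∀ u : 𝔻 → ℂ, IsSelfAdjoint (projQ m u) := fun u =>
    isSelfAdjoint_one_sub_starProjection (modelSpace m u)
  obtain ⟨d, hd⟩ : ∃ d, IsDetOneSub (hankelProduct b c) d := by
    rw [hK]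
    exact exists_isDetOneSub_comp (monomialBasis m) hS hR
  have hd0 : d ≠ 0 := by
    rw [hK] at hX hd
    exact det_ne_zero_of_inverse (monomialBasis m) hS hR hX hd
  -- `D u` is `det(I - Q_u K Q_u)` for every `u`, so one function covers the partial products and
  -- the infinite product.
  choose D hD using fun u : 𝔻 → ℂ =>
    exists_isDetOneSub_conj (monomialBasis m) hS hR (hQn u) (hQs u)
  have hnorm : ∀ N, normalizedDet a α N = D (partialBlaschke α N) / d := by
    intro N
    have h1 : normalizedDet a α N = detCompress (toeplitz a) (finiteModelSpace α m N) *
      ∏ j ∈ Finset.range N, (geomMean (a.comp (mobius (-(α j)))))⁻¹ := rfl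
    have h2 : d * detCompress X (finiteModelSpace α m N) = D (partialBlaschke α N) := by
      have hDN := hD (partialBlaschke α N)
      rw [← hK] at hDN
      have : (finiteModelSpace α m N).1.HasOrthogonalProjection :=
        inferInstanceAs (modelSpace m (partialBlaschke α N)).HasOrthogonalProjection
      exact hd.jacobi hX (finiteModelSpace α m N) hDN
    -- The compression is multiplicative on `T(v₊) X T(v₋)` because the model space is invariant
    -- under `T(v₋)` and under the adjoint of `T(v₊)`.
    have h3 : detCompress (toeplitz a) (finiteModelSpace α m N) =
        (∏ j ∈ Finset.range N, geomMean (a.comp (mobius (-(α j))))) *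
          detCompress X (finiteModelSpace α m N) := by
      rw [hTa, detCompress_comp_of_adjoint_mapsTo, detCompress_comp_of_mapsTo,
        detCompress_toeplitz_modelSpace_of_isAnalytic α hvp.mem.star.1 hvp.analytic,
        detCompress_toeplitz_modelSpace α hvm.mem.1 hvm.coanalytic,
        Finset.prod_congr rfl fun j _ => (hlog (α j)).2, Finset.prod_mul_distrib]
      · ring
      · exact fun x hx => toeplitz_mem_modelSpace α hvm.coanalytic.preservesH2Compl N hx
      · intro x hx
        rw [adjoint_toeplitz]
        exact toeplitz_mem_modelSpace α hvp.analytic.star.preservesH2Compl N hx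
    have h4 : ∏ j ∈ Finset.range N, geomMean (a.comp (mobius (-(α j)))) ≠ 0 := by
      refine Finset.prod_ne_zero_iff.mpr fun j _ => ?_
      obtain ⟨ℓ, hℓ⟩ := (hlog (α j)).1
      rw [geomMean_eq hℓ]
      exact Complex.exp_ne_zero _
    rw [h1, h3, Finset.prod_inv_distrib, ← h2]
    field_simp
  have hnorm' : normalizedDet a α = fun N => D (partialBlaschke α N) / d := funext hnorm
  refine ⟨finiteDimensional_modelSpace α, fun β => (hlog β).1, d, hd, hd0, fun hα => ?_,
    fun hα => ?_⟩
  · refine ⟨tendsto_partialBlaschke_zero hα, tendsto_projQ_zero hα, ?_⟩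
    rw [hnorm']
    refine Tendsto.div_const ?_ d
    -- The strong limit of the `Q_{u_N}` is zero, for which the determinant is `1`.
    exact tendsto_det_conj (monomialBasis m) hS hR (N := 0) (tendsto_projQ_zero hα)
      (fun N => hQn _) (by simp) (fun N => hQs _) (IsSelfAdjoint.zero _) (fun N => hD _)
      (by simpa using isDetOneSub_zero)
  · refine ⟨multipliable_blaschkeFactor hα, tendsto_partialBlaschke hα, tendsto_projQ hα,
      D (infiniteBlaschke α), by rw [hK]; exact hD _, ?_⟩
    rw [hnorm']
    refine Tendsto.div_const ?_ d
    exact tendsto_det_conj (monomialBasis m) hS hR (tendsto_projQ hα)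
      (fun N => hQn _) (hQn _) (fun N => hQs _) (hQs _) (fun N => hD _) (hD _)
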